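/- Let $\beta>0$ be a constant, and let $v(t,x)\in\mathbb{R}^3$ (background flow) and $\alpha(t,x)\in\mathbb{R}$ (mean helicity; $\alpha\equiv 0$ is allowed) be smooth and bounded on $[0,\infty)\times\mathbb{R}^3$. Consider $$\partial_t B=\nabla\times(v\times B)+\nabla\times(\alpha B)+\beta\nabla^2B \qquad (1)$$ on $\mathbb{R}^3$, and the constrained system with electromotive force $\mathcal{E}=\alpha B-\beta\nabla\times B$, $$\partial_t B=\nabla\times(v\times B)+\nabla\times\mathcal{E},\qquad \nabla\cdot B=0. \qquad (2)$$ A solution on a time interval $J\ni 0$ in $[0,\infty)$ is a field that is smooth on $J\times\mathbb{R}^3$ and satisfies the equation pointwise. It has finite energy if $\|B(t)\|_{L^2}$ is finite, locally uniformly in $t\in J$. 1. (Well-posedness.) Both (1), for arbitrary data, and (2), for divergence-free data, are well posed in the $L^2$ norm: there are constants $C,a$, depending only on $v,\alpha,\beta$, such that for every smooth $f\in L^2(\mathbb{R}^3;\mathbb{R}^3)$ (divergence-free in case (2)) there is a finite-energy solution on $[0,\infty)$ with $B(0)=f$ and $\|B(t)\|_{L^2}\le Ce^{at}\|f\|_{L^2}$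 for all $t\ge 0$; and two finite-energy solutions with the same initial value on any such time interval $J$ (nondegenerate and containing $0$) coincide. On smooth divergence-free fields the right-hand sides of (1) and (2) agree. 2. (Constraint.) For every solution of (1), $C_1=\nabla\cdot B$ satisfies $\partial_tC_1=\beta\nabla^2C_1$. If the solution has finite energy and $C_1=0$ at $t=0$, then $C_1=0$ for all $t\in J$. 3. (Modes.) Freeze $v$ and $\alpha$ at any point $(t_0,x_0)$, $t_0\ge 0$, and let $k\in\mathbb{R}^3$, $\omega\in\mathbb{C}$, $\Omega=\omega+v\cdot k-i\beta|k|^2$ and $$\mathcal{N}=\begin{pmatrix}\Omega&\alpha k_3&-\alpha k_2\\-\alpha k_3&\Omega&\alpha k_1\\ \alpha k_2&-\alpha k_1&\Omega\end{pmatrix}.$$ If $k\cdot b=0$, the plane wave $b\,e^{i(\omega t+k\cdot x)}$ solves the frozen equation (1) if and only if $\mathcal{N}b=0$. Moreover $\det\mathcal{N}=\Omega(\Omega^2+\alpha^2|k|^2)$, and this vanishes exactly when $\omega$ is one of $$\Omega_0=-v\cdot k+i\beta|k|^2,\qquad \Omega_\pm=-v\cdot k+i|k|(\beta|k|\pm|\alpha|).$$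 For $k\ne 0$ the nonzero plane waves with $k\cdot b=0$ that solve the frozen equation have exactly the frequencies $\Omega_\pm$; every nonzero plane-wave solution of the frozen equation (1), divergence-free or not, has $\operatorname{Im}\omega\in\{\operatorname{Im}\Omega_0,\operatorname{Im}\Omega_+,\operatorname{Im}\Omega_-\}$. 4. (High frequency.) For every $\varepsilon>0$ there is $K$ such that for all $|k|\ge K$ and all $(t_0,x_0)$ with $t_0\ge 0$, each $\omega\in\{\Omega_0,\Omega_+,\Omega_-\}$ satisfies $\operatorname{Im}\omega>0$ and $|\operatorname{Im}\omega-\beta|k|^2|\le\varepsilon\,\beta|k|^2$. -/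

import Mathlib

open Set MeasureTheory
open scoped ContDiff Matrix

/-- Vectors with three components in `𝕜`; physical space is `Vec3 ℝ`. -/
abbrev Vec3 (𝕜 : Type) : Type := EuclideanSpace 𝕜 (Fin 3)

noncomputable section

/-! ### Vector calculus on `ℝ³`, for fields with real (`𝕜 = ℝ`) or complex (`𝕜 = ℂ`) components -/

/-- The partial derivative `∂ᵢ g`. -/
def partialDeriv {F : Type} [NormedAddCommGroup F] [NormedSpace ℝ F]
    (i : Fin 3) (g : Vec3 ℝ → F) (x : Vec3 ℝ) : F :=
  fderiv ℝ g x (EuclideanSpace.single i 1)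

/-- The divergence `∇·B`. -/
def divergence {𝕜 : Type} [RCLike 𝕜] (B : Vec3 ℝ → Vec3 𝕜) (x : Vec3 ℝ) : 𝕜 :=
  ∑ i : Fin 3, partialDeriv i (fun y => B y i) x

/-- The curl `∇×B`. -/
def curl {𝕜 : Type} [RCLike 𝕜] (B : Vec3 ℝ → Vec3 𝕜) (x : Vec3 ℝ) : Vec3 𝕜 :=
  !₂[partialDeriv 1 (fun y => B y 2) x - partialDeriv 2 (fun y => B y 1) x,
     partialDeriv 2 (fun y => B y 0) x - partialDeriv 0 (fun y => B y 2) x,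
     partialDeriv 0 (fun y => B y 1) x - partialDeriv 1 (fun y => B y 0) x]

/-- The cross product `v×b` of a real vector `v` with a real or complex vector `b`. -/
def cross {𝕜 : Type} [RCLike 𝕜] (v : Vec3 ℝ) (b : Vec3 𝕜) : Vec3 𝕜 :=
  WithLp.toLp 2 ((fun i => (v i : 𝕜)) ⨯₃ WithLp.ofLp b)

/-! ### The dynamo equation (right-hand sides at a fixed time) -/

/-- The right-hand side `∇×(v×B) + ∇×(αB) + β∇²B`. -/
def inductionRHS {𝕜 : Type} [RCLike 𝕜] (v : Vec3 ℝ → Vec3 ℝ) (α : Vec3 ℝ → ℝ) (β : ℝ)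
    (B : Vec3 ℝ → Vec3 𝕜) (x : Vec3 ℝ) : Vec3 𝕜 :=
  curl (fun y => cross (v y) (B y)) x + curl (fun y => α y • B y) x
    + β • Laplacian.laplacian B x

/-- The diffusive electromotive force `αB - β∇×B`. -/
def electromotiveForce {𝕜 : Type} [RCLike 𝕜] (α : Vec3 ℝ → ℝ) (β : ℝ)
    (B : Vec3 ℝ → Vec3 𝕜) (x : Vec3 ℝ) : Vec3 𝕜 :=
  α x • B x - β • curl B x

/-- The right-hand side `∇×(v×B) + ∇×(αB - β∇×B)`. -/
def dynamoRHS {𝕜 : Type} [RCLike 𝕜] (v : Vec3 ℝ → Vec3 ℝ) (α : Vec3 ℝ → ℝ) (β : ℝ)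
    (B : Vec3 ℝ → Vec3 𝕜) (x : Vec3 ℝ) : Vec3 𝕜 :=
  curl (fun y => cross (v y) (B y)) x + curl (electromotiveForce α β B) x

/-! ### The initial-value problem -/

/-- A nondegenerate interval of nonnegative times containing the initial time `0`, such as
`[0,∞)`, `[0,T]` or `[0,T)`. -/
def IsTimeInterval (J : Set ℝ) : Prop :=
  (0 : ℝ) ∈ J ∧ J ⊆ Ici 0 ∧ J.OrdConnected ∧ J.Nontrivial

/-- `B` is a smooth solution (up to and including `t = 0`) of `∂ₜB = R(t, B(t))` on `J × ℝ³`. -/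
def IsSmoothSolution (R : ℝ → (Vec3 ℝ → Vec3 ℝ) → Vec3 ℝ → Vec3 ℝ) (J : Set ℝ)
    (B : ℝ → Vec3 ℝ → Vec3 ℝ) : Prop :=
  ContDiffOn ℝ ∞ (fun p : ℝ × Vec3 ℝ => B p.1 p.2) (J ×ˢ univ) ∧
    ∀ t ∈ J, ∀ x : Vec3 ℝ, HasDerivWithinAt (fun s => B s x) (R t (B t) x) J t

/-- The `L²` norm of `B(t)` (hence the magnetic energy) is finite, locally uniformly in time. -/
def HasFiniteEnergy (J : Set ℝ) (B : ℝ → Vec3 ℝ → Vec3 ℝ) : Prop :=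
  ∀ T ∈ J, ∃ M : NNReal, ∀ t ∈ J, t ≤ T → eLpNorm (B t) 2 volume ≤ M

/-- Well-posedness in the `L²` norm of the initial-value problem `∂ₜB = R(t, B(t))`, `B(0) = f`,
for fields subject to the constraint `B(t) ∈ 𝒦`: there are constants `C` and `a` such that every
smooth square-integrable datum `f ∈ 𝒦` is the initial value of a smooth solution for all times
`t ≥ 0` with `‖B(t)‖ ≤ C exp(a t) ‖f‖`, and such that a solution with that datum
is unique, on every time interval on which it is given. -/
def IsL2WellPosed (R : ℝ → (Vec3 ℝ → Vec3 ℝ) → Vec3 ℝ → Vec3 ℝ) (𝒦 : Set (Vec3 ℝ → Vec3 ℝ)) :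
    Prop :=
  ∃ C a : ℝ, ∀ f : Vec3 ℝ → Vec3 ℝ, ContDiff ℝ ∞ f → MemLp f 2 volume → f ∈ 𝒦 →
    (∃ B : ℝ → Vec3 ℝ → Vec3 ℝ, IsSmoothSolution R (Ici 0) B ∧ HasFiniteEnergy (Ici 0) B ∧
      (∀ t ∈ Ici (0 : ℝ), B t ∈ 𝒦) ∧ B 0 = f ∧
      ∀ t ∈ Ici (0 : ℝ), eLpNorm (B t) 2 volume
        ≤ ENNReal.ofReal (C * Real.exp (a * t)) * eLpNorm f 2 volume) ∧
    (∀ J : Set ℝ, IsTimeInterval J → ∀ B₁ B₂ : ℝ → Vec3 ℝ → Vec3 ℝ,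
      IsSmoothSolution R J B₁ → HasFiniteEnergy J B₁ → (∀ t ∈ J, B₁ t ∈ 𝒦) → B₁ 0 = f →
      IsSmoothSolution R J B₂ → HasFiniteEnergy J B₂ → (∀ t ∈ J, B₂ t ∈ 𝒦) → B₂ 0 = f →
      ∀ t ∈ J, B₁ t = B₂ t)

/-! ### Plane-wave modes of the equation with frozen (constant) coefficients `V`, `a`, `β` -/

/-- The plane wave `b exp(i(wt + k·x))`. -/
def planeWave (k : Vec3 ℝ) (w : ℂ) (b : Vec3 ℂ) (t : ℝ) (x : Vec3 ℝ) : Vec3 ℂ :=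
  Complex.exp (Complex.I * (w * (t : ℂ) + ((inner ℝ k x : ℝ) : ℂ))) • b

/-- The plane wave `b exp(i(wt + k·x))` solves `∂ₜB = ∇×(V×B) + ∇×(aB) + β∇²B`. -/
def SolvesFrozen (V : Vec3 ℝ) (a β : ℝ) (k : Vec3 ℝ) (w : ℂ) (b : Vec3 ℂ) : Prop :=
  ∀ (t : ℝ) (x : Vec3 ℝ), HasDerivAt (fun s => planeWave k w b s x)
    (inductionRHS (fun _ => V) (fun _ => a) β (planeWave k w b t) x) t

/-- `k·b = 0`, that is, plane waves `b exp(i(wt + k·x))` are divergence-free. -/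
def IsTransverse (k : Vec3 ℝ) (b : Vec3 ℂ) : Prop :=
  ∑ i : Fin 3, (k i : ℂ) * b i = 0

/-- `Ω = w + V·k - iβ|k|²`. -/
def shiftedFrequency (V : Vec3 ℝ) (β : ℝ) (k : Vec3 ℝ) (w : ℂ) : ℂ :=
  w + ((inner ℝ V k : ℝ) : ℂ) - Complex.I * ((β * ‖k‖ ^ 2 : ℝ) : ℂ)

/-- The matrix `𝒩` of the system for the modes. -/
def modeMatrix (a : ℝ) (k : Vec3 ℝ) (Ω : ℂ) : Matrix (Fin 3) (Fin 3) ℂ :=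
  !![Ω, (a * k 2 : ℂ), -(a * k 1 : ℂ);
     -(a * k 2 : ℂ), Ω, (a * k 0 : ℂ);
     (a * k 1 : ℂ), -(a * k 0 : ℂ), Ω]

/-- `Ω₀ = -V·k + iβ|k|²`. -/
def modeZero (V : Vec3 ℝ) (β : ℝ) (k : Vec3 ℝ) : ℂ :=
  -((inner ℝ V k : ℝ) : ℂ) + Complex.I * ((β * ‖k‖ ^ 2 : ℝ) : ℂ)

/-- `Ω₊ = -V·k + i|k|(β|k| + |a|)`. -/
def modePlus (V : Vec3 ℝ) (a β : ℝ) (k : Vec3 ℝ) : ℂ :=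
  -((inner ℝ V k : ℝ) : ℂ) + Complex.I * ((‖k‖ * (β * ‖k‖ + |a|) : ℝ) : ℂ)

/-- `Ω₋ = -V·k + i|k|(β|k| - |a|)`. -/
def modeMinus (V : Vec3 ℝ) (a β : ℝ) (k : Vec3 ℝ) : ℂ :=
  -((inner ℝ V k : ℝ) : ℂ) + Complex.I * ((‖k‖ * (β * ‖k‖ - |a|) : ℝ) : ℂ)

end

/-!
# Well-posedness, constraint and modes of the mean-field dynamo equation

With `uᵢ` the components of `B`, the equation `∂ₜB = ∇×(v×B) + ∇×(αB) + β∇²B` is the parabolic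
system in divergence form `∂ₜuᵢ = βΔuᵢ + ∑ⱼ ∂ⱼGᵢⱼ` whose flux `Gᵢⱼ = ∑ₖ aᵢⱼₖ uₖ` has bounded smooth
coefficients `aᵢⱼₖ = vᵢδⱼₖ - vⱼδᵢₖ + αεᵢⱼₖ`, antisymmetric in `i, j` (`inductionRHS_apply`,
`dynamoCoeff_swap`). On divergence-free fields `-∇×∇×B = ∇²B`, so the constrained system is the
restriction of the unconstrained one to such fields.

Everything rests on one localized energy inequality (`energy_inequality`): testing the equation with
`2φ²u` for a cutoff `φ` moves the outer derivative of the flux onto `u`, where the diffusion absorbs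
it, so that `∫ φ²|u|²` and the dissipation `β ∫∫ φ²|∇u|²` are bounded by the initial energy, by the
time integral of `∫ φ²|G|²`, and by that of `∫ |∇φ|²|u|²`. For a field bounded in `L²` and cutoffs at
scale `R` the last term is `O(R⁻²)`. Since no decay at infinity beyond `L²` is needed, this gives
* uniqueness, by Grönwall's inequality on the ball of radius `R` and `R → ∞`
  (`SolvesWithFlux.eq_zero_of_linearFlux`);
* the constraint: the divergence satisfies the heat equation because the flux is antisymmetric. It
  need not be bounded in `L²` at each time, but `∫∫ |∇·B|²` is finite by the dissipation bound, and
  that suffices for the same argument (`SolvesWithFlux.divergence_eq_zero`).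

Existence is by the Picard iteration `∂ₜBⁿ⁺¹ = βΔBⁿ⁺¹ + div(χₙ a Bⁿ)`, `Bⁿ⁺¹(0) = χₙ f`, where the
cutoff `χₙ` is one on the ball of radius `2ⁿ`. Each step is a scalar heat equation with compactly
supported data and source, solved by Gaussian averages and Duhamel's formula
(`exists_heat_solution`); the time derivative of a Gaussian average comes from Gaussian integration
by parts. The energies of the iterates are bounded uniformly in `n` (`IsPicardSequence.jetEnergy_le`).
On a fixed ball the truncations eventually disappear from the equation for `Bⁿ⁺¹ - Bⁿ`, whose energy
therefore decays geometrically; the dissipation carries the decay from the derivatives of order `k`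
to those of order `k + 1` (`IsPicardSequence.exists_jetEnergy_le`). By a local Sobolev inequality
all spatial derivatives converge locally uniformly, so the limit is smooth in space and solves the
system (`exists_linear_solution`), and the equation trades time derivatives for spatial ones
(`SolvesWithFlux.contDiffOn`). The `L²` norm is the supremum of the localized energies, which
transfers the bounds.

For plane waves the frozen equation is the linear system `Ω b = a k×b + (k·b) V`
(`solvesFrozen_iff`). On the plane `k·b = 0` the operator `b ↦ k×b` squares to `-|k|²` and has both
eigenvalues `±i|k|`, with circularly polarized eigenvectors; this gives `Ω² = -a²|k|²` and the
frequencies `Ω₊`, `Ω₋`. If `k·b ≠ 0`, the scalar product with `k` leaves only `w = iβ|k|²`. The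
imaginary parts differ from `β|k|²` by at most `|a||k|`, which is negligible for large `|k|`.
-/

open Filter Topology

noncomputable section

/-! ### Partial derivatives of scalar functions on `ℝ³` -/

theorem partialDeriv_eq_zero_of_notMem_tsupport {g : Vec3 ℝ → ℝ} {x : Vec3 ℝ} (i : Fin 3)
    (hx : x ∉ tsupport g) : partialDeriv i g x = 0 := by
  have h : g =ᶠ[𝓝 x] fun _ => 0 := notMem_tsupport_iff_eventuallyEq.1 hx
  simp [partialDeriv, h.fderiv_eq]

theorem partialDeriv_congr {g h : Vec3 ℝ → ℝ} {x : Vec3 ℝ} (i : Fin 3) (hgh : g =ᶠ[𝓝 x] h) :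
    partialDeriv i g =ᶠ[𝓝 x] partialDeriv i h := by
  filter_upwards [hgh.eventuallyEq_nhds] with y hy
  simp [partialDeriv, hy.fderiv_eq]

theorem ContDiff.partialDeriv {g : Vec3 ℝ → ℝ} (hg : ContDiff ℝ ∞ g) (i : Fin 3) :
    ContDiff ℝ ∞ (partialDeriv i g) := by
  have : ContDiff ℝ ∞ (fderiv ℝ g) := hg.fderiv_right (by simp)
  exact this.clm_apply contDiff_const

theorem ContDiff.differentiable_field {g : Vec3 ℝ → ℝ} (hg : ContDiff ℝ ∞ g) :
    Differentiable ℝ g := hg.differentiable (by simp)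

theorem HasCompactSupport.partialDeriv {g : Vec3 ℝ → ℝ} (hg : HasCompactSupport g) (i : Fin 3) :
    HasCompactSupport (partialDeriv i g) :=
  hg.mono' fun _ hx => by
    by_contra h
    exact hx (partialDeriv_eq_zero_of_notMem_tsupport i h)

theorem partialDeriv_add {g h : Vec3 ℝ → ℝ} (hg : Differentiable ℝ g) (hh : Differentiable ℝ h)
    (i : Fin 3) : partialDeriv i (fun x => g x + h x)
      = fun x => partialDeriv i g x + partialDeriv i h x := by
  ext x
  simp [partialDeriv, fderiv_fun_add (hg x) (hh x)]

theorem partialDeriv_sub {g h : Vec3 ℝ → ℝ} (hg : Differentiable ℝ g) (hh : Differentiable ℝ h)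
    (i : Fin 3) : partialDeriv i (fun x => g x - h x)
      = fun x => partialDeriv i g x - partialDeriv i h x := by
  ext x
  simp [partialDeriv, fderiv_fun_sub (hg x) (hh x)]

theorem partialDeriv_mul {g h : Vec3 ℝ → ℝ} (hg : Differentiable ℝ g) (hh : Differentiable ℝ h)
    (i : Fin 3) : partialDeriv i (fun x => g x * h x)
      = fun x => partialDeriv i g x * h x + g x * partialDeriv i h x := by
  ext x
  simp [partialDeriv, fderiv_fun_mul (hg x) (hh x)]
  ring

theorem partialDeriv_const (c : ℝ) (i : Fin 3) :
    partialDeriv i (fun _ => c) = fun _ => 0 := by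
  ext x
  simp [partialDeriv]

theorem partialDeriv_const_mul {g : Vec3 ℝ → ℝ} (hg : Differentiable ℝ g) (c : ℝ)
    (i : Fin 3) : partialDeriv i (fun x => c * g x) = fun x => c * partialDeriv i g x := by
  rw [partialDeriv_mul (differentiable_const c) hg, partialDeriv_const]
  simp

theorem partialDeriv_sum {ι : Type} (s : Finset ι) {g : ι → Vec3 ℝ → ℝ}
    (hg : ∀ k, Differentiable ℝ (g k)) (i : Fin 3) :
    partialDeriv i (fun x => ∑ k ∈ s, g k x) = fun x => ∑ k ∈ s, partialDeriv i (g k) x := by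
  ext x
  simp [partialDeriv, fderiv_fun_sum (fun k _ => hg k x)]

theorem partialDeriv_partialDeriv {g : Vec3 ℝ → ℝ} (hg : ContDiff ℝ ∞ g) (i j : Fin 3)
    (x : Vec3 ℝ) : partialDeriv i (partialDeriv j g) x
      = fderiv ℝ (fderiv ℝ g) x (EuclideanSpace.single i 1) (EuclideanSpace.single j 1) := by
  have hd : Differentiable ℝ (fderiv ℝ g) :=
    (hg.fderiv_right (m := ∞) (by simp)).differentiable (by simp)
  have h : partialDeriv j g = fun x => fderiv ℝ g x (EuclideanSpace.single j 1) := rfl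
  rw [h]
  simp only [partialDeriv]
  rw [fderiv_clm_apply (hd x) (differentiableAt_const _)]
  simp

theorem partialDeriv_comm {g : Vec3 ℝ → ℝ} (hg : ContDiff ℝ ∞ g) (i j : Fin 3) :
    partialDeriv i (partialDeriv j g) = partialDeriv j (partialDeriv i g) := by
  ext x
  rw [partialDeriv_partialDeriv hg, partialDeriv_partialDeriv hg]
  refine (hg.contDiffAt.isSymmSndFDerivAt ?_).eq _ _
  rw [minSmoothness_of_isRCLikeNormedField]
  exact WithTop.coe_le_coe.2 (le_top : (2 : ℕ∞) ≤ ⊤)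

theorem vec3_eq_sum_single (y : Vec3 ℝ) :
    y = ∑ i, y i • EuclideanSpace.single i (1 : ℝ) := by
  ext j
  simp [Fin.sum_univ_three]
  fin_cases j <;> simp

theorem fderiv_eq_sum_partialDeriv (g : Vec3 ℝ → ℝ) (x : Vec3 ℝ) :
    fderiv ℝ g x = ∑ i, partialDeriv i g x • EuclideanSpace.proj (𝕜 := ℝ) i := by
  ext y
  conv_lhs => rw [vec3_eq_sum_single y]
  simp [partialDeriv, mul_comm]

theorem hasDerivAt_line {g : Vec3 ℝ → ℝ} (hg : Differentiable ℝ g) (i : Fin 3) (x : Vec3 ℝ)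
    (r : ℝ) : HasDerivAt (fun r : ℝ => g (x + r • EuclideanSpace.single i 1))
      (partialDeriv i g (x + r • EuclideanSpace.single i 1)) r := by
  have h1 : HasDerivAt (fun r : ℝ => x + r • EuclideanSpace.single (𝕜 := ℝ) i 1)
      (EuclideanSpace.single i 1) r := by
    simpa using ((hasDerivAt_id r).smul_const (EuclideanSpace.single (𝕜 := ℝ) i 1)).const_add x
  exact (hg _).hasFDerivAt.comp_hasDerivAt r h1

/-- The flat Laplacian is the sum of the pure second partial derivatives. -/
def laplacianSum (g : Vec3 ℝ → ℝ) (x : Vec3 ℝ) : ℝ :=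
  ∑ l, partialDeriv l (partialDeriv l g) x

theorem laplacian_eq_laplacianSum {g : Vec3 ℝ → ℝ} (hg : ContDiff ℝ ∞ g) (x : Vec3 ℝ) :
    Laplacian.laplacian g x = laplacianSum g x := by
  rw [InnerProductSpace.laplacian_eq_iteratedFDeriv_orthonormalBasis g
    (EuclideanSpace.basisFun (Fin 3) ℝ)]
  simp only [laplacianSum]
  refine Finset.sum_congr rfl fun l _ => ?_
  rw [partialDeriv_partialDeriv hg, iteratedFDeriv_two_apply]
  simp

theorem laplacianSum_contDiff {g : Vec3 ℝ → ℝ} (hg : ContDiff ℝ ∞ g) :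
    ContDiff ℝ ∞ (laplacianSum g) :=
  ContDiff.sum fun l _ => (hg.partialDeriv l).partialDeriv l

/-- Integration by parts against a compactly supported function. -/
theorem integral_mul_partialDeriv {g h : Vec3 ℝ → ℝ} (hg : ContDiff ℝ ∞ g)
    (hh : ContDiff ℝ ∞ h) (hc : HasCompactSupport g) (i : Fin 3) :
    ∫ x, g x * partialDeriv i h x = - ∫ x, partialDeriv i g x * h x := by
  refine integral_mul_fderiv_eq_neg_fderiv_mul_of_integrable ?_ ?_ ?_
    (fun x _ => hg.differentiable_field x) (fun x _ => hh.differentiable_field x)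
  · exact ((hg.partialDeriv i).continuous.mul hh.continuous).integrable_of_hasCompactSupport
      ((hc.partialDeriv i).mul_right)
  · exact (hg.continuous.mul (hh.partialDeriv i).continuous).integrable_of_hasCompactSupport
      hc.mul_right
  · exact (hg.continuous.mul hh.continuous).integrable_of_hasCompactSupport hc.mul_right

/-! ### Iterated partial derivatives -/

/-- The iterated partial derivative along a list of coordinate directions; the head of the list is
differentiated first. -/
def iterPartial : List (Fin 3) → (Vec3 ℝ → ℝ) → Vec3 ℝ → ℝ
  | [], g => g
  | i :: γ, g => iterPartial γ (partialDeriv i g)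

theorem ContDiff.iterPartial (γ : List (Fin 3)) : ∀ {g : Vec3 ℝ → ℝ}, ContDiff ℝ ∞ g →
    ContDiff ℝ ∞ (iterPartial γ g) := by
  induction γ with
  | nil => exact fun hg => hg
  | cons i γ ih => exact fun hg => ih (hg.partialDeriv i)

theorem iterPartial_append (γ δ : List (Fin 3)) : ∀ g : Vec3 ℝ → ℝ,
    iterPartial (γ ++ δ) g = iterPartial δ (iterPartial γ g) := by
  induction γ with
  | nil => exact fun g => rfl
  | cons i γ ih => exact fun g => ih _

theorem partialDeriv_iterPartial (γ : List (Fin 3)) (i : Fin 3) (g : Vec3 ℝ → ℝ) :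
    partialDeriv i (iterPartial γ g) = iterPartial (γ ++ [i]) g := by
  rw [iterPartial_append]; rfl

theorem iterPartial_congr (γ : List (Fin 3)) : ∀ {g h : Vec3 ℝ → ℝ} {x : Vec3 ℝ},
    g =ᶠ[𝓝 x] h → iterPartial γ g =ᶠ[𝓝 x] iterPartial γ h := by
  induction γ with
  | nil => exact fun h => h
  | cons i γ ih => exact fun h => ih (partialDeriv_congr i h)

theorem iterPartial_add (γ : List (Fin 3)) : ∀ {g h : Vec3 ℝ → ℝ}, ContDiff ℝ ∞ g →
    ContDiff ℝ ∞ h → iterPartial γ (fun x => g x + h x)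
      = fun x => iterPartial γ g x + iterPartial γ h x := by
  induction γ with
  | nil => exact fun _ _ => rfl
  | cons i γ ih =>
    intro g h hg hh
    simp only [iterPartial]
    rw [partialDeriv_add hg.differentiable_field hh.differentiable_field,
      ih (hg.partialDeriv i) (hh.partialDeriv i)]

theorem iterPartial_sub (γ : List (Fin 3)) : ∀ {g h : Vec3 ℝ → ℝ}, ContDiff ℝ ∞ g →
    ContDiff ℝ ∞ h → iterPartial γ (fun x => g x - h x)
      = fun x => iterPartial γ g x - iterPartial γ h x := by
  induction γ with
  | nil => exact fun _ _ => rfl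
  | cons i γ ih =>
    intro g h hg hh
    simp only [iterPartial]
    rw [partialDeriv_sub hg.differentiable_field hh.differentiable_field,
      ih (hg.partialDeriv i) (hh.partialDeriv i)]

theorem iterPartial_zero (γ : List (Fin 3)) : iterPartial γ (fun _ => 0) = fun _ => 0 := by
  induction γ with
  | nil => rfl
  | cons i γ ih =>
    simp only [iterPartial]
    rw [partialDeriv_const, ih]

/-- A function all of whose iterated partial derivatives are differentiable is smooth. -/
theorem contDiff_of_differentiable_iterPartial {g : Vec3 ℝ → ℝ}
    (hg : ∀ γ, Differentiable ℝ (iterPartial γ g)) : ContDiff ℝ ∞ g := by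
  suffices h : ∀ n : ℕ, ∀ g : Vec3 ℝ → ℝ, (∀ γ, Differentiable ℝ (iterPartial γ g)) →
      ContDiff ℝ n g from contDiff_infty.2 fun n => h n g hg
  intro n
  induction n with
  | zero => exact fun g hg => contDiff_zero.2 (hg []).continuous
  | succ n ih =>
    intro g hg
    push_cast
    rw [contDiff_succ_iff_fderiv]
    refine ⟨hg [], by simp, ?_⟩
    have : fderiv ℝ g = fun x => ∑ i, partialDeriv i g x • EuclideanSpace.proj (𝕜 := ℝ) i :=
      funext (fderiv_eq_sum_partialDeriv g)
    rw [this]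
    exact ContDiff.sum fun i _ => (ih _ fun γ => hg (i :: γ)).smul contDiff_const

/-! ### Time-dependent fields that are smooth in space -/

/-- A time-dependent scalar field that is smooth in space at each time of `J`, and all of whose
spatial derivatives are of class `C^m` in space and time on `J × ℝ³`. -/
structure SmoothField (m : ℕ∞ω) (J : Set ℝ) (u : ℝ → Vec3 ℝ → ℝ) : Prop where
  contDiff : ∀ t ∈ J, ContDiff ℝ ∞ (u t)
  contDiffOn : ∀ γ, ContDiffOn ℝ m (fun p : ℝ × Vec3 ℝ => iterPartial γ (u p.1) p.2) (J ×ˢ univ)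

namespace SmoothField

variable {m : ℕ∞ω} {J : Set ℝ} {u w : ℝ → Vec3 ℝ → ℝ}

theorem congr (hu : SmoothField m J u) (h : ∀ t ∈ J, w t = u t) : SmoothField m J w where
  contDiff t ht := by rw [h t ht]; exact hu.contDiff t ht
  contDiffOn γ := (hu.contDiffOn γ).congr fun p hp => by rw [h p.1 hp.1]

theorem mono {J' : Set ℝ} (hu : SmoothField m J u) (h : J' ⊆ J) : SmoothField m J' u where
  contDiff t ht := hu.contDiff t (h ht)
  contDiffOn γ := (hu.contDiffOn γ).mono (prod_mono h Subset.rfl)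

theorem of_le {m' : ℕ∞ω} (hu : SmoothField m J u) (h : m' ≤ m) : SmoothField m' J u where
  contDiff := hu.contDiff
  contDiffOn γ := (hu.contDiffOn γ).of_le h

theorem partialDeriv (hu : SmoothField m J u) (i : Fin 3) :
    SmoothField m J (fun t => partialDeriv i (u t)) where
  contDiff t ht := (hu.contDiff t ht).partialDeriv i
  contDiffOn γ := hu.contDiffOn (i :: γ)

theorem add (hu : SmoothField m J u) (hw : SmoothField m J w) :
    SmoothField m J (fun t x => u t x + w t x) where
  contDiff t ht := (hu.contDiff t ht).add (hw.contDiff t ht)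
  contDiffOn γ := ((hu.contDiffOn γ).add (hw.contDiffOn γ)).congr fun p hp => by
    rw [iterPartial_add γ (hu.contDiff _ hp.1) (hw.contDiff _ hp.1)]

theorem mul (hu : SmoothField m J u) (hw : SmoothField m J w) :
    SmoothField m J (fun t x => u t x * w t x) where
  contDiff t ht := (hu.contDiff t ht).mul (hw.contDiff t ht)
  contDiffOn γ := by
    induction γ generalizing u w with
    | nil => exact (hu.contDiffOn []).mul (hw.contDiffOn [])
    | cons i γ ih =>
      refine ((ih (hu.partialDeriv i) hw).add (ih hu (hw.partialDeriv i))).congr fun p hp => ?_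
      have h1 := hu.contDiff _ hp.1
      have h2 := hw.contDiff _ hp.1
      simp only [_root_.iterPartial]
      rw [partialDeriv_mul h1.differentiable_field h2.differentiable_field,
        iterPartial_add γ ((h1.partialDeriv i).mul h2) (h1.mul (h2.partialDeriv i))]

theorem of_contDiff {g : Vec3 ℝ → ℝ} (hg : ContDiff ℝ ∞ g) (hm : m ≤ ∞) :
    SmoothField m J (fun _ => g) where
  contDiff _ _ := hg
  contDiffOn γ := (((hg.iterPartial γ).of_le hm).comp contDiff_snd).contDiffOn

theorem const_mul (hu : SmoothField m J u) (hm : m ≤ ∞) (c : ℝ) :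
    SmoothField m J (fun t x => c * u t x) :=
  (of_contDiff (g := fun _ => c) contDiff_const hm).mul hu

theorem sub (hu : SmoothField m J u) (hw : SmoothField m J w) :
    SmoothField m J (fun t x => u t x - w t x) where
  contDiff t ht := (hu.contDiff t ht).sub (hw.contDiff t ht)
  contDiffOn γ := ((hu.contDiffOn γ).sub (hw.contDiffOn γ)).congr fun p hp => by
    rw [iterPartial_sub γ (hu.contDiff _ hp.1) (hw.contDiff _ hp.1)]

theorem sum {ι : Type} (s : Finset ι) {f : ι → ℝ → Vec3 ℝ → ℝ}
    (hf : ∀ k, SmoothField m J (f k)) (hm : m ≤ ∞) :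
    SmoothField m J (fun t x => ∑ k ∈ s, f k t x) := by
  classical
  induction s using Finset.induction_on with
  | empty => simpa using of_contDiff (g := fun _ => (0 : ℝ)) contDiff_const hm
  | insert a s ha ih => simpa [Finset.sum_insert ha] using (hf a).add ih

theorem laplacianSum (hu : SmoothField m J u) (hm : m ≤ ∞) :
    SmoothField m J (fun t => laplacianSum (u t)) :=
  sum Finset.univ (fun l => (hu.partialDeriv l).partialDeriv l) hm

theorem continuousOn (hu : SmoothField m J u) :
    ContinuousOn (fun p : ℝ × Vec3 ℝ => u p.1 p.2) (J ×ˢ univ) :=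
  (hu.contDiffOn []).continuousOn

theorem continuousOn_time (hu : SmoothField m J u) (x : Vec3 ℝ) :
    ContinuousOn (fun t => u t x) J :=
  hu.continuousOn.comp (by fun_prop : ContinuousOn (fun t : ℝ => (t, x)) J)
    fun _ ht => ⟨ht, mem_univ _⟩

/-- The spatial derivatives of a jointly smooth field are jointly smooth, also at the end points of
the time interval. -/
theorem of_contDiffOn (hJ : UniqueDiffOn ℝ J)
    (hu : ContDiffOn ℝ ∞ (fun p : ℝ × Vec3 ℝ => u p.1 p.2) (J ×ˢ univ)) :
    SmoothField ∞ J u := by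
  have hslice : ∀ {u : ℝ → Vec3 ℝ → ℝ},
      ContDiffOn ℝ ∞ (fun p : ℝ × Vec3 ℝ => u p.1 p.2) (J ×ˢ univ) →
      ∀ t ∈ J, ContDiff ℝ ∞ (u t) := by
    intro u hu t ht
    rw [← contDiffOn_univ]
    exact hu.comp (f := fun x : Vec3 ℝ => (t, x)) (by fun_prop) fun x _ => ⟨ht, mem_univ _⟩
  refine ⟨hslice hu, fun γ => ?_⟩
  induction γ generalizing u with
  | nil => exact hu
  | cons i γ ih =>
    refine ih (u := fun t => _root_.partialDeriv i (u t)) ?_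
    have hU : UniqueDiffOn ℝ (J ×ˢ (univ : Set (Vec3 ℝ))) := hJ.prod uniqueDiffOn_univ
    have h1 : ContDiffOn ℝ ∞ (fun p => fderivWithin ℝ (fun p : ℝ × Vec3 ℝ => u p.1 p.2)
        (J ×ˢ univ) p ((0 : ℝ), EuclideanSpace.single i (1 : ℝ))) (J ×ˢ univ) :=
      (hu.fderivWithin hU (by simp)).clm_apply contDiffOn_const
    refine h1.congr fun p hp => ?_
    have hd := (hu.differentiableOn (by simp) p hp).hasFDerivWithinAt
    have hl : HasFDerivWithinAt (fun x : Vec3 ℝ => (p.1, x))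
        (ContinuousLinearMap.inr ℝ ℝ (Vec3 ℝ)) univ p.2 :=
      (hasFDerivAt_prodMk_right p.1 p.2).hasFDerivWithinAt
    have hc := HasFDerivWithinAt.comp (f := fun x : Vec3 ℝ => (p.1, x)) p.2 (t := J ×ˢ univ) hd hl
      (fun x _ => ⟨hp.1, mem_univ _⟩)
    rw [hasFDerivWithinAt_univ] at hc
    have he : fderiv ℝ (u p.1) p.2 = _ := hc.fderiv
    simp [_root_.partialDeriv, he]

end SmoothField

/-! ### Time derivatives on a compact interval -/

theorem eq_add_integral_of_hasDerivWithinAt {T : ℝ} {f f' : ℝ → ℝ}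
    (hd : ∀ t ∈ Icc 0 T, HasDerivWithinAt f (f' t) (Icc 0 T) t)
    (hc : ContinuousOn f' (Icc 0 T)) {t : ℝ} (ht : t ∈ Icc 0 T) :
    f t = f 0 + ∫ s in (0 : ℝ)..t, f' s := by
  have hsub : Icc 0 t ⊆ Icc 0 T := Icc_subset_Icc_right ht.2
  rw [intervalIntegral.integral_eq_sub_of_hasDerivAt_of_le ht.1 (f := f)
    (fun s hs => ((hd s (hsub hs)).continuousWithinAt).mono hsub)
    (fun s hs => (hd s (hsub (Ioo_subset_Icc_self hs))).hasDerivAt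
      (Icc_mem_nhds hs.1 (hs.2.trans_le ht.2)))
    ((hc.mono hsub).intervalIntegrable_of_Icc ht.1)]
  ring

theorem hasDerivWithinAt_of_eq_add_integral {T : ℝ} {f f' : ℝ → ℝ} {c : ℝ}
    (hc : ContinuousOn f' (Icc 0 T))
    (hf : ∀ t ∈ Icc 0 T, f t = c + ∫ s in (0 : ℝ)..t, f' s) {t : ℝ} (ht : t ∈ Icc 0 T) :
    HasDerivWithinAt f (f' t) (Icc 0 T) t := by
  have hT : (0 : ℝ) ≤ T := ht.1.trans ht.2
  have hk : Continuous (IccExtend hT ((Icc 0 T).domRestrict f')) :=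
    (continuousOn_iff_continuous_domRestrict.1 hc).Icc_extend'
  have hkt : ∀ s ∈ Icc 0 T, IccExtend hT ((Icc 0 T).domRestrict f') s = f' s := fun s hs => by
    rw [IccExtend_of_mem hT _ hs]; rfl
  have h1 : HasDerivAt (fun t => c + ∫ s in (0 : ℝ)..t, IccExtend hT ((Icc 0 T).domRestrict f') s)
      (IccExtend hT ((Icc 0 T).domRestrict f') t) t :=
    (intervalIntegral.integral_hasDerivAt_right (hk.intervalIntegrable _ _)
      hk.aestronglyMeasurable.stronglyMeasurableAtFilter hk.continuousAt).const_add c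
  rw [hkt t ht] at h1
  have h2 : ∀ t ∈ Icc 0 T,
      f t = c + ∫ s in (0 : ℝ)..t, IccExtend hT ((Icc 0 T).domRestrict f') s := by
    intro t ht
    rw [hf t ht]
    congr 1
    refine intervalIntegral.integral_congr fun s hs => ?_
    rw [uIcc_of_le ht.1] at hs
    exact (hkt s ⟨hs.1, hs.2.trans ht.2⟩).symm
  exact h1.hasDerivWithinAt.congr h2 (h2 t ht)

namespace SmoothField

variable {m : ℕ∞ω} {T : ℝ} {u h : ℝ → Vec3 ℝ → ℝ}

theorem exists_bound (hu : SmoothField m (Icc 0 T) u) {K : Set (Vec3 ℝ)} (hK : IsCompact K) :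
    ∃ C, 0 ≤ C ∧ ∀ t ∈ Icc 0 T, ∀ x ∈ K, |u t x| ≤ C := by
  obtain ⟨C, hC⟩ := (isCompact_Icc.prod hK).exists_bound_of_continuousOn
    (hu.continuousOn.mono (prod_mono Subset.rfl (subset_univ K)))
  refine ⟨max C 0, le_max_right _ _, fun t ht x hx => ?_⟩
  exact (hC (t, x) ⟨ht, hx⟩).trans (le_max_left _ _)

theorem hasDerivAt_integral_line (hh : SmoothField m (Icc 0 T) h) {t : ℝ} (ht : t ∈ Icc 0 T)
    (i : Fin 3) (x : Vec3 ℝ) :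
    HasDerivAt (fun r : ℝ => ∫ s in (0 : ℝ)..t, h s (x + r • EuclideanSpace.single i 1))
      (∫ s in (0 : ℝ)..t, _root_.partialDeriv i (h s) x) 0 := by
  have hsub : uIoc 0 t ⊆ Icc 0 T := by
    rw [uIoc_of_le ht.1]
    exact fun s hs => ⟨hs.1.le, hs.2.trans ht.2⟩
  have hsub' : uIcc 0 t ⊆ Icc 0 T := by
    rw [uIcc_of_le ht.1]
    exact fun s hs => ⟨hs.1, hs.2.trans ht.2⟩
  obtain ⟨C, -, hC⟩ := (hh.partialDeriv i).exists_bound (isCompact_closedBall x 1)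
  have key := (intervalIntegral.hasDerivAt_integral_of_dominated_loc_of_deriv_le
    (μ := volume) (a := 0) (b := t) (x₀ := (0 : ℝ)) (s := Metric.ball 0 1) (bound := fun _ => C)
    (F := fun r s => h s (x + r • EuclideanSpace.single i 1))
    (F' := fun r s => _root_.partialDeriv i (h s) (x + r • EuclideanSpace.single i 1))
    (Metric.ball_mem_nhds _ one_pos) ?_ ?_ ?_ ?_ ?_ ?_).2
  · simpa using key
  · exact Eventually.of_forall fun r => ((hh.continuousOn_time _).mono
      hsub).aestronglyMeasurable measurableSet_uIoc
  · exact ((hh.continuousOn_time _).mono hsub').intervalIntegrable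
  · exact (((hh.partialDeriv i).continuousOn_time _).mono hsub).aestronglyMeasurable
      measurableSet_uIoc
  · refine Eventually.of_forall fun s hs r hr => hC s (hsub hs) _ ?_
    simpa [norm_smul] using (mem_ball_zero_iff.1 hr).le
  · exact intervalIntegrable_const
  · exact Eventually.of_forall fun s hs r _ =>
      hasDerivAt_line (hh.contDiff s (hsub hs)).differentiable_field i x r

/-- Time and space derivatives commute: if `∂ₜu = h`, then `∂ₜ∂ᵢu = ∂ᵢh`, also at the end points of
the time interval. -/
theorem hasDerivWithinAt_partialDeriv (hu : SmoothField m (Icc 0 T) u)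
    (hh : SmoothField m (Icc 0 T) h)
    (hd : ∀ t ∈ Icc 0 T, ∀ x, HasDerivWithinAt (fun s => u s x) (h t x) (Icc 0 T) t)
    (i : Fin 3) : ∀ t ∈ Icc 0 T, ∀ x, HasDerivWithinAt (fun s => _root_.partialDeriv i (u s) x)
      (_root_.partialDeriv i (h t) x) (Icc 0 T) t := by
  intro t ht x
  refine hasDerivWithinAt_of_eq_add_integral (c := _root_.partialDeriv i (u 0) x)
    (f' := fun s => _root_.partialDeriv i (h s) x)
    ((hh.partialDeriv i).continuousOn_time x) (fun t ht => ?_) ht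
  have h0 : (0 : ℝ) ∈ Icc 0 T := ⟨le_rfl, ht.1.trans ht.2⟩
  have h1 := hasDerivAt_line (hu.contDiff t ht).differentiable_field i x 0
  have h2 := (hasDerivAt_line (hu.contDiff 0 h0).differentiable_field i x 0).add
    (hh.hasDerivAt_integral_line ht i x)
  have h3 : (fun r : ℝ => u t (x + r • EuclideanSpace.single i 1)) =
      (fun r : ℝ => u 0 (x + r • EuclideanSpace.single i 1)) +
      fun r : ℝ => ∫ s in (0 : ℝ)..t, h s (x + r • EuclideanSpace.single i 1) := by
    ext r
    exact eq_add_integral_of_hasDerivWithinAt (fun s hs => hd s hs _) (hh.continuousOn_time _) ht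
  rw [h3] at h1
  simpa using h1.unique h2

theorem hasDerivWithinAt_iterPartial (γ : List (Fin 3)) (hu : SmoothField m (Icc 0 T) u)
    (hh : SmoothField m (Icc 0 T) h)
    (hd : ∀ t ∈ Icc 0 T, ∀ x, HasDerivWithinAt (fun s => u s x) (h t x) (Icc 0 T) t) :
    ∀ t ∈ Icc 0 T, ∀ x, HasDerivWithinAt (fun s => _root_.iterPartial γ (u s) x)
      (_root_.iterPartial γ (h t) x) (Icc 0 T) t := by
  induction γ generalizing u h with
  | nil => exact hd
  | cons i γ ih =>
    exact ih (SmoothField.partialDeriv hu i) (SmoothField.partialDeriv hh i)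
      (hu.hasDerivWithinAt_partialDeriv hh hd i)

end SmoothField

/-! ### Integrals against squared cutoffs -/

/-- The integral of `g` against the square of a cutoff function `φ`. -/
def cutoffIntegral (φ g : Vec3 ℝ → ℝ) : ℝ := ∫ x, φ x ^ 2 * g x

section cutoffIntegral

variable {φ g h : Vec3 ℝ → ℝ}

theorem integrable_cutoff (hφ : Continuous φ) (hc : HasCompactSupport φ) (hg : Continuous g) :
    Integrable fun x => φ x ^ 2 * g x := by
  refine ((hφ.pow 2).mul hg).integrable_of_hasCompactSupport ?_
  exact hc.mono fun x hx hx' => hx (by simp [hx'])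

theorem cutoffIntegral_add (hφ : Continuous φ) (hc : HasCompactSupport φ) (hg : Continuous g)
    (hh : Continuous h) : cutoffIntegral φ (fun x => g x + h x)
      = cutoffIntegral φ g + cutoffIntegral φ h := by
  simp only [cutoffIntegral, mul_add]
  exact integral_add (integrable_cutoff hφ hc hg) (integrable_cutoff hφ hc hh)

theorem cutoffIntegral_const_mul (c : ℝ) :
    cutoffIntegral φ (fun x => c * g x) = c * cutoffIntegral φ g := by
  simp only [cutoffIntegral, ← integral_const_mul]
  congr 1; ext x; ring

theorem cutoffIntegral_sum {ι : Type} (s : Finset ι) {f : ι → Vec3 ℝ → ℝ} (hφ : Continuous φ)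
    (hc : HasCompactSupport φ) (hf : ∀ k, Continuous (f k)) :
    cutoffIntegral φ (fun x => ∑ k ∈ s, f k x) = ∑ k ∈ s, cutoffIntegral φ (f k) := by
  simp only [cutoffIntegral, Finset.mul_sum]
  exact integral_finsetSum _ fun k _ => integrable_cutoff hφ hc (hf k)

theorem cutoffIntegral_mono (hφ : Continuous φ) (hc : HasCompactSupport φ) (hg : Continuous g)
    (hh : Continuous h) (hgh : ∀ x, φ x ≠ 0 → g x ≤ h x) :
    cutoffIntegral φ g ≤ cutoffIntegral φ h := by
  refine integral_mono (integrable_cutoff hφ hc hg) (integrable_cutoff hφ hc hh) fun x => ?_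
  by_cases hx : φ x = 0
  · simp [hx]
  · exact mul_le_mul_of_nonneg_left (hgh x hx) (sq_nonneg _)

theorem cutoffIntegral_congr (hgh : ∀ x, φ x ≠ 0 → g x = h x) :
    cutoffIntegral φ g = cutoffIntegral φ h := by
  refine integral_congr_ae (Eventually.of_forall fun x => ?_)
  by_cases hx : φ x = 0
  · simp [hx]
  · simp [hgh x hx]

theorem cutoffIntegral_nonneg (hg : ∀ x, 0 ≤ g x) : 0 ≤ cutoffIntegral φ g :=
  integral_nonneg fun x => mul_nonneg (sq_nonneg _) (hg x)

theorem cutoffIntegral_mono_cutoff {ψ : Vec3 ℝ → ℝ} {c : ℝ} (hφ : Continuous φ)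
    (hc : HasCompactSupport φ) (hψ : Continuous ψ) (hcψ : HasCompactSupport ψ) (hg : Continuous g)
    (hg0 : ∀ x, 0 ≤ g x) (hle : ∀ x, φ x ^ 2 ≤ c * ψ x ^ 2) :
    cutoffIntegral φ g ≤ c * cutoffIntegral ψ g := by
  rw [← cutoffIntegral_const_mul]
  refine integral_mono (integrable_cutoff hφ hc hg)
    (integrable_cutoff hψ hcψ (continuous_const.mul hg)) fun x => ?_
  have := mul_le_mul_of_nonneg_right (hle x) (hg0 x)
  simp only
  linarith

end cutoffIntegral

namespace SmoothField

variable {m : ℕ∞ω} {T : ℝ} {J : Set ℝ} {u h : ℝ → Vec3 ℝ → ℝ} {φ : Vec3 ℝ → ℝ}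

theorem continuous_slice (hu : SmoothField m J u) {t : ℝ} (ht : t ∈ J) : Continuous (u t) :=
  (hu.contDiff t ht).continuous

theorem continuousOn_cutoffIntegral (hu : SmoothField m (Icc 0 T) u) (hφ : Continuous φ)
    (hc : HasCompactSupport φ) : ContinuousOn (fun t => cutoffIntegral φ (u t)) (Icc 0 T) := by
  refine continuousOn_integral_of_compact_support (k := tsupport φ) hc
    (f := fun t x => φ x ^ 2 * u t x) ?_ ?_
  · have : ContinuousOn (fun p : ℝ × Vec3 ℝ => φ p.2 ^ 2) (Icc 0 T ×ˢ univ) :=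
      ((hφ.comp continuous_snd).pow 2).continuousOn
    exact this.mul hu.continuousOn
  · intro t x _ hx
    simp [image_eq_zero_of_notMem_tsupport hx]

theorem intervalIntegrable_cutoffIntegral (hu : SmoothField m (Icc 0 T) u) (hφ : Continuous φ)
    (hc : HasCompactSupport φ) {t : ℝ} (ht : t ∈ Icc 0 T) :
    IntervalIntegrable (fun s => cutoffIntegral φ (u s)) volume 0 t :=
  ((hu.continuousOn_cutoffIntegral hφ hc).mono
    (Icc_subset_Icc_right ht.2)).intervalIntegrable_of_Icc ht.1

theorem cutoffIntegral_eq_add_integral (hu : SmoothField m (Icc 0 T) u)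
    (hh : SmoothField m (Icc 0 T) h)
    (hd : ∀ t ∈ Icc 0 T, ∀ x, HasDerivWithinAt (fun s => u s x) (h t x) (Icc 0 T) t)
    (hφ : Continuous φ) (hc : HasCompactSupport φ) {t : ℝ} (ht : t ∈ Icc 0 T) :
    cutoffIntegral φ (u t) = cutoffIntegral φ (u 0)
      + ∫ s in (0 : ℝ)..t, cutoffIntegral φ (h s) := by
  have h0 : (0 : ℝ) ∈ Icc 0 T := ⟨le_rfl, ht.1.trans ht.2⟩
  have hint : Integrable (Function.uncurry fun s x => φ x ^ 2 * h s x)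
      ((volume.restrict (uIoc 0 t)).prod volume) := by
    rw [uIoc_of_le ht.1]
    have hK : IsCompact (Icc 0 t ×ˢ tsupport φ) := isCompact_Icc.prod hc
    have hcont : ContinuousOn (Function.uncurry fun s x => φ x ^ 2 * h s x)
        (Icc 0 T ×ˢ univ) := by
      have : ContinuousOn (fun p : ℝ × Vec3 ℝ => φ p.2 ^ 2) (Icc 0 T ×ˢ univ) :=
        ((hφ.comp continuous_snd).pow 2).continuousOn
      exact this.mul hh.continuousOn
    have h1 : IntegrableOn (Function.uncurry fun s x => φ x ^ 2 * h s x)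
        (Icc 0 t ×ˢ tsupport φ) (volume.prod volume) :=
      (hcont.mono (prod_mono (Icc_subset_Icc_right ht.2) (subset_univ _))).integrableOn_compact hK
    have h2 : IntegrableOn (Function.uncurry fun s x => φ x ^ 2 * h s x)
        (Icc 0 t ×ˢ univ) (volume.prod volume) := by
      refine h1.of_forall_sdiff_eq_zero (measurableSet_Icc.prod MeasurableSet.univ) ?_
      rintro ⟨s, x⟩ ⟨⟨hs, -⟩, hx⟩
      have : x ∉ tsupport φ := fun h => hx ⟨hs, h⟩
      simp [image_eq_zero_of_notMem_tsupport this]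
    have h3 := h2.mono_set (prod_mono Ioc_subset_Icc_self (Subset.refl (univ : Set (Vec3 ℝ))))
    rwa [IntegrableOn, ← Measure.prod_restrict, Measure.restrict_univ] at h3
  simp only [cutoffIntegral]
  rw [intervalIntegral_integral_swap hint]
  rw [← integral_add (integrable_cutoff hφ hc (hu.continuous_slice h0))]
  · refine integral_congr_ae (Eventually.of_forall fun x => ?_)
    simp only
    rw [intervalIntegral.integral_const_mul,
      eq_add_integral_of_hasDerivWithinAt (fun s hs => hd s hs x) (hh.continuousOn_time x) ht]
    ring
  · have := hint.integral_prod_right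
    simpa only [intervalIntegral.integral_of_le ht.1, uIoc_of_le ht.1] using! this

end SmoothField

theorem intervalIntegrable_finsetSum {ι : Type} {s : Finset ι} {f : ι → ℝ → ℝ} {a b : ℝ}
    (hf : ∀ i ∈ s, IntervalIntegrable (f i) volume a b) :
    IntervalIntegrable (fun x => ∑ i ∈ s, f i x) volume a b := by
  simpa only [Finset.sum_fn] using IntervalIntegrable.sum s hf

/-! ### The localized energy inequality -/

theorem hasCompactSupport_cutoff_sq_mul {φ g : Vec3 ℝ → ℝ} (hc : HasCompactSupport φ) :
    HasCompactSupport fun x => φ x ^ 2 * g x :=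
  hc.mono fun x hx hx' => hx (by simp [hx'])

/-- The spatial part of the energy inequality: testing `βΔu + ∇·G` with `2φ²u` and absorbing the
cross terms into the dissipation. -/
theorem cutoffIntegral_test_le {β : ℝ} (hβ : 0 < β) {u : Vec3 ℝ → ℝ} {G : Fin 3 → Vec3 ℝ → ℝ}
    (hu : ContDiff ℝ ∞ u) (hG : ∀ j, ContDiff ℝ ∞ (G j)) {φ : Vec3 ℝ → ℝ} (hφ : ContDiff ℝ ∞ φ)
    (hc : HasCompactSupport φ) :
    cutoffIntegral φ (fun x => 2 * u x * (β * laplacianSum u x + ∑ j, partialDeriv j (G j) x))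
        + β * cutoffIntegral φ (fun x => ∑ i, partialDeriv i u x ^ 2)
      ≤ (8 * β + 2 + 2 / β) * (∑ i, cutoffIntegral (partialDeriv i φ) (fun x => u x ^ 2)
        + ∑ j, cutoffIntegral φ (fun x => G j x ^ 2)) := by
  have hH : ∀ i, ContDiff ℝ ∞ fun x => β * partialDeriv i u x + G i x := fun i =>
    (contDiff_const.mul (hu.partialDeriv i)).add (hG i)
  have hφu : ContDiff ℝ ∞ fun x => φ x ^ 2 * (2 * u x) :=
    (hφ.pow 2).mul (contDiff_const.mul hu)
  have h1 : cutoffIntegral φ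
      (fun x => 2 * u x * (β * laplacianSum u x + ∑ j, partialDeriv j (G j) x))
      = ∑ i, ∫ x, φ x ^ 2 * (2 * u x)
          * partialDeriv i (fun x => β * partialDeriv i u x + G i x) x := by
    rw [← integral_finsetSum]
    · refine integral_congr_ae (Eventually.of_forall fun x => ?_)
      simp only [laplacianSum]
      simp_rw [fun i => partialDeriv_add
        ((contDiff_const (c := β)).mul (hu.partialDeriv i)).differentiable_field
        (hG i).differentiable_field i,
        fun i => partialDeriv_const_mul (hu.partialDeriv i).differentiable_field β i]
      rw [← Finset.mul_sum, Finset.sum_add_distrib, Finset.mul_sum Finset.univ _ β]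
      ring
    · intro i _
      refine (hφu.continuous.mul ((hH i).partialDeriv i).continuous).integrable_of_hasCompactSupport
        (HasCompactSupport.mul_right (hasCompactSupport_cutoff_sq_mul hc))
  rw [h1]
  simp_rw [fun i => integral_mul_partialDeriv hφu (hH i) (hasCompactSupport_cutoff_sq_mul hc) i]
  rw [cutoffIntegral_sum (f := fun i x => partialDeriv i u x ^ 2) _ hφ.continuous hc
      (fun i => (hu.partialDeriv i).continuous.pow 2),
    Finset.mul_sum, ← Finset.sum_add_distrib, ← Finset.sum_add_distrib, Finset.mul_sum]
  refine Finset.sum_le_sum fun i _ => ?_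
  have hcont := hu.continuous
  have hφcont := hφ.continuous
  have hGcont := (hG i).continuous
  have hucont := (hu.partialDeriv i).continuous
  have hφi := (hφ.partialDeriv i).continuous
  rw [← integral_neg, cutoffIntegral, ← integral_const_mul, ← integral_add, cutoffIntegral,
    cutoffIntegral, ← integral_add, ← integral_const_mul]
  rotate_left
  · exact integrable_cutoff hφi (hc.partialDeriv i) (hcont.pow 2)
  · exact integrable_cutoff hφcont hc (hGcont.pow 2)
  · refine ((hφu.partialDeriv i).continuous.mul
      (hH i).continuous).neg.integrable_of_hasCompactSupport ?_
    exact (((hasCompactSupport_cutoff_sq_mul hc).partialDeriv i).mul_right).neg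
  · exact (integrable_cutoff hφcont hc (hucont.pow 2)).const_mul β
  refine integral_mono ?_ ?_ fun x => ?_
  · refine Integrable.add ?_ ((integrable_cutoff hφcont hc (hucont.pow 2)).const_mul β)
    refine ((hφu.partialDeriv i).continuous.mul
      (hH i).continuous).neg.integrable_of_hasCompactSupport ?_
    exact (((hasCompactSupport_cutoff_sq_mul hc).partialDeriv i).mul_right).neg
  · exact ((integrable_cutoff hφi (hc.partialDeriv i) (hcont.pow 2)).add
      (integrable_cutoff hφcont hc (hGcont.pow 2))).const_mul _
  have h2 : partialDeriv i (fun x => φ x ^ 2 * (2 * u x)) x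
      = 2 * φ x * partialDeriv i φ x * (2 * u x) + φ x ^ 2 * (2 * partialDeriv i u x) := by
    rw [partialDeriv_mul (hφ.pow 2).differentiable_field
      (contDiff_const.mul hu).differentiable_field,
      partialDeriv_const_mul hu.differentiable_field]
    have : (fun x => φ x ^ 2) = fun x => φ x * φ x := by ext; ring
    rw [this, partialDeriv_mul hφ.differentiable_field hφ.differentiable_field]
    ring
  simp only [h2]
  set p := φ x * partialDeriv i u x with hp
  set q := partialDeriv i φ x * u x with hq
  set r := φ x * G i x with hr
  have e1 : -((2 * φ x * partialDeriv i φ x * (2 * u x) + φ x ^ 2 * (2 * partialDeriv i u x))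
      * (β * partialDeriv i u x + G i x)) + β * (φ x ^ 2 * partialDeriv i u x ^ 2)
      = -(4 * q + 2 * p) * (β * p + r) + β * p ^ 2 := by rw [hp, hq, hr]; ring
  have e2 : partialDeriv i φ x ^ 2 * u x ^ 2 + φ x ^ 2 * G i x ^ 2 = q ^ 2 + r ^ 2 := by
    rw [hq, hr]; ring
  rw [e1, e2]
  have k1 : 0 ≤ β / 2 * (p + 4 * q) ^ 2 := by positivity
  have k2 : 0 ≤ β / 2 * (p + 2 / β * r) ^ 2 := by positivity
  have k3 : β / 2 * (p + 2 / β * r) ^ 2 = β / 2 * p ^ 2 + 2 * p * r + 2 / β * r ^ 2 := by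
    field_simp
    ring
  have k4 : 0 ≤ 2 / β * q ^ 2 := by positivity
  have k5 : 0 ≤ β * r ^ 2 := by positivity
  nlinarith [sq_nonneg (q + r)]

/-- **Localized energy inequality** for `∂ₜu = βΔu + ∇·G`. Only the cutoff is differentiated on the
right-hand side, and the dissipation controls one more derivative of `u`. -/
theorem energy_inequality {T β : ℝ} (hβ : 0 < β) {u : ℝ → Vec3 ℝ → ℝ}
    {G : Fin 3 → ℝ → Vec3 ℝ → ℝ} (hu : SmoothField 0 (Icc 0 T) u)
    (hG : ∀ j, SmoothField 0 (Icc 0 T) (G j))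
    (hd : ∀ t ∈ Icc 0 T, ∀ x, HasDerivWithinAt (fun s => u s x)
      (β * laplacianSum (u t) x + ∑ j, partialDeriv j (G j t) x) (Icc 0 T) t)
    {φ : Vec3 ℝ → ℝ} (hφ : ContDiff ℝ ∞ φ) (hc : HasCompactSupport φ) {t : ℝ}
    (ht : t ∈ Icc 0 T) :
    cutoffIntegral φ (fun x => u t x ^ 2)
        + β * ∫ s in (0 : ℝ)..t, cutoffIntegral φ (fun x => ∑ i, partialDeriv i (u s) x ^ 2)
      ≤ cutoffIntegral φ (fun x => u 0 x ^ 2) + (8 * β + 2 + 2 / β) * ∫ s in (0 : ℝ)..t,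
        (∑ i, cutoffIntegral (partialDeriv i φ) (fun x => u s x ^ 2)
          + ∑ j, cutoffIntegral φ (fun x => G j s x ^ 2)) := by
  have hsq : ∀ {f : ℝ → Vec3 ℝ → ℝ}, SmoothField 0 (Icc 0 T) f →
      SmoothField 0 (Icc 0 T) (fun t x => f t x ^ 2) := fun hf => by
    simpa only [sq] using hf.mul hf
  have hR : SmoothField 0 (Icc 0 T)
      (fun t x => β * laplacianSum (u t) x + ∑ j, partialDeriv j (G j t) x) :=
    ((hu.laplacianSum (by simp)).const_mul (by simp) β).add
      (SmoothField.sum _ (fun j => (hG j).partialDeriv j) (by simp))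
  have hE : SmoothField 0 (Icc 0 T) (fun t x => 2 * u t x
      * (β * laplacianSum (u t) x + ∑ j, partialDeriv j (G j t) x)) :=
    (hu.const_mul (by simp) 2).mul hR
  have hD : SmoothField 0 (Icc 0 T) (fun t x => ∑ i, partialDeriv i (u t) x ^ 2) :=
    SmoothField.sum _ (fun i => hsq (hu.partialDeriv i)) (by simp)
  rw [(hsq hu).cutoffIntegral_eq_add_integral hE (fun t ht x => by
    simpa using! (hd t ht x).pow 2) hφ.continuous hc ht, add_assoc,
    ← intervalIntegral.integral_const_mul, ← intervalIntegral.integral_add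
      (hE.intervalIntegrable_cutoffIntegral hφ.continuous hc ht)
      ((hD.intervalIntegrable_cutoffIntegral hφ.continuous hc ht).const_mul β),
    ← intervalIntegral.integral_const_mul]
  gcongr
  refine intervalIntegral.integral_mono_on ht.1 ?_ ?_ fun s hs => ?_
  · exact (hE.intervalIntegrable_cutoffIntegral hφ.continuous hc ht).add
      ((hD.intervalIntegrable_cutoffIntegral hφ.continuous hc ht).const_mul β)
  · refine IntervalIntegrable.const_mul (IntervalIntegrable.add ?_ ?_) _
    · refine intervalIntegrable_finsetSum fun i _ => (hsq hu).intervalIntegrable_cutoffIntegral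
        (hφ.partialDeriv i).continuous (hc.partialDeriv i) ht
    · refine intervalIntegrable_finsetSum fun j _ => (hsq (hG j)).intervalIntegrable_cutoffIntegral
        hφ.continuous hc ht
  · have hs' : s ∈ Icc 0 T := ⟨hs.1, hs.2.trans ht.2⟩
    exact cutoffIntegral_test_le hβ (hu.contDiff s hs') (fun j => (hG j).contDiff s hs') hφ hc

/-! ### Squared jets -/

/-- The sum of the squares of all iterated partial derivatives of order at most `k`. -/
def sqJet : ℕ → (Vec3 ℝ → ℝ) → Vec3 ℝ → ℝ
  | 0, u => fun x => u x ^ 2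
  | k + 1, u => fun x => u x ^ 2 + ∑ i, sqJet k (partialDeriv i u) x

theorem sqJet_nonneg (k : ℕ) (u : Vec3 ℝ → ℝ) (x : Vec3 ℝ) : 0 ≤ sqJet k u x := by
  induction k generalizing u with
  | zero => exact sq_nonneg _
  | succ k ih => exact add_nonneg (sq_nonneg _) (Finset.sum_nonneg fun i _ => ih _)

theorem sqJet_congr (k : ℕ) {u w : Vec3 ℝ → ℝ} {x : Vec3 ℝ} (h : u =ᶠ[𝓝 x] w) :
    sqJet k u x = sqJet k w x := by
  induction k generalizing u w with
  | zero => simp [sqJet, h.eq_of_nhds]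
  | succ k ih => simp [sqJet, h.eq_of_nhds, fun i => ih (partialDeriv_congr i h)]

theorem sqJet_zero_fun (k : ℕ) (x : Vec3 ℝ) : sqJet k (fun _ => 0) x = 0 := by
  induction k with
  | zero => simp [sqJet]
  | succ k ih => simp [sqJet, partialDeriv_const, ih]

theorem sqJet_le_succ (k : ℕ) (u : Vec3 ℝ → ℝ) (x : Vec3 ℝ) :
    sqJet k u x ≤ sqJet (k + 1) u x := by
  induction k generalizing u with
  | zero => exact le_add_of_nonneg_right (Finset.sum_nonneg fun i _ => sqJet_nonneg _ _ _)
  | succ k ih => exact add_le_add_right (Finset.sum_le_sum fun i _ => ih _) _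

theorem sq_le_sqJet (k : ℕ) (u : Vec3 ℝ → ℝ) (x : Vec3 ℝ) : u x ^ 2 ≤ sqJet k u x := by
  cases k with
  | zero => exact le_rfl
  | succ k => exact le_add_of_nonneg_right (Finset.sum_nonneg fun _ _ => sqJet_nonneg _ _ _)

theorem sqJet_partialDeriv_le (k : ℕ) (u : Vec3 ℝ → ℝ) (i : Fin 3) (x : Vec3 ℝ) :
    sqJet k (partialDeriv i u) x ≤ sqJet (k + 1) u x :=
  (Finset.single_le_sum (f := fun i => sqJet k (partialDeriv i u) x)
    (fun _ _ => sqJet_nonneg _ _ _) (Finset.mem_univ i)).trans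
      (le_add_of_nonneg_left (sq_nonneg _))

theorem sqJet_iterPartial_le (k : ℕ) (γ : List (Fin 3)) (u : Vec3 ℝ → ℝ) (x : Vec3 ℝ) :
    sqJet k (iterPartial γ u) x ≤ sqJet (k + γ.length) u x := by
  induction γ generalizing u with
  | nil => exact le_rfl
  | cons i γ ih => exact (ih _).trans (sqJet_partialDeriv_le _ _ _ _)

theorem continuous_sqJet (k : ℕ) {u : Vec3 ℝ → ℝ} (hu : ContDiff ℝ ∞ u) :
    Continuous (sqJet k u) := by
  induction k generalizing u with
  | zero => exact hu.continuous.pow 2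
  | succ k ih =>
    exact (hu.continuous.pow 2).add (continuous_finsetSum _ fun i _ => ih (hu.partialDeriv i))

theorem sqJet_add_le (k : ℕ) {u w : Vec3 ℝ → ℝ} (hu : ContDiff ℝ ∞ u) (hw : ContDiff ℝ ∞ w)
    (x : Vec3 ℝ) : sqJet k (fun x => u x + w x) x ≤ 2 * sqJet k u x + 2 * sqJet k w x := by
  induction k generalizing u w with
  | zero =>
    simp only [sqJet]
    nlinarith [sq_nonneg (u x - w x)]
  | succ k ih =>
    simp only [sqJet]
    simp_rw [fun i => partialDeriv_add hu.differentiable_field hw.differentiable_field i]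
    have h := Finset.sum_le_sum fun i (_ : i ∈ (Finset.univ : Finset (Fin 3))) =>
      ih (hu.partialDeriv i) (hw.partialDeriv i)
    rw [Finset.sum_add_distrib, ← Finset.mul_sum, ← Finset.mul_sum] at h
    nlinarith [sq_nonneg (u x - w x)]

theorem sqJet_sum_le (k : ℕ) {f : Fin 3 → Vec3 ℝ → ℝ} (hf : ∀ l, ContDiff ℝ ∞ (f l))
    (x : Vec3 ℝ) : sqJet k (fun x => ∑ l, f l x) x ≤ 4 * ∑ l, sqJet k (f l) x := by
  simp only [Fin.sum_univ_three]
  have h1 := sqJet_add_le k ((hf 0).add (hf 1)) (hf 2) x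
  have h2 := sqJet_add_le k (hf 0) (hf 1) x
  have h3 := sqJet_nonneg k (f 2) x
  linarith

theorem SmoothField.sqJet {m : ℕ∞ω} (hm : m ≤ ∞) {J : Set ℝ} (k : ℕ) {u : ℝ → Vec3 ℝ → ℝ}
    (hu : SmoothField m J u) : SmoothField m J (fun t => sqJet k (u t)) := by
  induction k generalizing u with
  | zero => simpa only [_root_.sqJet, sq] using hu.mul hu
  | succ k ih =>
    simpa only [_root_.sqJet, sq] using
      (hu.mul hu).add (SmoothField.sum _ (fun i => ih (hu.partialDeriv i)) hm)

/-- Multiplication by a smooth field is bounded on jets, locally uniformly in space and time. -/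
theorem SmoothField.exists_sqJet_mul_le {m : ℕ∞ω} {T : ℝ} (k : ℕ) {a : ℝ → Vec3 ℝ → ℝ}
    (ha : SmoothField m (Icc 0 T) a) {K : Set (Vec3 ℝ)} (hK : IsCompact K) :
    ∃ C, 0 ≤ C ∧ ∀ t ∈ Icc 0 T, ∀ x ∈ K, ∀ w : Vec3 ℝ → ℝ, ContDiff ℝ ∞ w →
      _root_.sqJet k (fun x => a t x * w x) x ≤ C * _root_.sqJet k w x := by
  induction k generalizing a with
  | zero =>
    obtain ⟨C, hC0, hC⟩ := ha.exists_bound hK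
    refine ⟨C ^ 2, sq_nonneg _, fun t ht x hx w _ => ?_⟩
    simp only [_root_.sqJet, mul_pow]
    exact mul_le_mul_of_nonneg_right (sq_le_sq' (neg_le_of_abs_le (hC t ht x hx))
      (le_of_abs_le (hC t ht x hx))) (sq_nonneg _)
  | succ k ih =>
    obtain ⟨C, hC0, hC⟩ := ha.exists_bound hK
    obtain ⟨C₁, hC₁0, hC₁⟩ := ih ha
    choose C₂ hC₂0 hC₂ using fun i => ih (ha.partialDeriv i)
    refine ⟨C ^ 2 + 2 * C₁ + 2 * ∑ i, C₂ i, by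
      have := Finset.sum_nonneg fun i (_ : i ∈ (Finset.univ : Finset (Fin 3))) => hC₂0 i
      positivity,
      fun t ht x hx w hw => ?_⟩
    have hd : ∀ i, _root_.partialDeriv i (fun x => a t x * w x)
        = fun x => _root_.partialDeriv i (a t) x * w x + a t x * _root_.partialDeriv i w x :=
      partialDeriv_mul (ha.contDiff t ht).differentiable_field hw.differentiable_field
    simp only [_root_.sqJet, hd, mul_pow]
    have hsum : ∑ i, _root_.sqJet k (fun x => _root_.partialDeriv i (a t) x * w x
        + a t x * _root_.partialDeriv i w x) x
        ≤ ∑ i, (2 * (C₂ i * _root_.sqJet (k + 1) w x)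
          + 2 * (C₁ * _root_.sqJet k (_root_.partialDeriv i w) x)) := by
      refine Finset.sum_le_sum fun i _ => ?_
      refine (sqJet_add_le k (((ha.contDiff t ht).partialDeriv i).mul hw)
        ((ha.contDiff t ht).mul (hw.partialDeriv i)) x).trans ?_
      have e1 := (hC₂ i t ht x hx w hw).trans
        (mul_le_mul_of_nonneg_left (sqJet_le_succ k w x) (hC₂0 i))
      have e2 := hC₁ t ht x hx _ (hw.partialDeriv i)
      linarith
    rw [Finset.sum_add_distrib, ← Finset.mul_sum, ← Finset.sum_mul, ← Finset.mul_sum,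
      ← Finset.mul_sum] at hsum
    have e0 : a t x ^ 2 * w x ^ 2 ≤ C ^ 2 * w x ^ 2 :=
      mul_le_mul_of_nonneg_right (sq_le_sq' (neg_le_of_abs_le (hC t ht x hx))
        (le_of_abs_le (hC t ht x hx))) (sq_nonneg _)
    have e3 : ∑ i, _root_.sqJet k (_root_.partialDeriv i w) x ≤ _root_.sqJet (k + 1) w x :=
      le_add_of_nonneg_left (sq_nonneg _)
    have e4 := sq_le_sqJet (k + 1) w x
    have e5 : _root_.sqJet (k + 1) w x
      = w x ^ 2 + ∑ i, _root_.sqJet k (_root_.partialDeriv i w) x := rfl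
    rw [← e5]
    have e6 := mul_le_mul_of_nonneg_left e3 hC₁0
    have e7 := mul_le_mul_of_nonneg_left e4 (sq_nonneg C)
    nlinarith

/-! ### The energy inequality for jets -/

theorem cutoffIntegral_sqJet_succ {φ : Vec3 ℝ → ℝ} (hφ : Continuous φ) (hc : HasCompactSupport φ)
    (k : ℕ) {u : Vec3 ℝ → ℝ} (hu : ContDiff ℝ ∞ u) :
    cutoffIntegral φ (sqJet (k + 1) u) = cutoffIntegral φ (sqJet 0 u)
      + ∑ i, cutoffIntegral φ (sqJet k (partialDeriv i u)) := by
  have h : sqJet (k + 1) u = fun x => sqJet 0 u x + ∑ i, sqJet k (partialDeriv i u) x := rfl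
  have hs : Continuous fun x => ∑ i, sqJet k (partialDeriv i u) x :=
    continuous_finsetSum _ fun i _ => continuous_sqJet k (hu.partialDeriv i)
  rw [h, cutoffIntegral_add hφ hc (continuous_sqJet 0 hu) hs,
    cutoffIntegral_sum _ hφ hc fun i => continuous_sqJet k (hu.partialDeriv i)]

/-- The energy inequality summed over all spatial derivatives of order at most `k`. -/
theorem energy_inequality_sqJet {T β : ℝ} (hβ : 0 < β) (k : ℕ) {u : ℝ → Vec3 ℝ → ℝ}
    {G : Fin 3 → ℝ → Vec3 ℝ → ℝ} (hu : SmoothField 0 (Icc 0 T) u)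
    (hG : ∀ j, SmoothField 0 (Icc 0 T) (G j))
    (hd : ∀ t ∈ Icc 0 T, ∀ x, HasDerivWithinAt (fun s => u s x)
      (β * laplacianSum (u t) x + ∑ j, partialDeriv j (G j t) x) (Icc 0 T) t)
    {φ : Vec3 ℝ → ℝ} (hφ : ContDiff ℝ ∞ φ) (hc : HasCompactSupport φ) {t : ℝ}
    (ht : t ∈ Icc 0 T) :
    cutoffIntegral φ (sqJet k (u t))
        + β * ∫ s in (0 : ℝ)..t, ∑ i, cutoffIntegral φ (sqJet k (partialDeriv i (u s)))
      ≤ cutoffIntegral φ (sqJet k (u 0)) + (8 * β + 2 + 2 / β) * ∫ s in (0 : ℝ)..t,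
        (∑ i, cutoffIntegral (partialDeriv i φ) (sqJet k (u s))
          + ∑ j, cutoffIntegral φ (sqJet k (G j s))) := by
  have h0 : (0 : ℝ) ∈ Icc 0 T := ⟨le_rfl, ht.1.trans ht.2⟩
  have hsub : ∀ {s}, s ∈ uIcc 0 t → s ∈ Icc 0 T := fun {s} hs => by
    rw [uIcc_of_le ht.1] at hs
    exact ⟨hs.1, hs.2.trans ht.2⟩
  have hbase : ∀ {u : ℝ → Vec3 ℝ → ℝ} {G : Fin 3 → ℝ → Vec3 ℝ → ℝ},
      SmoothField 0 (Icc 0 T) u → (∀ j, SmoothField 0 (Icc 0 T) (G j)) →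
      (∀ t ∈ Icc 0 T, ∀ x, HasDerivWithinAt (fun s => u s x)
        (β * laplacianSum (u t) x + ∑ j, partialDeriv j (G j t) x) (Icc 0 T) t) →
      cutoffIntegral φ (sqJet 0 (u t))
        + β * ∫ s in (0 : ℝ)..t, ∑ i, cutoffIntegral φ (sqJet 0 (partialDeriv i (u s)))
      ≤ cutoffIntegral φ (sqJet 0 (u 0)) + (8 * β + 2 + 2 / β) * ∫ s in (0 : ℝ)..t,
        (∑ i, cutoffIntegral (partialDeriv i φ) (sqJet 0 (u s))
          + ∑ j, cutoffIntegral φ (sqJet 0 (G j s))) := by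
    intro u G hu hG hd
    have h := energy_inequality hβ hu hG hd hφ hc ht
    rwa [intervalIntegral.integral_congr fun s hs => cutoffIntegral_sum
      (f := fun i x => partialDeriv i (u s) x ^ 2) Finset.univ hφ.continuous hc fun i =>
        ((hu.contDiff s (hsub hs)).partialDeriv i).continuous.pow 2] at h
  induction k generalizing u G with
  | zero => exact hbase hu hG hd
  | succ k ih =>
    have hi : ∀ {ψ : Vec3 ℝ → ℝ}, ContDiff ℝ ∞ ψ → HasCompactSupport ψ → ∀ k
        {w : ℝ → Vec3 ℝ → ℝ}, SmoothField 0 (Icc 0 T) w →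
        IntervalIntegrable (fun s => cutoffIntegral ψ (sqJet k (w s))) volume 0 t :=
      fun hψ hcψ k _ hw => (hw.sqJet (by simp) k).intervalIntegrable_cutoffIntegral
        hψ.continuous hcψ ht
    have e0 := hbase hu hG hd
    have ei := Finset.sum_le_sum fun i (_ : i ∈ (Finset.univ : Finset (Fin 3))) =>
      ih (u := fun t => partialDeriv i (u t)) (G := fun j t => partialDeriv i (G j t))
      (hu.partialDeriv i) (fun j => (hG j).partialDeriv i) (fun t ht x => by
        have hR : SmoothField 0 (Icc 0 T)
            (fun t x => β * laplacianSum (u t) x + ∑ j, partialDeriv j (G j t) x) :=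
          ((hu.laplacianSum (by simp)).const_mul (by simp) β).add
            (SmoothField.sum _ (fun j => (hG j).partialDeriv j) (by simp))
        have h := hu.hasDerivWithinAt_partialDeriv hR hd i t ht x
        have hut := hu.contDiff t ht
        have hGt := fun j => (hG j).contDiff t ht
        rw [partialDeriv_add ((contDiff_const (c := β)).mul
            (laplacianSum_contDiff hut)).differentiable_field
          (ContDiff.sum fun j _ => (hGt j).partialDeriv j).differentiable_field,
          partialDeriv_const_mul (laplacianSum_contDiff hut).differentiable_field,
          partialDeriv_sum _ fun j => ((hGt j).partialDeriv j).differentiable_field] at h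
        have e : partialDeriv i (laplacianSum (u t)) = laplacianSum (partialDeriv i (u t)) := by
          have : laplacianSum (u t) = fun x => ∑ l, partialDeriv l (partialDeriv l (u t)) x := rfl
          rw [this, partialDeriv_sum _ fun l =>
            ((hut.partialDeriv l).partialDeriv l).differentiable_field]
          ext x
          refine Finset.sum_congr rfl fun l _ => ?_
          rw [partialDeriv_comm (hut.partialDeriv l), partialDeriv_comm hut]
        rw [e] at h
        simpa only [fun j => partialDeriv_comm (hGt j) i j] using h)
    have hfin := add_le_add e0 ei
    rw [Finset.sum_add_distrib, Finset.sum_add_distrib, ← Finset.mul_sum, ← Finset.mul_sum,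
      ← intervalIntegral.integral_finsetSum, ← intervalIntegral.integral_finsetSum] at hfin
    rotate_left
    · intro i _
      exact (intervalIntegrable_finsetSum fun l _ => hi (hφ.partialDeriv l) (hc.partialDeriv l) k
        (hu.partialDeriv i)).add (intervalIntegrable_finsetSum fun j _ => hi hφ hc k
          ((hG j).partialDeriv i))
    · intro i _
      exact intervalIntegrable_finsetSum fun l _ => hi hφ hc k
        ((hu.partialDeriv i).partialDeriv l)
    rw [cutoffIntegral_sqJet_succ hφ.continuous hc k (hu.contDiff t ht),
      cutoffIntegral_sqJet_succ hφ.continuous hc k (hu.contDiff 0 h0)]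
    have eL : ∫ s in (0 : ℝ)..t, ∑ i, cutoffIntegral φ (sqJet (k + 1) (partialDeriv i (u s)))
        = (∫ s in (0 : ℝ)..t, ∑ i, cutoffIntegral φ (sqJet 0 (partialDeriv i (u s))))
          + ∫ s in (0 : ℝ)..t, ∑ i, ∑ l,
            cutoffIntegral φ (sqJet k (partialDeriv l (partialDeriv i (u s)))) := by
      rw [← intervalIntegral.integral_add
        (intervalIntegrable_finsetSum fun i _ => hi hφ hc 0 (hu.partialDeriv i))
        (intervalIntegrable_finsetSum fun i _ => intervalIntegrable_finsetSum fun l _ =>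
          hi hφ hc k ((hu.partialDeriv i).partialDeriv l))]
      refine intervalIntegral.integral_congr fun s hs => ?_
      rw [← Finset.sum_add_distrib]
      exact Finset.sum_congr rfl fun i _ => cutoffIntegral_sqJet_succ hφ.continuous hc k
        ((hu.contDiff s (hsub hs)).partialDeriv i)
    have eR : ∫ s in (0 : ℝ)..t, (∑ i, cutoffIntegral (partialDeriv i φ) (sqJet (k + 1) (u s))
          + ∑ j, cutoffIntegral φ (sqJet (k + 1) (G j s)))
        = (∫ s in (0 : ℝ)..t, (∑ i, cutoffIntegral (partialDeriv i φ) (sqJet 0 (u s))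
          + ∑ j, cutoffIntegral φ (sqJet 0 (G j s))))
          + ∫ s in (0 : ℝ)..t, ∑ l, (∑ i, cutoffIntegral (partialDeriv i φ)
              (sqJet k (partialDeriv l (u s)))
            + ∑ j, cutoffIntegral φ (sqJet k (partialDeriv l (G j s)))) := by
      rw [← intervalIntegral.integral_add]
      rotate_left
      · exact (intervalIntegrable_finsetSum fun i _ => hi (hφ.partialDeriv i)
          (hc.partialDeriv i) 0 hu).add
          (intervalIntegrable_finsetSum fun j _ => hi hφ hc 0 (hG j))
      · exact intervalIntegrable_finsetSum fun l _ => (intervalIntegrable_finsetSum fun i _ =>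
          hi (hφ.partialDeriv i) (hc.partialDeriv i) k (hu.partialDeriv l)).add
          (intervalIntegrable_finsetSum fun j _ => hi hφ hc k ((hG j).partialDeriv l))
      refine intervalIntegral.integral_congr fun s hs => ?_
      have c1 : ∑ l, ∑ i, cutoffIntegral (partialDeriv i φ) (sqJet k (partialDeriv l (u s)))
          = ∑ i, ∑ l, cutoffIntegral (partialDeriv i φ) (sqJet k (partialDeriv l (u s))) :=
        Finset.sum_comm
      have c2 : ∑ l, ∑ j, cutoffIntegral φ (sqJet k (partialDeriv l (G j s)))
          = ∑ j, ∑ l, cutoffIntegral φ (sqJet k (partialDeriv l (G j s))) := Finset.sum_comm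
      rw [Finset.sum_add_distrib, c1, c2]
      rw [Finset.sum_congr rfl fun i _ => cutoffIntegral_sqJet_succ
        (hφ.partialDeriv i).continuous (hc.partialDeriv i) k (hu.contDiff s (hsub hs)),
        Finset.sum_congr rfl fun j _ => cutoffIntegral_sqJet_succ
        hφ.continuous hc k ((hG j).contDiff s (hsub hs)), Finset.sum_add_distrib,
        Finset.sum_add_distrib]
      ring
    rw [eL, eR]
    linarith

/-! ### A Sobolev inequality -/

theorem enorm_le_lintegral_partialDeriv {g : Vec3 ℝ → ℝ} (hg : ContDiff ℝ ∞ g)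
    (hc : HasCompactSupport g) (i : Fin 3) (y : Fin 3 → ℝ) :
    ‖g (WithLp.toLp 2 y)‖ₑ
      ≤ ∫⁻ r : ℝ, ‖partialDeriv i g (WithLp.toLp 2 (Function.update y i r))‖ₑ := by
  have hline : ∀ r : ℝ, WithLp.toLp 2 (Function.update y i r)
      = WithLp.toLp 2 (Function.update y i 0) + r • EuclideanSpace.single (𝕜 := ℝ) i 1 := by
    intro r
    ext j
    by_cases h : j = i
    · subst h; simp
    · simp [h]
  set z : Vec3 ℝ := WithLp.toLp 2 (Function.update y i 0) with hz
  have hd := hasDerivAt_line hg.differentiable_field i z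
  have hderiv : deriv (fun r : ℝ => g (z + r • EuclideanSpace.single i 1))
      = fun r => partialDeriv i g (z + r • EuclideanSpace.single i 1) :=
    funext fun r => (hd r).deriv
  have hsmooth : ContDiff ℝ 1 fun r : ℝ => g (z + r • EuclideanSpace.single i 1) :=
    (hg.of_le (by simp)).comp (by fun_prop)
  have hcs : HasCompactSupport fun r : ℝ => g (z + r • EuclideanSpace.single i 1) := by
    refine hc.comp_isClosedEmbedding (g := fun r : ℝ => z + r • EuclideanSpace.single i (1 : ℝ)) ?_
    have : Isometry fun r : ℝ => z + r • EuclideanSpace.single (𝕜 := ℝ) i 1 := by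
      refine Isometry.of_dist_eq fun a b => ?_
      rw [dist_add_left, dist_eq_norm, ← sub_smul, norm_smul]
      simp [Real.dist_eq]
    exact this.isClosedEmbedding
  have h := HasCompactSupport.enorm_le_lintegral_Ici_deriv hsmooth hcs (y i)
  rw [← hline, Function.update_eq_self, hderiv] at h
  refine h.trans ((setLIntegral_le_lintegral _ _).trans (le_of_eq ?_))
  simp_rw [hline]

theorem lmarginal_enorm_le {g : Vec3 ℝ → ℝ} (hg : ContDiff ℝ ∞ g) (hc : HasCompactSupport g)
    {s : Finset (Fin 3)} {i : Fin 3} (hi : i ∉ s) :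
    lmarginal (fun _ => (volume : Measure ℝ)) s (fun y => ‖g (WithLp.toLp 2 y)‖ₑ)
      ≤ lmarginal (fun _ => (volume : Measure ℝ)) (insert i s)
        (fun y => ‖partialDeriv i g (WithLp.toLp 2 y)‖ₑ) := by
  rw [lmarginal_insert' _ _ hi]
  · exact lmarginal_mono fun y => enorm_le_lintegral_partialDeriv hg hc i y
  · exact ((hg.partialDeriv i).continuous.comp
      (PiLp.continuous_toLp 2 _)).measurable.enorm

/-- A compactly supported function on `ℝ³` is bounded by the `L¹` norm of its mixed third
derivative, by the fundamental theorem of calculus in each variable. -/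
theorem abs_le_integral_partialDeriv {g : Vec3 ℝ → ℝ} (hg : ContDiff ℝ ∞ g)
    (hc : HasCompactSupport g) (x : Vec3 ℝ) :
    |g x| ≤ ∫ y, |iterPartial [0, 1, 2] g y| := by
  have h0 := lmarginal_enorm_le hg hc (s := ∅) (i := 0) (by simp)
  have h1 := lmarginal_enorm_le (hg.partialDeriv 0) (hc.partialDeriv 0) (s := {0}) (i := 1)
    (by simp)
  have h2 := lmarginal_enorm_le ((hg.partialDeriv 0).partialDeriv 1)
    ((hc.partialDeriv 0).partialDeriv 1) (s := {1, 0}) (i := 2) (by decide)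
  have h3 := (h0.trans (h1.trans h2)) (WithLp.ofLp x)
  have hu : (insert 2 {1, 0} : Finset (Fin 3)) = Finset.univ := by decide
  rw [hu, lmarginal_univ, lmarginal_empty] at h3
  have hsm := ((hg.partialDeriv 0).partialDeriv 1).partialDeriv 2
  have hcs := ((hc.partialDeriv 0).partialDeriv 1).partialDeriv 2
  have hmp := (EuclideanSpace.volume_preserving_symm_measurableEquiv_toLp (Fin 3)).symm
  have h4 : ∫⁻ y : Fin 3 → ℝ, ‖partialDeriv 2 (partialDeriv 1 (partialDeriv 0 g))
      (WithLp.toLp 2 y)‖ₑ = ∫⁻ y : Vec3 ℝ, ‖iterPartial [0, 1, 2] g y‖ₑ :=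
    hmp.lintegral_comp hsm.continuous.measurable.enorm
  have h5 : ENNReal.ofReal |g x| ≤ ENNReal.ofReal (∫ y, |iterPartial [0, 1, 2] g y|) := by
    have hint : Integrable (iterPartial [0, 1, 2] g) :=
      hsm.continuous.integrable_of_hasCompactSupport hcs
    have h6 := ofReal_integral_norm_eq_lintegral_enorm hint
    simp only [Real.norm_eq_abs] at h6
    rw [h6, ← h4, ← Real.enorm_eq_ofReal_abs]
    exact h3
  exact (ENNReal.ofReal_le_ofReal_iff (integral_nonneg fun _ => abs_nonneg _)).1 h5

/-! ### Cutoffs on large balls -/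

/-- A smooth bump function equal to `1` on the unit ball and supported in the ball of radius `2`. -/
def unitBump : ContDiffBump (0 : Vec3 ℝ) := ⟨1, 2, one_pos, one_lt_two⟩

/-- The bump function rescaled to length `R`. -/
def ballCutoff (R : ℝ) (x : Vec3 ℝ) : ℝ := unitBump (R⁻¹ • x)

theorem ballCutoff_contDiff (R : ℝ) : ContDiff ℝ ∞ (ballCutoff R) :=
  unitBump.contDiff.comp (contDiff_const_smul _)

theorem ballCutoff_nonneg (R : ℝ) (x : Vec3 ℝ) : 0 ≤ ballCutoff R x := unitBump.nonneg

theorem ballCutoff_le_one (R : ℝ) (x : Vec3 ℝ) : ballCutoff R x ≤ 1 := unitBump.le_one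

theorem ballCutoff_sq_le_one (R : ℝ) (x : Vec3 ℝ) : ballCutoff R x ^ 2 ≤ 1 :=
  pow_le_one₀ (ballCutoff_nonneg R x) (ballCutoff_le_one R x)

theorem ballCutoff_eq_one {R : ℝ} (hR : 0 < R) {x : Vec3 ℝ} (hx : ‖x‖ ≤ R) :
    ballCutoff R x = 1 := by
  refine unitBump.one_of_mem_closedBall ?_
  rw [mem_closedBall_zero_iff, norm_smul, norm_inv, Real.norm_of_nonneg hR.le]
  exact (inv_mul_le_iff₀ hR).2 (by simpa [unitBump] using hx)

theorem ballCutoff_eq_zero {R : ℝ} (hR : 0 < R) {x : Vec3 ℝ} (hx : 2 * R ≤ ‖x‖) :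
    ballCutoff R x = 0 := by
  refine unitBump.zero_of_le_dist ?_
  rw [dist_zero_right, norm_smul, norm_inv, Real.norm_of_nonneg hR.le]
  exact (le_inv_mul_iff₀ hR).2 (by simpa [unitBump, mul_comm] using hx)

theorem ballCutoff_tsupport {R : ℝ} (hR : 0 < R) :
    tsupport (ballCutoff R) ⊆ Metric.closedBall 0 (2 * R) := by
  refine closure_minimal (fun x hx => ?_) Metric.isClosed_closedBall
  rw [mem_closedBall_zero_iff]
  by_contra! h
  exact hx (ballCutoff_eq_zero hR h.le)

theorem ballCutoff_hasCompactSupport {R : ℝ} (hR : 0 < R) : HasCompactSupport (ballCutoff R) :=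
  (isCompact_closedBall _ _).of_isClosed_subset (isClosed_tsupport _) (ballCutoff_tsupport hR)

/-- The gradient of the cutoff at scale `R` is of size `1 / R`, and lives where the cutoff at scale
`2R` equals `1`. -/
theorem exists_ballCutoff_gradient_le : ∃ c : ℝ, 0 ≤ c ∧ ∀ R : ℝ, 0 < R → ∀ i x,
    partialDeriv i (ballCutoff R) x ^ 2 ≤ c / R ^ 2 * ballCutoff (2 * R) x ^ 2 := by
  have hb : ∀ i, ∃ c : ℝ, ∀ x, ‖partialDeriv i (unitBump : Vec3 ℝ → ℝ) x‖ ≤ c := fun i =>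
    ((unitBump.contDiff (n := ⊤)).partialDeriv i).continuous.bounded_above_of_compact_support
      (unitBump.hasCompactSupport.partialDeriv i)
  choose c hc using hb
  refine ⟨∑ i, c i ^ 2, Finset.sum_nonneg fun i _ => sq_nonneg _, fun R hR i x => ?_⟩
  by_cases hx : x ∈ tsupport (ballCutoff R)
  · have h2 : ballCutoff (2 * R) x = 1 :=
      ballCutoff_eq_one (by positivity) (mem_closedBall_zero_iff.1 (ballCutoff_tsupport hR hx))
    have h3 : partialDeriv i (ballCutoff R) x
        = R⁻¹ * partialDeriv i (unitBump : Vec3 ℝ → ℝ) (R⁻¹ • x) := by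
      have hd := ((unitBump.contDiff (n := ⊤)).differentiable (by simp) (R⁻¹ • x)).hasFDerivAt
      have hl : HasFDerivAt (fun x : Vec3 ℝ => R⁻¹ • x)
          (R⁻¹ • ContinuousLinearMap.id ℝ (Vec3 ℝ)) x := (hasFDerivAt_id x).const_smul R⁻¹
      have := (hd.comp x hl).fderiv
      have h : fderiv ℝ (ballCutoff R) x = _ := this
      simp [partialDeriv, h]
    rw [h2, h3, mul_pow, one_pow, mul_one, inv_pow, div_eq_inv_mul]
    refine mul_le_mul_of_nonneg_left ?_ (by positivity)
    refine le_trans ?_ (Finset.single_le_sum (f := fun i => c i ^ 2)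
      (fun i _ => sq_nonneg _) (Finset.mem_univ i))
    exact sq_le_sq' (neg_le_of_abs_le (hc i _)) (le_of_abs_le (hc i _))
  · rw [partialDeriv_eq_zero_of_notMem_tsupport i hx]
    have : 0 ≤ ∑ i, c i ^ 2 := Finset.sum_nonneg fun i _ => sq_nonneg _
    simp only [ne_eq, OfNat.ofNat_ne_zero, not_false_eq_true, zero_pow]
    positivity

/-- Local Sobolev inequality: third-order jets control point values. -/
theorem exists_sq_le_cutoffIntegral_sqJet {φ : Vec3 ℝ → ℝ} (hφ : ContDiff ℝ ∞ φ)
    (hc : HasCompactSupport φ) {ψ : Vec3 ℝ → ℝ} (hψ : ContDiff ℝ ∞ ψ) (hcψ : HasCompactSupport ψ)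
    (hφψ : ∀ x ∈ tsupport φ, ψ x = 1) :
    ∃ C, 0 ≤ C ∧ ∀ w : Vec3 ℝ → ℝ, ContDiff ℝ ∞ w → ∀ x, φ x = 1 →
      w x ^ 2 ≤ C * cutoffIntegral ψ (sqJet 3 w) := by
  obtain ⟨C, hC0, hC⟩ := (SmoothField.of_contDiff (m := 0) (J := Icc (0 : ℝ) 0) hφ
    (by simp)).exists_sqJet_mul_le 3 hc
  set V := (volume (tsupport φ)).toReal with hV
  have hVfin : volume (tsupport φ) ≠ ⊤ := hc.measure_lt_top.ne
  refine ⟨V * C, mul_nonneg ENNReal.toReal_nonneg hC0, fun w hw x hx => ?_⟩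
  have hφw : ContDiff ℝ ∞ fun x => φ x * w x := hφ.mul hw
  have hcw : HasCompactSupport fun x => φ x * w x := hc.mul_right
  set D := iterPartial [0, 1, 2] fun x => φ x * w x with hD
  have hDc : Continuous D := (hφw.iterPartial _).continuous
  have hD0 : ∀ y, y ∉ tsupport φ → D y = 0 := by
    intro y hy
    have h0 : (fun x => φ x * w x) =ᶠ[𝓝 y] fun _ => 0 := by
      filter_upwards [notMem_tsupport_iff_eventuallyEq.1 hy] with z hz
      simp [hz]
    have := (iterPartial_congr [0, 1, 2] h0).eq_of_nhds
    rw [iterPartial_zero] at this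
    exact this
  have hDcs : HasCompactSupport D := HasCompactSupport.intro hc hD0
  have h1 : |w x| ≤ ∫ y, |D y| := by
    simpa [hx] using abs_le_integral_partialDeriv hφw hcw x
  have h2 : ∫ y, |D y| = ∫ y in tsupport φ, |D y| :=
    (setIntegral_eq_integral_of_forall_compl_eq_zero fun y hy => by simp [hD0 y hy]).symm
  have hi1 : IntegrableOn (fun y => |D y|) (tsupport φ) :=
    (hDc.abs.integrable_of_hasCompactSupport hDcs.norm).integrableOn
  have hi2 : Integrable fun y => D y ^ 2 :=
    (hDc.pow 2).integrable_of_hasCompactSupport (hDcs.mono fun x hx hx' => hx (by simp [hx']))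
  -- Cauchy–Schwarz on the support of the cutoff
  have h3 : (∫ y in tsupport φ, |D y|) ^ 2 ≤ V * ∫ y, D y ^ 2 := by
    have h4 : ∫ y in tsupport φ, D y ^ 2 ≤ ∫ y, D y ^ 2 :=
      setIntegral_le_integral hi2 (Eventually.of_forall fun y => sq_nonneg _)
    set I := ∫ y in tsupport φ, |D y| with hI
    have h5 : ∀ c : ℝ, 2 * c * I ≤ c ^ 2 * V + ∫ y in tsupport φ, D y ^ 2 := by
      intro c
      have e : ∫ y in tsupport φ, (c ^ 2 + D y ^ 2) = c ^ 2 * V + ∫ y in tsupport φ, D y ^ 2 := by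
        rw [integral_add (integrableOn_const (C := c ^ 2) hVfin (by simp)).integrable
          hi2.integrableOn]
        simp [hV, Measure.real, mul_comm]
      rw [← e, hI, ← integral_const_mul]
      refine integral_mono (hi1.const_mul _)
        ((integrableOn_const (C := c ^ 2) hVfin (by simp)).add hi2.integrableOn)
        fun y => ?_
      have := two_mul_le_add_sq c |D y|
      simpa [sq_abs] using this
    have hV0 : 0 ≤ V := ENNReal.toReal_nonneg
    rcases hV0.eq_or_lt with hV0 | hV0
    · have : volume (tsupport φ) = 0 := by
        rcases (ENNReal.toReal_eq_zero_iff _).1 hV0.symm with h | h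
        · exact h
        · exact absurd h hVfin
      have : I = 0 := by rw [hI, Measure.restrict_eq_zero.2 this]; simp
      rw [this, ← hV0]
      simp
    · have h6 := h5 (I / V)
      have h7 : 2 * (I / V) * I = 2 * (I ^ 2 / V) := by ring
      have h8 : (I / V) ^ 2 * V = I ^ 2 / V := by field_simp
      rw [h7, h8] at h6
      have h9 : I ^ 2 / V ≤ ∫ y, D y ^ 2 := by linarith
      rw [div_le_iff₀ hV0] at h9
      linarith
  have h10 : ∫ y, D y ^ 2 ≤ C * cutoffIntegral ψ (sqJet 3 w) := by
    rw [← cutoffIntegral_const_mul]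
    refine integral_mono hi2 (integrable_cutoff hψ.continuous hcψ
      (continuous_const.mul (continuous_sqJet 3 hw))) fun y => ?_
    by_cases hy : y ∈ tsupport φ
    · simp only [hφψ y hy, one_pow, one_mul]
      refine le_trans ?_ (hC 0 ⟨le_rfl, le_rfl⟩ y hy w hw)
      exact (sq_le_sqJet 0 _ y).trans (sqJet_iterPartial_le 0 [0, 1, 2] _ y)
    · simp only [hD0 y hy, ne_eq, OfNat.ofNat_ne_zero, not_false_eq_true, zero_pow]
      exact mul_nonneg (sq_nonneg _) (mul_nonneg hC0 (sqJet_nonneg 3 w y))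
  calc w x ^ 2 = |w x| ^ 2 := (sq_abs _).symm
    _ ≤ (∫ y, |D y|) ^ 2 := by gcongr
    _ ≤ V * ∫ y, D y ^ 2 := by rw [h2]; exact h3
    _ ≤ V * (C * cutoffIntegral ψ (sqJet 3 w)) :=
      mul_le_mul_of_nonneg_left h10 ENNReal.toReal_nonneg
    _ = _ := by ring

/-! ### Averages of translates of a compactly supported field -/

/-- A field, spatially smooth at all real times, that is supported in the compact set `K`. -/
structure CompactField (K : Set (Vec3 ℝ)) (g : ℝ → Vec3 ℝ → ℝ) : Prop where
  smooth : SmoothField 0 univ g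
  isCompact : IsCompact K
  eq_zero : ∀ t x, x ∉ K → g t x = 0

namespace CompactField

variable {K : Set (Vec3 ℝ)} {g : ℝ → Vec3 ℝ → ℝ}

theorem partialDeriv (hg : CompactField K g) (i : Fin 3) :
    CompactField K (fun t => partialDeriv i (g t)) where
  smooth := hg.smooth.partialDeriv i
  isCompact := hg.isCompact
  eq_zero t x hx := by
    refine partialDeriv_eq_zero_of_notMem_tsupport i fun h => hx ?_
    refine closure_minimal (fun y hy => ?_) hg.isCompact.isClosed h
    by_contra hyK
    exact hy (hg.eq_zero t y hyK)

theorem laplacianSum (hg : CompactField K g) : CompactField K (fun t => laplacianSum (g t)) where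
  smooth := hg.smooth.laplacianSum (by simp)
  isCompact := hg.isCompact
  eq_zero t x hx := Finset.sum_eq_zero fun l _ =>
    ((hg.partialDeriv l).partialDeriv l).eq_zero t x hx

theorem continuous (hg : CompactField K g) : Continuous fun p : ℝ × Vec3 ℝ => g p.1 p.2 := by
  have := hg.smooth.continuousOn
  rwa [univ_prod_univ, continuousOn_univ] at this

theorem exists_bound (hg : CompactField K g) (T : ℝ) :
    ∃ C, 0 ≤ C ∧ ∀ t, |t| ≤ T → ∀ x, |g t x| ≤ C := by
  obtain ⟨C, hC⟩ := ((isCompact_Icc (a := -T) (b := T)).prod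
    hg.isCompact).exists_bound_of_continuousOn hg.continuous.continuousOn
  refine ⟨max C 0, le_max_right _ _, fun t ht x => ?_⟩
  by_cases hx : x ∈ K
  · exact (hC (t, x) ⟨abs_le.1 ht, hx⟩).trans (le_max_left _ _)
  · simp [hg.eq_zero t x hx]

theorem differentiable (hg : CompactField K g) (t : ℝ) : Differentiable ℝ (g t) :=
  (hg.smooth.contDiff t (mem_univ t)).differentiable_field

theorem continuous_fderiv (hg : CompactField K g) :
    Continuous fun p : ℝ × Vec3 ℝ => fderiv ℝ (g p.1) p.2 := by
  simp_rw [fderiv_eq_sum_partialDeriv]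
  exact continuous_finsetSum _ fun i _ => (hg.partialDeriv i).continuous.smul continuous_const

theorem exists_fderiv_bound (hg : CompactField K g) (T : ℝ) :
    ∃ C, 0 ≤ C ∧ ∀ t, |t| ≤ T → ∀ x, ‖fderiv ℝ (g t) x‖ ≤ C := by
  choose C hC0 hC using fun i => (hg.partialDeriv i).exists_bound T
  refine ⟨∑ i, C i * ‖(EuclideanSpace.proj i : Vec3 ℝ →L[ℝ] ℝ)‖,
    Finset.sum_nonneg fun i _ => mul_nonneg (hC0 i) (norm_nonneg _), fun t ht x => ?_⟩
  rw [fderiv_eq_sum_partialDeriv]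
  refine norm_sum_le_of_le _ fun i _ => ?_
  rw [norm_smul]
  exact mul_le_mul_of_nonneg_right (hC i t ht x) (norm_nonneg _)

end CompactField

section shiftAverage

variable {Q Y : Type} [TopologicalSpace Q] [TopologicalSpace Y] [MeasurableSpace Y] [BorelSpace Y]

/-- The average of the translates `g(τ, · + ζ)`, where the time `τ` and the shift `ζ` depend on a
parameter `q` and on a random variable with law `μ`. -/
def shiftAverage (μ : Measure Y) (τ : Q → Y → ℝ) (ζ : Q → Y → Vec3 ℝ) (g : ℝ → Vec3 ℝ → ℝ)
    (q : Q) (x : Vec3 ℝ) : ℝ :=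
  ∫ y, g (τ q y) (x + ζ q y) ∂μ

variable {μ : Measure Y} [IsFiniteMeasure μ] {τ : Q → Y → ℝ} {ζ : Q → Y → Vec3 ℝ}
  {K : Set (Vec3 ℝ)} {g : ℝ → Vec3 ℝ → ℝ}

theorem CompactField.integrable_shift (hg : CompactField K g)
    (hτ : Continuous (Function.uncurry τ)) (hζ : Continuous (Function.uncurry ζ))
    (hb : ∀ q₀, ∃ T, ∀ᶠ q in 𝓝 q₀, ∀ᵐ y ∂μ, |τ q y| ≤ T) (q : Q) (x : Vec3 ℝ) :
    Integrable (fun y => g (τ q y) (x + ζ q y)) μ := by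
  obtain ⟨T, hT⟩ := hb q
  obtain ⟨C, -, hC⟩ := hg.exists_bound T
  have hc : Continuous fun y => g (τ q y) (x + ζ q y) := hg.continuous.comp
    ((hτ.comp (Continuous.prodMk_right q)).prodMk
      (continuous_const.add (hζ.comp (Continuous.prodMk_right q))))
  refine Integrable.mono' (integrable_const C) hc.aestronglyMeasurable ?_
  filter_upwards [hT.self_of_nhds] with y hy using hC _ hy _

theorem CompactField.continuous_shiftAverage [FirstCountableTopology Q] (hg : CompactField K g)
    (hτ : Continuous (Function.uncurry τ)) (hζ : Continuous (Function.uncurry ζ))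
    (hb : ∀ q₀, ∃ T, ∀ᶠ q in 𝓝 q₀, ∀ᵐ y ∂μ, |τ q y| ≤ T) :
    Continuous fun p : Q × Vec3 ℝ => shiftAverage μ τ ζ g p.1 p.2 := by
  refine continuous_iff_continuousAt.2 fun p₀ => ?_
  obtain ⟨T, hT⟩ := hb p₀.1
  obtain ⟨C, -, hC⟩ := hg.exists_bound T
  refine continuousAt_of_dominated (bound := fun _ => C) ?_ ?_ (integrable_const C) ?_
  · exact Eventually.of_forall fun p =>
      (hg.integrable_shift hτ hζ hb p.1 p.2).aestronglyMeasurable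
  · filter_upwards [continuousAt_fst.eventually hT] with p hp
    filter_upwards [hp] with y hy using hC _ hy _
  · refine Eventually.of_forall fun y => Continuous.continuousAt ?_
    have h1 : Continuous fun p : Q × Vec3 ℝ => (p.1, y) := by fun_prop
    exact hg.continuous.comp ((hτ.comp h1).prodMk (continuous_snd.add (hζ.comp h1)))

theorem CompactField.hasFDerivAt_shiftAverage (hg : CompactField K g)
    (hτ : Continuous (Function.uncurry τ)) (hζ : Continuous (Function.uncurry ζ))
    (hb : ∀ q₀, ∃ T, ∀ᶠ q in 𝓝 q₀, ∀ᵐ y ∂μ, |τ q y| ≤ T) (q : Q) (x : Vec3 ℝ) :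
    Integrable (fun y => fderiv ℝ (g (τ q y)) (x + ζ q y)) μ ∧
    HasFDerivAt (shiftAverage μ τ ζ g q) (∫ y, fderiv ℝ (g (τ q y)) (x + ζ q y) ∂μ) x := by
  obtain ⟨T, hT⟩ := hb q
  obtain ⟨C, -, hC⟩ := hg.exists_fderiv_bound T
  have hc : Continuous fun y => fderiv ℝ (g (τ q y)) (x + ζ q y) := hg.continuous_fderiv.comp
    ((hτ.comp (Continuous.prodMk_right q)).prodMk
      (continuous_const.add (hζ.comp (Continuous.prodMk_right q))))
  refine ⟨Integrable.mono' (integrable_const C) hc.aestronglyMeasurable ?_,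
    hasFDerivAt_integral_of_dominated_of_fderiv_le (s := univ) (bound := fun _ => C)
    (F' := fun x y => fderiv ℝ (g (τ q y)) (x + ζ q y)) univ_mem ?_
    (hg.integrable_shift hτ hζ hb q x) hc.aestronglyMeasurable ?_ (integrable_const C) ?_⟩
  · filter_upwards [hT.self_of_nhds] with y hy using hC _ hy _
  · exact Eventually.of_forall fun x => (hg.integrable_shift hτ hζ hb q x).aestronglyMeasurable
  · filter_upwards [hT.self_of_nhds] with y hy x _ using hC _ hy _
  · refine Eventually.of_forall fun y x _ => ?_
    have h1 := (hg.differentiable (τ q y) (x + ζ q y)).hasFDerivAt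
    have h2 := h1.comp x ((hasFDerivAt_id x).add_const (ζ q y))
    simpa using! h2

theorem CompactField.partialDeriv_shiftAverage (hg : CompactField K g)
    (hτ : Continuous (Function.uncurry τ)) (hζ : Continuous (Function.uncurry ζ))
    (hb : ∀ q₀, ∃ T, ∀ᶠ q in 𝓝 q₀, ∀ᵐ y ∂μ, |τ q y| ≤ T) (q : Q) (i : Fin 3) :
    _root_.partialDeriv i (shiftAverage μ τ ζ g q)
      = shiftAverage μ τ ζ (fun t => _root_.partialDeriv i (g t)) q := by
  ext x
  obtain ⟨h1, h2⟩ := hg.hasFDerivAt_shiftAverage hτ hζ hb q x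
  simp only [_root_.partialDeriv, shiftAverage, h2.fderiv]
  exact ContinuousLinearMap.integral_apply h1 _

theorem CompactField.iterPartial_shiftAverage (γ : List (Fin 3)) (hg : CompactField K g)
    (hτ : Continuous (Function.uncurry τ)) (hζ : Continuous (Function.uncurry ζ))
    (hb : ∀ q₀, ∃ T, ∀ᶠ q in 𝓝 q₀, ∀ᵐ y ∂μ, |τ q y| ≤ T) (q : Q) :
    _root_.iterPartial γ (shiftAverage μ τ ζ g q)
      = shiftAverage μ τ ζ (fun t => _root_.iterPartial γ (g t)) q := by
  induction γ generalizing g with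
  | nil => rfl
  | cons i γ ih =>
    simp only [_root_.iterPartial]
    rw [hg.partialDeriv_shiftAverage hτ hζ hb, ih (hg.partialDeriv i)]

theorem CompactField.iterPartial (γ : List (Fin 3)) (hg : CompactField K g) :
    CompactField K (fun t => iterPartial γ (g t)) := by
  induction γ generalizing g with
  | nil => exact hg
  | cons i γ ih => exact ih (hg.partialDeriv i)

theorem CompactField.contDiff_shiftAverage (hg : CompactField K g)
    (hτ : Continuous (Function.uncurry τ)) (hζ : Continuous (Function.uncurry ζ))
    (hb : ∀ q₀, ∃ T, ∀ᶠ q in 𝓝 q₀, ∀ᵐ y ∂μ, |τ q y| ≤ T) (q : Q) :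
    ContDiff ℝ ∞ (shiftAverage μ τ ζ g q) := by
  refine contDiff_of_differentiable_iterPartial fun γ => ?_
  rw [hg.iterPartial_shiftAverage γ hτ hζ hb]
  exact fun x => ((hg.iterPartial γ).hasFDerivAt_shiftAverage hτ hζ hb q x).2.differentiableAt

end shiftAverage

/-! ### The heat semigroup as a Gaussian average -/

/-- The standard Gaussian density on `ℝ³`. -/
def gaussDensity (z : Vec3 ℝ) : ℝ :=
  (∫ y : Vec3 ℝ, Real.exp (-(1 / 2) * ‖y‖ ^ 2))⁻¹ * Real.exp (-(1 / 2) * ‖z‖ ^ 2)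

/-- The standard Gaussian measure on `ℝ³`. -/
def gaussMeasure : Measure (Vec3 ℝ) := volume.withDensity fun z => ENNReal.ofReal (gaussDensity z)

theorem integrable_exp_neg_mul_sq_norm {b : ℝ} (hb : 0 < b) :
    Integrable fun z : Vec3 ℝ => Real.exp (-b * ‖z‖ ^ 2) := by
  have h := (GaussianFourier.integrable_cexp_neg_mul_sq_norm_add (b := (b : ℂ)) (by simpa using hb)
    0 (0 : Vec3 ℝ)).re
  refine h.congr (Eventually.of_forall fun z => ?_)
  simp only [zero_mul, add_zero]
  rw [show -(b : ℂ) * (‖z‖ : ℂ) ^ 2 = ((-b * ‖z‖ ^ 2 : ℝ) : ℂ) by push_cast; ring]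
  exact Complex.exp_ofReal_re _

theorem gaussDensity_contDiff : ContDiff ℝ ∞ gaussDensity :=
  contDiff_const.mul (Real.contDiff_exp.comp (contDiff_const.mul (contDiff_norm_sq ℝ)))

theorem gaussDensity_nonneg (z : Vec3 ℝ) : 0 ≤ gaussDensity z :=
  mul_nonneg (inv_nonneg.2 (integral_nonneg fun _ => (Real.exp_pos _).le)) (Real.exp_pos _).le

theorem integrable_gaussDensity : Integrable gaussDensity :=
  (integrable_exp_neg_mul_sq_norm one_half_pos).const_mul _

theorem integral_gaussDensity : ∫ z, gaussDensity z = 1 := by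
  simp only [gaussDensity, integral_const_mul]
  refine inv_mul_cancel₀ (ne_of_gt ?_)
  rw [GaussianFourier.integral_rexp_neg_mul_sq_norm one_half_pos]
  positivity

theorem measurable_ofReal_gaussDensity :
    Measurable fun z => ENNReal.ofReal (gaussDensity z) :=
  gaussDensity_contDiff.continuous.measurable.ennreal_ofReal

instance : IsProbabilityMeasure gaussMeasure := by
  refine ⟨?_⟩
  rw [gaussMeasure, withDensity_apply _ MeasurableSet.univ, Measure.restrict_univ,
    ← ofReal_integral_eq_lintegral_ofReal integrable_gaussDensity
      (Eventually.of_forall gaussDensity_nonneg), integral_gaussDensity, ENNReal.ofReal_one]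

theorem integral_gaussMeasure (h : Vec3 ℝ → ℝ) :
    ∫ z, h z ∂gaussMeasure = ∫ z, gaussDensity z * h z := by
  rw [gaussMeasure, integral_withDensity_eq_integral_toReal_smul measurable_ofReal_gaussDensity
    (Eventually.of_forall fun _ => ENNReal.ofReal_lt_top)]
  simp [ENNReal.toReal_ofReal (gaussDensity_nonneg _)]

theorem integrable_norm_gaussMeasure : Integrable (fun z : Vec3 ℝ => ‖z‖) gaussMeasure := by
  rw [gaussMeasure, integrable_withDensity_iff measurable_ofReal_gaussDensity
    (Eventually.of_forall fun _ => ENNReal.ofReal_lt_top)]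
  set c := (∫ y : Vec3 ℝ, Real.exp (-(1 / 2) * ‖y‖ ^ 2))⁻¹ with hc
  have hc0 : 0 ≤ c := inv_nonneg.2 (integral_nonneg fun _ => (Real.exp_pos _).le)
  refine Integrable.mono' ((integrable_exp_neg_mul_sq_norm (b := 1 / 4) (by norm_num)).const_mul c)
    (continuous_norm.measurable.mul
      measurable_ofReal_gaussDensity.ennreal_toReal).aestronglyMeasurable
    (Eventually.of_forall fun z => ?_)
  rw [ENNReal.toReal_ofReal (gaussDensity_nonneg z), Real.norm_of_nonneg
    (mul_nonneg (norm_nonneg z) (gaussDensity_nonneg z)), gaussDensity, ← hc]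
  have h1 : ‖z‖ ≤ Real.exp (1 / 4 * ‖z‖ ^ 2) := by
    have := Real.add_one_le_exp (1 / 4 * ‖z‖ ^ 2)
    nlinarith [sq_nonneg (‖z‖ / 2 - 1)]
  calc ‖z‖ * (c * Real.exp (-(1 / 2) * ‖z‖ ^ 2))
      ≤ Real.exp (1 / 4 * ‖z‖ ^ 2) * (c * Real.exp (-(1 / 2) * ‖z‖ ^ 2)) := by gcongr
    _ = c * Real.exp (-(1 / 4) * ‖z‖ ^ 2) := by
      rw [mul_left_comm, ← Real.exp_add]
      congr 2; ring

theorem partialDeriv_gaussDensity (i : Fin 3) (z : Vec3 ℝ) :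
    partialDeriv i gaussDensity z = -(z i * gaussDensity z) := by
  have h1 : HasFDerivAt (fun z : Vec3 ℝ => ‖z‖ ^ 2) (2 • innerSL ℝ z) z :=
    (hasStrictFDerivAt_norm_sq z).hasFDerivAt
  have h2 := ((h1.const_mul (-(1 / 2))).exp).const_mul
    (∫ y : Vec3 ℝ, Real.exp (-(1 / 2) * ‖y‖ ^ 2))⁻¹
  have h3 : fderiv ℝ gaussDensity z = _ := h2.fderiv
  rw [partialDeriv, h3]
  simp [gaussDensity, EuclideanSpace.inner_single_right]
  ring

/-- **Stein's identity** for the standard Gaussian measure. -/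
theorem integral_mul_coord_gaussMeasure {h : Vec3 ℝ → ℝ} (hh : ContDiff ℝ ∞ h)
    (hc : HasCompactSupport h) (i : Fin 3) :
    ∫ z, h z * z i ∂gaussMeasure = ∫ z, partialDeriv i h z ∂gaussMeasure := by
  rw [integral_gaussMeasure, integral_gaussMeasure]
  have h1 := integral_mul_partialDeriv hh gaussDensity_contDiff hc i
  simp_rw [partialDeriv_gaussDensity] at h1
  have h2 : ∫ z, gaussDensity z * (h z * z i) = -∫ z, h z * -(z i * gaussDensity z) := by
    rw [← integral_neg]
    congr 1; ext z; ring
  rw [h2, h1, neg_neg]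
  congr 1; ext z; ring

/-- The heat semigroup with diffusivity `β` after time `s`, applied to the time-`r` slice of `g`. -/
def heatFlow (β : ℝ) (g : ℝ → Vec3 ℝ → ℝ) (s r : ℝ) (x : Vec3 ℝ) : ℝ :=
  shiftAverage gaussMeasure (fun (q : ℝ × ℝ) _ => q.2) (fun q z => √(2 * β * q.1) • z) g (s, r) x

section heatFlow

variable {K : Set (Vec3 ℝ)} {g : ℝ → Vec3 ℝ → ℝ}

theorem heatFlow_bounded_time (q₀ : ℝ × ℝ) :
    ∃ T, ∀ᶠ q : ℝ × ℝ in 𝓝 q₀, ∀ᵐ _z ∂gaussMeasure, |q.2| ≤ T := by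
  refine ⟨|q₀.2| + 1, ?_⟩
  have h : Tendsto (fun q : ℝ × ℝ => |q.2|) (𝓝 q₀) (𝓝 |q₀.2|) :=
    (continuous_snd.abs).tendsto q₀
  filter_upwards [h.eventually_lt_const (lt_add_one |q₀.2|)] with q hq
  exact Eventually.of_forall fun _ => hq.le

theorem continuous_heatFlow_shift (β : ℝ) : Continuous (Function.uncurry
    fun (q : ℝ × ℝ) (z : Vec3 ℝ) => √(2 * β * q.1) • z) := by
  unfold Function.uncurry
  fun_prop

theorem continuous_heatFlow_time : Continuous (Function.uncurry
    fun (q : ℝ × ℝ) (_ : Vec3 ℝ) => q.2) := by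
  unfold Function.uncurry
  fun_prop

theorem CompactField.continuous_heatFlow (hg : CompactField K g) (β : ℝ) (x : Vec3 ℝ) :
    Continuous fun q : ℝ × ℝ => heatFlow β g q.1 q.2 x :=
  (hg.continuous_shiftAverage (μ := gaussMeasure) continuous_heatFlow_time
    (continuous_heatFlow_shift β) heatFlow_bounded_time).comp (Continuous.prodMk_left x)

theorem CompactField.integrable_heatFlow (hg : CompactField K g) (β s r : ℝ) (x : Vec3 ℝ) :
    Integrable (fun z => g r (x + √(2 * β * s) • z)) gaussMeasure :=
  hg.integrable_shift continuous_heatFlow_time (continuous_heatFlow_shift β) heatFlow_bounded_time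
    (s, r) x

theorem CompactField.hasCompactSupport_comp (hg : CompactField K g) (r : ℝ) (x : Vec3 ℝ) {σ : ℝ}
    (hσ : σ ≠ 0) : HasCompactSupport fun z => g r (x + σ • z) := by
  have h : HasCompactSupport (g r) := HasCompactSupport.intro hg.isCompact (hg.eq_zero r)
  exact h.comp_homeomorph ((Homeomorph.smulOfNeZero σ hσ).trans (Homeomorph.addLeft x))

/-- The Gaussian average of the radial derivative is `σ` times the average of the Laplacian. -/
theorem CompactField.integral_fderiv_gaussMeasure (hg : CompactField K g) (r : ℝ) (x : Vec3 ℝ)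
    {σ : ℝ} (hσ : σ ≠ 0) : ∫ z, fderiv ℝ (g r) (x + σ • z) z ∂gaussMeasure
      = σ * ∫ z, _root_.laplacianSum (g r) (x + σ • z) ∂gaussMeasure := by
  have hl : ContDiff ℝ ∞ fun z : Vec3 ℝ => x + σ • z := contDiff_const.add (contDiff_const_smul σ)
  have hsm : ∀ i, ContDiff ℝ ∞ fun z => _root_.partialDeriv i (g r) (x + σ • z) := fun i =>
    ((hg.partialDeriv i).smooth.contDiff r (mem_univ r)).comp hl
  have hcs := fun i => (hg.partialDeriv i).hasCompactSupport_comp r x hσ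
  have h1 : ∀ i z, _root_.partialDeriv i (fun z => _root_.partialDeriv i (g r) (x + σ • z)) z
      = σ * _root_.partialDeriv i (_root_.partialDeriv i (g r)) (x + σ • z) := by
    intro i z
    have hd := ((hg.partialDeriv i).differentiable r (x + σ • z)).hasFDerivAt
    have hlz : HasFDerivAt (fun z : Vec3 ℝ => x + σ • z)
        (σ • ContinuousLinearMap.id ℝ (Vec3 ℝ)) z := ((hasFDerivAt_id z).const_smul σ).const_add x
    have h : fderiv ℝ (fun z => _root_.partialDeriv i (g r) (x + σ • z)) z = _ :=
      (HasFDerivAt.comp (g := _root_.partialDeriv i (g r)) z hd hlz).fderiv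
    rw [_root_.partialDeriv, h]
    simp [_root_.partialDeriv]
  have h2 : ∀ z, fderiv ℝ (g r) (x + σ • z) z
      = ∑ i, _root_.partialDeriv i (g r) (x + σ • z) * z i := by
    intro z
    rw [fderiv_eq_sum_partialDeriv]
    simp
  simp_rw [h2]
  have hint : ∀ i, Integrable (fun z => _root_.partialDeriv i (g r) (x + σ • z) * z i)
      gaussMeasure := fun i => ((hsm i).continuous.mul
    (by fun_prop)).integrable_of_hasCompactSupport (hcs i).mul_right
  rw [integral_finsetSum _ fun i _ => hint i]
  simp_rw [fun i => integral_mul_coord_gaussMeasure (hsm i) (hcs i) i, h1,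
    MeasureTheory.integral_const_mul]
  rw [← Finset.mul_sum]
  congr 1
  simp only [_root_.laplacianSum]
  rw [integral_finsetSum _ fun i _ => ?_]
  exact ((((hg.partialDeriv i).partialDeriv i).smooth.contDiff r (mem_univ r)).comp
    hl).continuous.integrable_of_hasCompactSupport
      (((hg.partialDeriv i).partialDeriv i).hasCompactSupport_comp r x hσ)

theorem CompactField.hasDerivAt_heatFlow (hg : CompactField K g) {β : ℝ} (hβ : 0 < β) {s : ℝ}
    (hs : 0 < s) (r : ℝ) (x : Vec3 ℝ) : HasDerivAt (fun s => heatFlow β g s r x)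
      (β * heatFlow β (fun t => _root_.laplacianSum (g t)) s r x) s := by
  obtain ⟨C, hC0, hC⟩ := hg.exists_fderiv_bound |r|
  have hsq : ∀ s', 0 < s' → HasDerivAt (fun s' => √(2 * β * s')) (β / √(2 * β * s')) s' := by
    intro s' hs'
    have h1 : HasDerivAt (fun s' => 2 * β * s') (2 * β) s' := by
      simpa using (hasDerivAt_id s').const_mul (2 * β)
    convert h1.sqrt (by positivity) using 1
    field_simp
  have key := (hasDerivAt_integral_of_dominated_loc_of_deriv_le (μ := gaussMeasure)
    (F := fun s z => g r (x + √(2 * β * s) • z)) (x₀ := s) (s := Ioi (s / 2))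
    (F' := fun s z => (β / √(2 * β * s)) * fderiv ℝ (g r) (x + √(2 * β * s) • z) z)
    (bound := fun z => (β / √(2 * β * (s / 2))) * (C * ‖z‖)) (Ioi_mem_nhds (by linarith))
    ?_ ?_ ?_ ?_ ?_ ?_).2
  · have h0 : √(2 * β * s) ≠ 0 := (Real.sqrt_pos.2 (by positivity)).ne'
    rw [MeasureTheory.integral_const_mul, hg.integral_fderiv_gaussMeasure r x h0, ← mul_assoc,
      div_mul_cancel₀ _ h0] at key
    exact key
  · exact Eventually.of_forall fun s => (hg.integrable_heatFlow β s r x).aestronglyMeasurable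
  · exact hg.integrable_heatFlow β s r x
  · refine Continuous.aestronglyMeasurable (continuous_const.mul ?_)
    have h1 : Continuous fun z : Vec3 ℝ => fderiv ℝ (g r) (x + √(2 * β * s) • z) :=
      hg.continuous_fderiv.comp (by fun_prop : Continuous fun z : Vec3 ℝ =>
        (r, x + √(2 * β * s) • z))
    exact h1.clm_apply continuous_id
  · refine Eventually.of_forall fun z s' hs' => ?_
    have hs0 : 0 < s' := lt_trans (by linarith) (mem_Ioi.1 hs')
    have h1 : 0 < √(2 * β * (s / 2)) := Real.sqrt_pos.2 (by positivity)
    rw [norm_mul, Real.norm_of_nonneg (by positivity)]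
    gcongr
    · exact (mem_Ioi.1 hs').le
    · exact (ContinuousLinearMap.le_opNorm _ _).trans
        (mul_le_mul_of_nonneg_right (hC r le_rfl _) (norm_nonneg _))
  · exact (integrable_norm_gaussMeasure.const_mul C).const_mul _
  · refine Eventually.of_forall fun z s' hs' => ?_
    have hs0 : 0 < s' := lt_trans (by linarith) (mem_Ioi.1 hs')
    have h1 : HasDerivAt (fun s' => x + √(2 * β * s') • z) ((β / √(2 * β * s')) • z) s' :=
      ((hsq s' hs0).smul_const z).const_add x
    have h2 := (hg.differentiable r (x + √(2 * β * s') • z)).hasFDerivAt.comp_hasDerivAt s' h1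
    simpa using! h2

theorem heatFlow_zero (β : ℝ) (g : ℝ → Vec3 ℝ → ℝ) (r : ℝ) (x : Vec3 ℝ) :
    heatFlow β g 0 r x = g r x := by
  simp [heatFlow, shiftAverage]

theorem CompactField.heatFlow_eq (hg : CompactField K g) {β : ℝ} (hβ : 0 < β) {s : ℝ}
    (hs : 0 ≤ s) (r : ℝ) (x : Vec3 ℝ) : heatFlow β g s r x = g r x
      + ∫ σ in (0 : ℝ)..s, β * heatFlow β (fun t => _root_.laplacianSum (g t)) σ r x := by
  have hc : Continuous fun s => heatFlow β g s r x :=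
    (hg.continuous_heatFlow β x).comp (Continuous.prodMk_left r)
  have hc' : Continuous fun s => heatFlow β (fun t => _root_.laplacianSum (g t)) s r x :=
    (hg.laplacianSum.continuous_heatFlow β x).comp (Continuous.prodMk_left r)
  rw [intervalIntegral.integral_eq_sub_of_hasDerivAt_of_le hs (f := fun s => heatFlow β g s r x)
    hc.continuousOn (fun σ hσ => hg.hasDerivAt_heatFlow hβ hσ.1 r x)
    ((continuous_const.mul hc').intervalIntegrable _ _), heatFlow_zero]
  ring

end heatFlow

/-! ### Duhamel's formula -/

/-- Exchanging the order of integration over a triangle. -/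
theorem integral_triangle {q : ℝ → ℝ → ℝ} (hq : Continuous (Function.uncurry q)) {t : ℝ}
    (ht : 0 ≤ t) : ∫ r in (0 : ℝ)..t, ∫ s in (0 : ℝ)..r, q r s
      = ∫ s in (0 : ℝ)..t, ∫ r in s..t, q r s := by
  have hm : MeasurableSet {p : ℝ × ℝ | p.2 ≤ p.1} := measurableSet_le measurable_snd measurable_fst
  have hint : IntegrableOn (Function.uncurry fun r s => if s ≤ r then q r s else 0)
      (uIoc 0 t ×ˢ uIoc 0 t) := by
    have h1 : IntegrableOn (Function.uncurry q) (Icc 0 t ×ˢ Icc 0 t) :=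
      hq.continuousOn.integrableOn_compact (isCompact_Icc.prod isCompact_Icc)
    have h2 := (h1.mono_set (prod_mono (Ioc_subset_Icc_self) (Ioc_subset_Icc_self))).indicator hm
    rw [uIoc_of_le ht]
    refine h2.congr (Eventually.of_forall fun p => ?_)
    simp [indicator, Function.uncurry]
  have h := intervalIntegral_intervalIntegral_swap hint
  have e1 : ∀ r ∈ uIcc 0 t, ∫ s in (0 : ℝ)..t, (if s ≤ r then q r s else 0)
      = ∫ s in (0 : ℝ)..r, q r s := by
    intro r hr
    rw [uIcc_of_le ht] at hr
    rw [intervalIntegral.integral_of_le ht, intervalIntegral.integral_of_le hr.1]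
    have : (fun s => if s ≤ r then q r s else 0) = (Iic r).indicator (q r) := by
      ext s; simp [indicator]
    rw [this, setIntegral_indicator measurableSet_Iic]
    congr 2
    ext s
    simp only [mem_inter_iff, mem_Ioc, mem_Iic]
    exact ⟨fun h => ⟨h.1.1, h.2⟩, fun h => ⟨⟨h.1, h.2.trans hr.2⟩, h.2⟩⟩
  have e2 : ∀ s ∈ uIoc 0 t, ∫ r in (0 : ℝ)..t, (if s ≤ r then q r s else 0)
      = ∫ r in s..t, q r s := by
    intro s hs
    rw [uIoc_of_le ht] at hs
    rw [intervalIntegral.integral_of_le ht, intervalIntegral.integral_of_le hs.2]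
    have : (fun r => if s ≤ r then q r s else 0) = (Ici s).indicator (fun r => q r s) := by
      ext r; simp [indicator]
    rw [this, setIntegral_indicator measurableSet_Ici, ← integral_Icc_eq_integral_Ioc (x := s)]
    congr 2
    ext r
    simp only [mem_inter_iff, mem_Ioc, mem_Ici, mem_Icc]
    exact ⟨fun h => ⟨h.2, h.1.2⟩, fun h => ⟨⟨hs.1.trans_le h.1, h.2⟩, h.1⟩⟩
  rw [← intervalIntegral.integral_congr e1, h]
  exact intervalIntegral.integral_congr_ae (Eventually.of_forall e2)

/-- The law of the rescaled intermediate time and of the Gaussian displacement in Duhamel's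
formula. -/
def duhamelMeasure : Measure (ℝ × Vec3 ℝ) := (volume.restrict (Icc 0 1)).prod gaussMeasure

instance : IsFiniteMeasure duhamelMeasure := by unfold duhamelMeasure; infer_instance

/-- Duhamel's integral divided by `t`, with the intermediate time rescaled to `[0,1]`. -/
def duhamelAverage (β : ℝ) (g : ℝ → Vec3 ℝ → ℝ) (t : ℝ) (x : Vec3 ℝ) : ℝ :=
  shiftAverage duhamelMeasure (fun t p => t * p.1) (fun t p => √(2 * β * (t - t * p.1)) • p.2) g t x

section duhamel

variable {K : Set (Vec3 ℝ)} {g : ℝ → Vec3 ℝ → ℝ}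

theorem duhamel_ae_mem : ∀ᵐ p ∂duhamelMeasure, p.1 ∈ Icc (0 : ℝ) 1 := by
  have : ∀ᵐ θ ∂(volume.restrict (Icc (0 : ℝ) 1)), θ ∈ Icc (0 : ℝ) 1 :=
    ae_restrict_mem measurableSet_Icc
  exact (Measure.quasiMeasurePreserving_fst (μ := volume.restrict (Icc (0 : ℝ) 1))
    (ν := gaussMeasure)).ae this

theorem duhamel_bounded_time (t₀ : ℝ) :
    ∃ T, ∀ᶠ t : ℝ in 𝓝 t₀, ∀ᵐ p ∂duhamelMeasure, |t * p.1| ≤ T := by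
  refine ⟨|t₀| + 1, ?_⟩
  filter_upwards [continuous_abs.continuousAt.eventually_lt_const (lt_add_one |t₀|)] with t ht
  filter_upwards [duhamel_ae_mem] with p hp
  rw [abs_mul]
  refine le_trans ?_ ht.le
  exact mul_le_of_le_one_right (abs_nonneg t) (abs_le.2 ⟨by linarith [hp.1], hp.2⟩)

theorem continuous_duhamel_time :
    Continuous (Function.uncurry fun (t : ℝ) (p : ℝ × Vec3 ℝ) => t * p.1) := by
  unfold Function.uncurry
  fun_prop

theorem continuous_duhamel_shift (β : ℝ) : Continuous (Function.uncurry
    fun (t : ℝ) (p : ℝ × Vec3 ℝ) => √(2 * β * (t - t * p.1)) • p.2) := by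
  unfold Function.uncurry
  fun_prop

theorem CompactField.smoothField_duhamelAverage (hg : CompactField K g) (β : ℝ) :
    SmoothField 0 univ (duhamelAverage β g) where
  contDiff t _ := hg.contDiff_shiftAverage continuous_duhamel_time (continuous_duhamel_shift β)
    duhamel_bounded_time t
  contDiffOn γ := by
    have h : ∀ t, _root_.iterPartial γ (duhamelAverage β g t)
        = duhamelAverage β (fun t => _root_.iterPartial γ (g t)) t := fun t =>
      hg.iterPartial_shiftAverage γ continuous_duhamel_time (continuous_duhamel_shift β)
        duhamel_bounded_time t
    simp_rw [h]
    exact contDiffOn_zero.2 ((hg.iterPartial γ).continuous_shiftAverage continuous_duhamel_time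
      (continuous_duhamel_shift β) duhamel_bounded_time).continuousOn

theorem CompactField.laplacianSum_duhamelAverage (hg : CompactField K g) (β t : ℝ) :
    _root_.laplacianSum (duhamelAverage β g t)
      = duhamelAverage β (fun t => _root_.laplacianSum (g t)) t := by
  ext x
  simp only [_root_.laplacianSum]
  have h : ∀ l, _root_.partialDeriv l (_root_.partialDeriv l (duhamelAverage β g t))
      = duhamelAverage β (fun t => _root_.partialDeriv l (_root_.partialDeriv l (g t))) t :=
    fun l => hg.iterPartial_shiftAverage [l, l] continuous_duhamel_time
      (continuous_duhamel_shift β) duhamel_bounded_time t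
  simp_rw [h]
  refine (integral_finsetSum _ fun l _ => ?_).symm
  exact ((hg.partialDeriv l).partialDeriv l).integrable_shift continuous_duhamel_time
    (continuous_duhamel_shift β) duhamel_bounded_time t x

theorem CompactField.mul_duhamelAverage (hg : CompactField K g) (β t : ℝ) (x : Vec3 ℝ) :
    t * duhamelAverage β g t x = ∫ s in (0 : ℝ)..t, heatFlow β g (t - s) s x := by
  have h1 : duhamelAverage β g t x
      = ∫ θ in (0 : ℝ)..1, heatFlow β g (t - t * θ) (t * θ) x := by
    rw [intervalIntegral.integral_of_le zero_le_one, ← integral_Icc_eq_integral_Ioc]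
    exact integral_prod _ (hg.integrable_shift continuous_duhamel_time
      (continuous_duhamel_shift β) duhamel_bounded_time t x)
  rw [h1, ← smul_eq_mul, intervalIntegral.smul_integral_comp_mul_left
    (f := fun s => heatFlow β g (t - s) s x)]
  simp

/-- Duhamel's integral solves the inhomogeneous heat equation with zero initial value. -/
theorem CompactField.duhamel_eq_integral (hg : CompactField K g) {β : ℝ} (hβ : 0 < β) {t : ℝ}
    (ht : 0 ≤ t) (x : Vec3 ℝ) : t * duhamelAverage β g t x = ∫ s in (0 : ℝ)..t,
      (β * (s * _root_.laplacianSum (duhamelAverage β g s) x) + g s x) := by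
  have hq : Continuous (Function.uncurry fun r s =>
      β * heatFlow β (fun t => _root_.laplacianSum (g t)) (r - s) s x) :=
    continuous_const.mul ((hg.laplacianSum.continuous_heatFlow β x).comp
      (by fun_prop : Continuous fun p : ℝ × ℝ => (p.1 - p.2, p.2)))
  have hgc : Continuous fun s => g s x := hg.continuous.comp (Continuous.prodMk_left x)
  have h1 : ∀ s, β * (s * _root_.laplacianSum (duhamelAverage β g s) x)
      = ∫ r in (0 : ℝ)..s, β * heatFlow β (fun t => _root_.laplacianSum (g t)) (s - r) r x := by
    intro s
    rw [hg.laplacianSum_duhamelAverage, hg.laplacianSum.mul_duhamelAverage,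
      intervalIntegral.integral_const_mul]
  have hcont : Continuous fun s : ℝ => ∫ r in (0 : ℝ)..s,
      β * heatFlow β (fun t => _root_.laplacianSum (g t)) (s - r) r x :=
    intervalIntegral.continuous_parametric_intervalIntegral_of_continuous hq continuous_id
  simp_rw [h1]
  rw [intervalIntegral.integral_add (hcont.intervalIntegrable _ _) (hgc.intervalIntegrable _ _),
    integral_triangle hq ht, hg.mul_duhamelAverage, ← intervalIntegral.integral_add ?_
      (hgc.intervalIntegrable _ _)]
  · refine intervalIntegral.integral_congr fun s hs => ?_
    rw [uIcc_of_le ht] at hs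
    have h2 := hg.heatFlow_eq hβ (sub_nonneg.2 hs.2) s x
    have h3 := intervalIntegral.integral_comp_sub_right (a := s) (b := t)
      (fun σ => β * heatFlow β (fun t => _root_.laplacianSum (g t)) σ s x) s
    simp only [sub_self] at h3
    rw [h2, h3]
    ring
  · have h4 : Continuous fun s : ℝ => ∫ r in t..s,
        β * heatFlow β (fun t => _root_.laplacianSum (g t)) (r - s) s x :=
      intervalIntegral.continuous_parametric_intervalIntegral_of_continuous
        (f := fun s r => β * heatFlow β (fun t => _root_.laplacianSum (g t)) (r - s) s x)
        (hq.comp continuous_swap) continuous_id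
    simp_rw [intervalIntegral.integral_symm t]
    exact h4.neg.intervalIntegrable _ _

end duhamel

/-! ### The inhomogeneous heat equation with compactly supported data -/

/-- Averages of translates are bounded in `L¹`, uniformly in the law of the shifts. -/
theorem CompactField.cutoffIntegral_abs_shiftAverage_le {Q Y : Type} [TopologicalSpace Q]
    [TopologicalSpace Y] [SecondCountableTopology Y] [MeasurableSpace Y] [BorelSpace Y]
    {μ : Measure Y} [IsFiniteMeasure μ] {τ : Q → Y → ℝ} {ζ : Q → Y → Vec3 ℝ}
    {K : Set (Vec3 ℝ)} {g : ℝ → Vec3 ℝ → ℝ} (hg : CompactField K g)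
    (hτ : Continuous (Function.uncurry τ)) (hζ : Continuous (Function.uncurry ζ))
    {q : Q} {C : ℝ} (hC : ∀ᵐ y ∂μ, ∀ x, |g (τ q y) x| ≤ C) {φ : Vec3 ℝ → ℝ}
    (hφ : Continuous φ) (hc : HasCompactSupport φ) (hφ1 : ∀ x, φ x ^ 2 ≤ 1) :
    cutoffIntegral φ (fun x => |shiftAverage μ τ ζ g q x|)
      ≤ μ.real univ * (C * (volume K).toReal) := by
  have hcont : Continuous fun p : Vec3 ℝ × Y => g (τ q p.2) (p.1 + ζ q p.2) :=
    hg.continuous.comp ((hτ.comp (by fun_prop : Continuous fun p : Vec3 ℝ × Y => (q, p.2))).prodMk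
      (continuous_fst.add (hζ.comp (by fun_prop : Continuous fun p : Vec3 ℝ × Y => (q, p.2)))))
  have hφi : Integrable fun x => φ x ^ 2 := by
    simpa using integrable_cutoff (g := fun _ => 1) hφ hc continuous_const
  have hint : Integrable (Function.uncurry fun x y => φ x ^ 2 * |g (τ q y) (x + ζ q y)|)
      (volume.prod μ) := by
    refine Integrable.mono' (hφi.mul_prod (integrable_const (μ := μ) C)) ?_ ?_
    · exact ((hφ.comp continuous_fst).pow 2 |>.mul hcont.abs).aestronglyMeasurable
    · have h1 : ∀ᵐ p ∂((volume : Measure (Vec3 ℝ)).prod μ), ∀ x, |g (τ q p.2) x| ≤ C :=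
        (Measure.quasiMeasurePreserving_snd (μ := (volume : Measure (Vec3 ℝ))) (ν := μ)).ae hC
      filter_upwards [h1] with p hp
      simp only [Function.uncurry]
      rw [Real.norm_of_nonneg (by positivity)]
      exact mul_le_mul_of_nonneg_left (hp _) (sq_nonneg _)
  have h2 : cutoffIntegral φ (fun x => |shiftAverage μ τ ζ g q x|)
      ≤ ∫ x, ∫ y, φ x ^ 2 * |g (τ q y) (x + ζ q y)| ∂μ := by
    refine integral_mono_of_nonneg (Eventually.of_forall fun x => by positivity)
      hint.integral_prod_left (Eventually.of_forall fun x => ?_)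
    simp only
    rw [MeasureTheory.integral_const_mul]
    exact mul_le_mul_of_nonneg_left abs_integral_le_integral_abs (sq_nonneg _)
  refine h2.trans ?_
  rw [integral_integral_swap hint, ← smul_eq_mul, ← integral_const]
  refine integral_mono_ae hint.integral_prod_right (integrable_const _) ?_
  filter_upwards [hC] with y hy
  have hgc : Continuous (g (τ q y)) := hg.continuous.comp (Continuous.prodMk_right _)
  have hgs : HasCompactSupport (g (τ q y)) := HasCompactSupport.intro hg.isCompact (hg.eq_zero _)
  have hgi : Integrable fun x => |g (τ q y) x| := (hgc.integrable_of_hasCompactSupport hgs).abs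
  calc ∫ x, φ x ^ 2 * |g (τ q y) (x + ζ q y)| ≤ ∫ x, |g (τ q y) (x + ζ q y)| := by
        refine integral_mono_of_nonneg (Eventually.of_forall fun x => by positivity)
          (hgi.comp_add_right _) (Eventually.of_forall fun x => ?_)
        exact mul_le_of_le_one_left (abs_nonneg _) (hφ1 x)
    _ = ∫ x, |g (τ q y) x| := integral_add_right_eq_self (fun x => |g (τ q y) x|) _
    _ = ∫ x in K, |g (τ q y) x| :=
        (setIntegral_eq_integral_of_forall_compl_eq_zero fun x hx => by
          simp [hg.eq_zero _ x hx]).symm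
    _ ≤ ∫ x in K, C := by
        have hKfin := hg.isCompact.measure_lt_top (μ := (volume : Measure (Vec3 ℝ)))
        exact integral_mono hgi.integrableOn
          (integrableOn_const (C := C) hKfin.ne (by simp)) hy
    _ = C * (volume K).toReal := by simp [Measure.real, mul_comm]

theorem CompactField.exists_cutoffIntegral_duhamel_le {K : Set (Vec3 ℝ)} {g : ℝ → Vec3 ℝ → ℝ}
    (hg : CompactField K g) (β T : ℝ) : ∃ M, 0 ≤ M ∧ ∀ t ∈ Icc 0 T, ∀ φ : Vec3 ℝ → ℝ,
      Continuous φ → HasCompactSupport φ → (∀ x, φ x ^ 2 ≤ 1) →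
      cutoffIntegral φ (fun x => (t * duhamelAverage β g t x) ^ 2) ≤ M := by
  obtain ⟨C, hC0, hC⟩ := hg.exists_bound T
  set m := duhamelMeasure.real univ with hm
  have hm0 : 0 ≤ m := measureReal_nonneg
  refine ⟨T ^ 2 * ((m * C) * (m * (C * (volume K).toReal))), by positivity,
    fun t ht φ hφ hc hφ1 => ?_⟩
  have hae : ∀ᵐ p ∂duhamelMeasure, ∀ x, |g (t * p.1) x| ≤ C := by
    filter_upwards [duhamel_ae_mem] with p hp
    refine hC _ ?_
    rw [abs_of_nonneg (mul_nonneg ht.1 hp.1)]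
    exact (mul_le_of_le_one_right ht.1 hp.2).trans ht.2
  have h1 := hg.cutoffIntegral_abs_shiftAverage_le continuous_duhamel_time
    (continuous_duhamel_shift β) hae hφ hc hφ1
  have hsup : ∀ x, |duhamelAverage β g t x| ≤ m * C := by
    intro x
    refine abs_integral_le_integral_abs.trans ?_
    have e : ∫ _p, C ∂duhamelMeasure = m * C := by simp [hm]
    rw [← e]
    refine integral_mono_ae (hg.integrable_shift continuous_duhamel_time
      (continuous_duhamel_shift β) duhamel_bounded_time t x).abs (integrable_const _) ?_
    filter_upwards [hae] with p hp using hp _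
  have hcont : Continuous (duhamelAverage β g t) :=
    ((hg.smoothField_duhamelAverage β).contDiff t (mem_univ t)).continuous
  have h2 : cutoffIntegral φ (fun x => (t * duhamelAverage β g t x) ^ 2)
      ≤ (T ^ 2 * (m * C)) * cutoffIntegral φ (fun x => |duhamelAverage β g t x|) := by
    rw [← cutoffIntegral_const_mul]
    refine cutoffIntegral_mono hφ hc ((continuous_const.mul hcont).pow 2)
      (continuous_const.mul hcont.abs) fun x _ => ?_
    rw [mul_pow, mul_assoc]
    have e1 : t ^ 2 ≤ T ^ 2 := pow_le_pow_left₀ ht.1 ht.2 2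
    have e2 : duhamelAverage β g t x ^ 2 ≤ m * C * |duhamelAverage β g t x| := by
      rw [← sq_abs, sq]
      exact mul_le_mul_of_nonneg_right (hsup x) (abs_nonneg _)
    exact mul_le_mul e1 e2 (sq_nonneg _) (sq_nonneg _)
  refine h2.trans ?_
  rw [mul_assoc, mul_assoc]
  have h3 : T ^ 2 * (m * C * cutoffIntegral φ (fun x => |duhamelAverage β g t x|))
      ≤ T ^ 2 * (m * C * (m * (C * (volume K).toReal))) := by
    refine mul_le_mul_of_nonneg_left (mul_le_mul_of_nonneg_left h1 ?_) (sq_nonneg _)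
    positivity
  simpa [mul_assoc] using h3

/-- The inhomogeneous heat equation with compactly supported data and source has a solution that is
smooth in space, up to the initial time, and bounded in `L²` on bounded time intervals. -/
theorem exists_heat_solution {β : ℝ} (hβ : 0 < β) {f : Vec3 ℝ → ℝ} (hf : ContDiff ℝ ∞ f)
    (hfc : HasCompactSupport f) {g : ℝ → Vec3 ℝ → ℝ} (hg : SmoothField 0 (Ici 0) g)
    {K : Set (Vec3 ℝ)} (hK : IsCompact K) (hgK : ∀ t, 0 ≤ t → ∀ x, x ∉ K → g t x = 0) :
    ∃ u : ℝ → Vec3 ℝ → ℝ, SmoothField 0 (Ici 0) u ∧ u 0 = f ∧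
      (∀ T, ∀ t ∈ Icc 0 T, ∀ x, HasDerivWithinAt (fun s => u s x)
        (β * laplacianSum (u t) x + g t x) (Icc 0 T) t) ∧
      ∀ T, ∃ M, 0 ≤ M ∧ ∀ t ∈ Icc 0 T, ∀ φ : Vec3 ℝ → ℝ, Continuous φ → HasCompactSupport φ →
        (∀ x, φ x ^ 2 ≤ 1) → cutoffIntegral φ (fun x => u t x ^ 2) ≤ M := by
  have hclamp : SmoothField 0 univ (fun t => g (max t 0)) := by
    refine ⟨fun t _ => hg.contDiff _ (mem_Ici.2 (le_max_right _ _)), fun γ => ?_⟩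
    refine contDiffOn_zero.2 ?_
    exact (hg.contDiffOn γ).continuousOn.comp
      (by fun_prop : ContinuousOn (fun p : ℝ × Vec3 ℝ => (max p.1 0, p.2)) (univ ×ˢ univ))
      fun p _ => ⟨mem_Ici.2 (le_max_right _ _), mem_univ _⟩
  have hΔf : ContDiff ℝ ∞ (laplacianSum f) := laplacianSum_contDiff hf
  have hfK : ∀ x, x ∉ tsupport f → laplacianSum f x = 0 := fun x hx =>
    Finset.sum_eq_zero fun l _ => partialDeriv_eq_zero_of_notMem_tsupport l fun h =>
      hx (closure_minimal (fun y hy => by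
        by_contra hy'
        exact hy (partialDeriv_eq_zero_of_notMem_tsupport l hy')) (isClosed_tsupport f) h)
  -- subtracting the initial value turns it into a contribution to the source
  set G : ℝ → Vec3 ℝ → ℝ := fun t x => g (max t 0) x + β * laplacianSum f x with hGdef
  have hG : CompactField (K ∪ tsupport f) G := by
    refine ⟨hclamp.add (SmoothField.of_contDiff (contDiff_const.mul hΔf) (by simp)),
      hK.union hfc, fun t x hx => ?_⟩
    rw [mem_union, not_or] at hx
    simp [hGdef, hgK _ (le_max_right t 0) x hx.1, hfK x hx.2]
  have hD := hG.smoothField_duhamelAverage β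
  have htD : SmoothField 0 univ (fun t x => t * duhamelAverage β G t x) := by
    refine ⟨fun t _ => contDiff_const.mul (hD.contDiff t (mem_univ t)), fun γ => ?_⟩
    have h : ∀ t, iterPartial γ (fun x => t * duhamelAverage β G t x)
        = fun x => t * iterPartial γ (duhamelAverage β G t) x := by
      intro t
      have : ∀ γ : List (Fin 3), ∀ h : Vec3 ℝ → ℝ, ContDiff ℝ ∞ h →
          iterPartial γ (fun x => t * h x) = fun x => t * iterPartial γ h x := by
        intro γ
        induction γ with
        | nil => exact fun _ _ => rfl
        | cons i γ ih =>
          intro h hh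
          simp only [iterPartial]
          rw [partialDeriv_const_mul hh.differentiable_field, ih _ (hh.partialDeriv i)]
      exact this γ _ (hD.contDiff t (mem_univ t))
    simp_rw [h]
    exact (contDiff_fst.contDiffOn).mul (hD.contDiffOn γ)
  have hu : SmoothField 0 univ (fun t x => f x + t * duhamelAverage β G t x) :=
    (SmoothField.of_contDiff hf (by simp)).add htD
  refine ⟨fun t x => f x + t * duhamelAverage β G t x, hu.mono (subset_univ _), ?_, ?_, ?_⟩
  · ext x; simp
  · intro T t ht x
    have hlap : ∀ s, laplacianSum (fun x => f x + s * duhamelAverage β G s x) x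
        = laplacianSum f x + s * laplacianSum (duhamelAverage β G s) x := by
      intro s
      have hDs := hD.contDiff s (mem_univ s)
      simp only [laplacianSum]
      rw [Finset.mul_sum, ← Finset.sum_add_distrib]
      refine Finset.sum_congr rfl fun l _ => ?_
      rw [partialDeriv_add hf.differentiable_field (contDiff_const.mul hDs).differentiable_field,
        partialDeriv_const_mul hDs.differentiable_field,
        partialDeriv_add (hf.partialDeriv l).differentiable_field
          (contDiff_const.mul (hDs.partialDeriv l)).differentiable_field,
        partialDeriv_const_mul (hDs.partialDeriv l).differentiable_field]
    have hR : SmoothField 0 univ (fun s x => β * (s * laplacianSum (duhamelAverage β G s) x)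
        + G s x) := by
      have h1 := (htD.laplacianSum (by simp)).const_mul (by simp) β
      refine (h1.add hG.smooth).congr fun s _ => ?_
      ext x
      have hDs := hD.contDiff s (mem_univ s)
      simp only [laplacianSum]
      congr 2
      rw [Finset.mul_sum]
      refine Finset.sum_congr rfl fun l _ => ?_
      rw [partialDeriv_const_mul hDs.differentiable_field,
        partialDeriv_const_mul (hDs.partialDeriv l).differentiable_field]
    have h2 := hasDerivWithinAt_of_eq_add_integral (T := T) (c := f x)
      (f := fun t => f x + t * duhamelAverage β G t x)
      (f' := fun s => β * (s * laplacianSum (duhamelAverage β G s) x) + G s x)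
      ((hR.mono (subset_univ _)).continuousOn_time x)
      (fun t ht => by rw [hG.duhamel_eq_integral hβ ht.1 x]) ht
    convert h2 using 1
    rw [hlap, hGdef]
    simp only [max_eq_left ht.1]
    ring
  · intro T
    obtain ⟨M, hM0, hM⟩ := hG.exists_cutoffIntegral_duhamel_le β T
    have hf2 : Integrable fun x => f x ^ 2 :=
      (hf.continuous.pow 2).integrable_of_hasCompactSupport
        (hfc.mono fun x hx hx' => hx (by simp [hx']))
    have hf0 : 0 ≤ ∫ x, f x ^ 2 := integral_nonneg fun x => sq_nonneg _
    refine ⟨2 * (∫ x, f x ^ 2) + 2 * M, by positivity, fun t ht φ hφ hc hφ1 => ?_⟩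
    have hDt : Continuous fun x => t * duhamelAverage β G t x :=
      (htD.contDiff t (mem_univ t)).continuous
    have h1 : cutoffIntegral φ (fun x => (f x + t * duhamelAverage β G t x) ^ 2)
        ≤ cutoffIntegral φ (fun x => 2 * f x ^ 2 + 2 * (t * duhamelAverage β G t x) ^ 2) := by
      refine cutoffIntegral_mono hφ hc ((hf.continuous.add hDt).pow 2)
        ((continuous_const.mul (hf.continuous.pow 2)).add
          (continuous_const.mul (hDt.pow 2))) fun x _ => ?_
      nlinarith [sq_nonneg (f x - t * duhamelAverage β G t x)]
    rw [cutoffIntegral_add (g := fun x => 2 * f x ^ 2)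
      (h := fun x => 2 * (t * duhamelAverage β G t x) ^ 2)
      hφ hc (continuous_const.mul (hf.continuous.pow 2))
      (continuous_const.mul (hDt.pow 2)), cutoffIntegral_const_mul, cutoffIntegral_const_mul] at h1
    have h2 : cutoffIntegral φ (fun x => f x ^ 2) ≤ ∫ x, f x ^ 2 :=
      integral_mono (integrable_cutoff hφ hc (hf.continuous.pow 2)) hf2 fun x =>
        mul_le_of_le_one_left (sq_nonneg _) (hφ1 x)
    have h3 := hM t ht φ hφ hc hφ1
    linarith

/-! ### Systems in divergence form -/

/-- The field `u` solves `∂ₜuᵢ = βΔuᵢ + ∑ⱼ ∂ⱼGᵢⱼ` on `[0,T]`; all fields are smooth in space. -/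
structure SolvesWithFlux (β T : ℝ) (u : Fin 3 → ℝ → Vec3 ℝ → ℝ)
    (G : Fin 3 → Fin 3 → ℝ → Vec3 ℝ → ℝ) : Prop where
  smooth : ∀ i, SmoothField 0 (Icc 0 T) (u i)
  smooth_flux : ∀ i j, SmoothField 0 (Icc 0 T) (G i j)
  hasDeriv : ∀ i, ∀ t ∈ Icc 0 T, ∀ x, HasDerivWithinAt (fun s => u i s x)
    (β * laplacianSum (u i t) x + ∑ j, partialDeriv j (G i j t) x) (Icc 0 T) t

/-- The localized energy of the jet of order `k` of a vector field. -/
def jetEnergy (k : ℕ) (φ : Vec3 ℝ → ℝ) (w : Fin 3 → Vec3 ℝ → ℝ) : ℝ :=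
  ∑ i, cutoffIntegral φ (sqJet k (w i))

/-- The localized dissipation of the jet of order `k` of a vector field. -/
def jetDissipation (k : ℕ) (φ : Vec3 ℝ → ℝ) (w : Fin 3 → Vec3 ℝ → ℝ) : ℝ :=
  ∑ i, ∑ l, cutoffIntegral φ (sqJet k (partialDeriv l (w i)))

/-- The localized energy of the jets of order `k` of the nine flux components. -/
def fluxEnergy (k : ℕ) (φ : Vec3 ℝ → ℝ) (G : Fin 3 → Fin 3 → Vec3 ℝ → ℝ) : ℝ :=
  ∑ i, ∑ j, cutoffIntegral φ (sqJet k (G i j))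

/-- The constant of the energy inequality. -/
def energyConst (β : ℝ) : ℝ := 8 * β + 2 + 2 / β

theorem energyConst_pos {β : ℝ} (hβ : 0 < β) : 0 < energyConst β := by
  unfold energyConst; positivity

theorem jetEnergy_nonneg (k : ℕ) (φ : Vec3 ℝ → ℝ) (w : Fin 3 → Vec3 ℝ → ℝ) :
    0 ≤ jetEnergy k φ w :=
  Finset.sum_nonneg fun _ _ => cutoffIntegral_nonneg fun _ => sqJet_nonneg _ _ _

theorem jetDissipation_nonneg (k : ℕ) (φ : Vec3 ℝ → ℝ) (w : Fin 3 → Vec3 ℝ → ℝ) :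
    0 ≤ jetDissipation k φ w :=
  Finset.sum_nonneg fun _ _ => Finset.sum_nonneg fun _ _ =>
    cutoffIntegral_nonneg fun _ => sqJet_nonneg _ _ _

theorem jetEnergy_mono_cutoff {k : ℕ} {φ ψ : Vec3 ℝ → ℝ} {w : Fin 3 → Vec3 ℝ → ℝ} {c : ℝ}
    (hφ : Continuous φ) (hc : HasCompactSupport φ) (hψ : Continuous ψ) (hcψ : HasCompactSupport ψ)
    (hw : ∀ i, ContDiff ℝ ∞ (w i)) (hle : ∀ x, φ x ^ 2 ≤ c * ψ x ^ 2) :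
    jetEnergy k φ w ≤ c * jetEnergy k ψ w := by
  rw [jetEnergy, jetEnergy, Finset.mul_sum]
  exact Finset.sum_le_sum fun i _ => cutoffIntegral_mono_cutoff hφ hc hψ hcψ
    (continuous_sqJet k (hw i)) (fun x => sqJet_nonneg _ _ _) hle

/-- Increasing the order of the jet by one adds the dissipation of the lower order. -/
theorem jetEnergy_succ {k : ℕ} {φ : Vec3 ℝ → ℝ} {w : Fin 3 → Vec3 ℝ → ℝ} (hφ : Continuous φ)
    (hc : HasCompactSupport φ) (hw : ∀ i, ContDiff ℝ ∞ (w i)) :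
    jetEnergy (k + 1) φ w = jetEnergy 0 φ w + jetDissipation k φ w := by
  simp only [jetEnergy, jetDissipation]
  rw [← Finset.sum_add_distrib]
  exact Finset.sum_congr rfl fun i _ => cutoffIntegral_sqJet_succ hφ hc k (hw i)

section continuity

variable {T : ℝ} {u : Fin 3 → ℝ → Vec3 ℝ → ℝ} {φ : Vec3 ℝ → ℝ}

theorem continuousOn_jetEnergy (hu : ∀ i, SmoothField 0 (Icc 0 T) (u i)) (k : ℕ)
    (hφ : Continuous φ) (hc : HasCompactSupport φ) :
    ContinuousOn (fun t => jetEnergy k φ fun i => u i t) (Icc 0 T) :=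
  continuousOn_finsetSum _ fun i _ =>
    ((hu i).sqJet (by simp) k).continuousOn_cutoffIntegral hφ hc

theorem continuousOn_jetDissipation (hu : ∀ i, SmoothField 0 (Icc 0 T) (u i)) (k : ℕ)
    (hφ : Continuous φ) (hc : HasCompactSupport φ) :
    ContinuousOn (fun t => jetDissipation k φ fun i => u i t) (Icc 0 T) :=
  continuousOn_finsetSum _ fun i _ => continuousOn_finsetSum _ fun l _ =>
    (((hu i).partialDeriv l).sqJet (by simp) k).continuousOn_cutoffIntegral hφ hc

theorem continuousOn_fluxEnergy {G : Fin 3 → Fin 3 → ℝ → Vec3 ℝ → ℝ}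
    (hG : ∀ i j, SmoothField 0 (Icc 0 T) (G i j)) (k : ℕ)
    (hφ : Continuous φ) (hc : HasCompactSupport φ) :
    ContinuousOn (fun t => fluxEnergy k φ fun i j => G i j t) (Icc 0 T) :=
  continuousOn_finsetSum _ fun i _ => continuousOn_finsetSum _ fun j _ =>
    ((hG i j).sqJet (by simp) k).continuousOn_cutoffIntegral hφ hc

end continuity

theorem ContinuousOn.intervalIntegrable_zero {T : ℝ} {e : ℝ → ℝ} (he : ContinuousOn e (Icc 0 T))
    {t : ℝ} (ht : t ∈ Icc 0 T) : IntervalIntegrable e volume 0 t :=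
  (he.mono (Icc_subset_Icc_right ht.2)).intervalIntegrable_of_Icc ht.1

/-- The energy inequality for systems, summed over components. -/
theorem SolvesWithFlux.energy {β T : ℝ} (hβ : 0 < β) {u : Fin 3 → ℝ → Vec3 ℝ → ℝ}
    {G : Fin 3 → Fin 3 → ℝ → Vec3 ℝ → ℝ} (h : SolvesWithFlux β T u G) (k : ℕ) {φ : Vec3 ℝ → ℝ}
    (hφ : ContDiff ℝ ∞ φ) (hc : HasCompactSupport φ) {t : ℝ} (ht : t ∈ Icc 0 T) :
    jetEnergy k φ (fun i => u i t) + β * ∫ s in (0 : ℝ)..t, jetDissipation k φ (fun i => u i s)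
      ≤ jetEnergy k φ (fun i => u i 0) + energyConst β * ∫ s in (0 : ℝ)..t,
        (∑ l, jetEnergy k (partialDeriv l φ) (fun i => u i s)
          + fluxEnergy k φ (fun i j => G i j s)) := by
  have hsum := Finset.sum_le_sum fun i (_ : i ∈ (Finset.univ : Finset (Fin 3))) =>
    energy_inequality_sqJet hβ k (h.smooth i) (h.smooth_flux i) (h.hasDeriv i) hφ hc ht
  rw [Finset.sum_add_distrib, Finset.sum_add_distrib, ← Finset.mul_sum, ← Finset.mul_sum,
    ← intervalIntegral.integral_finsetSum, ← intervalIntegral.integral_finsetSum] at hsum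
  rotate_left
  · intro i _
    refine (intervalIntegrable_finsetSum fun l _ => ?_).add
      (intervalIntegrable_finsetSum fun j _ => ?_)
    · exact ((h.smooth i).sqJet (by simp) k).intervalIntegrable_cutoffIntegral
        (hφ.partialDeriv l).continuous (hc.partialDeriv l) ht
    · exact ((h.smooth_flux i j).sqJet (by simp) k).intervalIntegrable_cutoffIntegral
        hφ.continuous hc ht
  · intro i _
    exact intervalIntegrable_finsetSum fun l _ => (((h.smooth i).partialDeriv l).sqJet
      (by simp) k).intervalIntegrable_cutoffIntegral hφ.continuous hc ht
  refine hsum.trans (le_of_eq ?_)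
  rw [energyConst, jetEnergy]
  congr 2
  refine intervalIntegral.integral_congr fun s _ => ?_
  simp only [jetEnergy, fluxEnergy]
  rw [Finset.sum_add_distrib, Finset.sum_comm]

/-- `L²` boundedness of the slices of a field on `[0,T]`, expressed through cutoffs. -/
def L2BoundedOn (T M : ℝ) (u : Fin 3 → ℝ → Vec3 ℝ → ℝ) : Prop :=
  ∀ t ∈ Icc 0 T, ∀ φ : Vec3 ℝ → ℝ, Continuous φ → HasCompactSupport φ → (∀ x, φ x ^ 2 ≤ 1) →
    jetEnergy 0 φ (fun i => u i t) ≤ M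

/-- For fields bounded in `L²`, the energy inequality on large balls has only a small error from
the cutoff. -/
theorem exists_energy_ballCutoff {β : ℝ} (hβ : 0 < β) : ∃ c : ℝ, 0 ≤ c ∧ ∀ (T M : ℝ)
    (u : Fin 3 → ℝ → Vec3 ℝ → ℝ) (G : Fin 3 → Fin 3 → ℝ → Vec3 ℝ → ℝ),
    SolvesWithFlux β T u G → L2BoundedOn T M u → ∀ R : ℝ, 0 < R → ∀ t ∈ Icc 0 T,
    jetEnergy 0 (ballCutoff R) (fun i => u i t)
        + β * ∫ s in (0 : ℝ)..t, jetDissipation 0 (ballCutoff R) (fun i => u i s)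
      ≤ jetEnergy 0 (ballCutoff R) (fun i => u i 0) + energyConst β * (∫ s in (0 : ℝ)..t,
        fluxEnergy 0 (ballCutoff R) (fun i j => G i j s)) + c * M * T / R ^ 2 := by
  obtain ⟨c, hc0, hc⟩ := exists_ballCutoff_gradient_le
  have hC := (energyConst_pos hβ).le
  refine ⟨energyConst β * (3 * c), by positivity, fun T M u G h hM R hR t ht => ?_⟩
  have hφ := ballCutoff_contDiff R
  have hcs := ballCutoff_hasCompactSupport hR
  have hM0 : 0 ≤ M := (jetEnergy_nonneg _ _ _).trans
    (hM t ht _ hφ.continuous hcs (ballCutoff_sq_le_one R))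
  have hT : 0 ≤ T := ht.1.trans ht.2
  refine (h.energy hβ 0 hφ hcs ht).trans ?_
  have hcont1 := continuousOn_finsetSum (Finset.univ : Finset (Fin 3)) fun l _ =>
    continuousOn_jetEnergy h.smooth 0 (hφ.partialDeriv l).continuous (hcs.partialDeriv l)
  have hcont2 := continuousOn_fluxEnergy h.smooth_flux 0 hφ.continuous hcs
  rw [intervalIntegral.integral_add (hcont1.intervalIntegrable_zero ht)
    (hcont2.intervalIntegrable_zero ht), mul_add, add_comm (energyConst β * _), ← add_assoc]
  gcongr
  have h1 : ∫ s in (0 : ℝ)..t, ∑ l, jetEnergy 0 (partialDeriv l (ballCutoff R)) (fun i => u i s)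
      ≤ ∫ _s in (0 : ℝ)..t, 3 * (c / R ^ 2 * M) := by
    refine intervalIntegral.integral_mono_on ht.1 (hcont1.intervalIntegrable_zero ht)
      intervalIntegrable_const fun s hs => ?_
    have hs' : s ∈ Icc 0 T := ⟨hs.1, hs.2.trans ht.2⟩
    have h2 : ∀ l, jetEnergy 0 (partialDeriv l (ballCutoff R)) (fun i => u i s)
        ≤ c / R ^ 2 * M := fun l =>
      (jetEnergy_mono_cutoff (hφ.partialDeriv l).continuous (hcs.partialDeriv l)
        (ballCutoff_contDiff (2 * R)).continuous (ballCutoff_hasCompactSupport (by positivity))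
        (fun i => (h.smooth i).contDiff s hs') (hc R hR l)).trans
        (mul_le_mul_of_nonneg_left (hM s hs' _ (ballCutoff_contDiff _).continuous
          (ballCutoff_hasCompactSupport (by positivity)) (ballCutoff_sq_le_one _)) (by positivity))
    refine (Finset.sum_le_sum fun l _ => h2 l).trans (le_of_eq ?_)
    simp
  rw [intervalIntegral.integral_const, sub_zero, smul_eq_mul] at h1
  calc energyConst β * ∫ s in (0 : ℝ)..t,
        ∑ l, jetEnergy 0 (partialDeriv l (ballCutoff R)) (fun i => u i s)
      ≤ energyConst β * (T * (3 * (c / R ^ 2 * M))) := by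
        refine mul_le_mul_of_nonneg_left (h1.trans ?_) hC
        exact mul_le_mul_of_nonneg_right ht.2 (by positivity)
    _ = energyConst β * (3 * c) * M * T / R ^ 2 := by ring

/-! ### Linear fluxes -/

/-- The flux `∑ₖ aᵢⱼₖ uₖ`. -/
def linearFlux (a : Fin 3 → Fin 3 → Fin 3 → ℝ → Vec3 ℝ → ℝ) (u : Fin 3 → ℝ → Vec3 ℝ → ℝ)
    (i j : Fin 3) (t : ℝ) (x : Vec3 ℝ) : ℝ :=
  ∑ k, a i j k t x * u k t x

theorem smooth_linearFlux {m : ℕ∞ω} (hm : m ≤ ∞) {J : Set ℝ}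
    {a : Fin 3 → Fin 3 → Fin 3 → ℝ → Vec3 ℝ → ℝ} {u : Fin 3 → ℝ → Vec3 ℝ → ℝ}
    (ha : ∀ i j k, SmoothField m J (a i j k)) (hu : ∀ i, SmoothField m J (u i)) (i j : Fin 3) :
    SmoothField m J (linearFlux a u i j) :=
  SmoothField.sum _ (fun k => (ha i j k).mul (hu k)) hm

/-- A bounded linear flux is controlled in `L²` by the field. -/
theorem fluxEnergy_linearFlux_le {J : Set ℝ} {a : Fin 3 → Fin 3 → Fin 3 → ℝ → Vec3 ℝ → ℝ}
    {u : Fin 3 → ℝ → Vec3 ℝ → ℝ} {A t : ℝ} (ht : t ∈ J)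
    (ha : ∀ i j k, SmoothField 0 J (a i j k)) (hu : ∀ i, SmoothField 0 J (u i))
    (hA : ∀ i j k x, |a i j k t x| ≤ A) {φ : Vec3 ℝ → ℝ} (hφ : Continuous φ)
    (hc : HasCompactSupport φ) :
    fluxEnergy 0 φ (fun i j => linearFlux a u i j t) ≤ 27 * A ^ 2 * jetEnergy 0 φ (u · t) := by
  have hG := smooth_linearFlux (by simp) ha hu
  have h1 : ∀ i j, cutoffIntegral φ (sqJet 0 (linearFlux a u i j t))
      ≤ 3 * A ^ 2 * jetEnergy 0 φ (u · t) := by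
    intro i j
    have hs : Continuous fun x => ∑ k, sqJet 0 (u k t) x :=
      continuous_finsetSum _ fun k _ => continuous_sqJet 0 ((hu k).contDiff t ht)
    rw [jetEnergy, ← cutoffIntegral_sum _ hφ hc fun k => continuous_sqJet 0
      ((hu k).contDiff t ht), ← cutoffIntegral_const_mul]
    refine cutoffIntegral_mono hφ hc (continuous_sqJet 0 ((hG i j).contDiff t ht))
      (continuous_const.mul hs) fun x _ => ?_
    simp only [sqJet, linearFlux]
    refine (sq_sum_le_card_mul_sum_sq).trans ?_
    rw [Finset.mul_sum, Finset.mul_sum]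
    refine Finset.sum_le_sum fun k _ => ?_
    have := sq_le_sq' (neg_le_of_abs_le (hA i j k x)) (le_of_abs_le (hA i j k x))
    have h2 := mul_le_mul_of_nonneg_right this (sq_nonneg (u k t x))
    simp only [Finset.card_univ, Fintype.card_fin, mul_pow]
    push_cast
    nlinarith
  refine (Finset.sum_le_sum fun i _ => Finset.sum_le_sum fun j _ => h1 i j).trans (le_of_eq ?_)
  simp
  ring

/-! ### Integral inequalities -/

theorem integral_exp_mul {l : ℝ} (hl : l ≠ 0) (t : ℝ) :
    ∫ s in (0 : ℝ)..t, Real.exp (l * s) = (Real.exp (l * t) - 1) / l := by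
  rw [intervalIntegral.integral_comp_mul_left (fun s => Real.exp s) hl, integral_exp, mul_zero,
    Real.exp_zero, smul_eq_mul, inv_mul_eq_div]

/-- Exponential growth is reproduced by integration, with the rate as a gain. -/
theorem integral_le_of_le_exp {T l W : ℝ} (hl : 0 < l) (hW : 0 ≤ W) {e : ℝ → ℝ}
    (he : ContinuousOn e (Icc 0 T)) (h : ∀ t ∈ Icc 0 T, e t ≤ W * Real.exp (l * t)) {t : ℝ}
    (ht : t ∈ Icc 0 T) : ∫ s in (0 : ℝ)..t, e s ≤ W / l * Real.exp (l * t) := by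
  have h1 : ∫ s in (0 : ℝ)..t, e s ≤ ∫ s in (0 : ℝ)..t, W * Real.exp (l * s) :=
    intervalIntegral.integral_mono_on ht.1 (he.intervalIntegrable_zero ht)
      (Continuous.intervalIntegrable (by fun_prop) _ _) fun s hs => h s ⟨hs.1, hs.2.trans ht.2⟩
  rw [intervalIntegral.integral_const_mul, integral_exp_mul hl.ne'] at h1
  refine h1.trans ?_
  rw [div_mul_eq_mul_div, ← mul_div_assoc]
  gcongr
  linarith

/-- Grönwall's inequality in integral form. -/
theorem le_of_le_integral {T C δ : ℝ} (hC : 0 < C) {e : ℝ → ℝ}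
    (he : ContinuousOn e (Icc 0 T)) (he0 : ∀ t ∈ Icc 0 T, 0 ≤ e t)
    (h : ∀ t ∈ Icc 0 T, e t ≤ δ + C * ∫ s in (0 : ℝ)..t, e s) :
    ∀ t ∈ Icc 0 T, e t ≤ 2 * δ * Real.exp (2 * C * t) := by
  intro t ht
  have hne : (Icc (0 : ℝ) T).Nonempty := ⟨t, ht⟩
  obtain ⟨t₀, ht₀, hmax⟩ := isCompact_Icc.exists_isMaxOn hne
    (f := fun s => e s * Real.exp (-(2 * C * s))) (he.mul (by fun_prop))
  set W := e t₀ * Real.exp (-(2 * C * t₀)) with hWdef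
  have hW : 0 ≤ W := mul_nonneg (he0 _ ht₀) (Real.exp_pos _).le
  have hle : ∀ s ∈ Icc 0 T, e s ≤ W * Real.exp (2 * C * s) := by
    intro s hs
    have h2 : e s * Real.exp (-(2 * C * s)) ≤ W := hmax hs
    rw [Real.exp_neg, ← div_eq_mul_inv, div_le_iff₀ (Real.exp_pos _)] at h2
    exact h2
  have h3 := integral_le_of_le_exp (by positivity : 0 < 2 * C) hW he hle ht₀
  have h4 := h t₀ ht₀
  have h5 : e t₀ = W * Real.exp (2 * C * t₀) := by
    rw [hWdef, mul_assoc, ← Real.exp_add]; simp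
  have h6 : C * (W / (2 * C) * Real.exp (2 * C * t₀)) = W * Real.exp (2 * C * t₀) / 2 := by
    field_simp
  have h7 := mul_le_mul_of_nonneg_left h3 hC.le
  have h8 : (1 : ℝ) ≤ Real.exp (2 * C * t₀) :=
    Real.one_le_exp (mul_nonneg (by positivity) ht₀.1)
  have h9 : W ≤ 2 * δ := by nlinarith
  exact (hle t ht).trans (mul_le_mul_of_nonneg_right h9 (Real.exp_pos _).le)

/-- A recursive integral inequality with geometrically decaying errors forces geometric decay. -/
theorem exists_geometric_bound {T C M θ : ℝ} (hC : 0 < C) (hM : 0 ≤ M) (hθ : 0 < θ)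
    {N : ℕ} {e : ℕ → ℝ → ℝ} (he : ∀ n, N ≤ n → ContinuousOn (e n) (Icc 0 T))
    (h : ∀ n, N ≤ n → ∀ t ∈ Icc 0 T,
      e (n + 1) t ≤ C * (∫ s in (0 : ℝ)..t, e n s) + M * θ ^ n) :
    ∃ M', 0 ≤ M' ∧ ∀ n, N ≤ n → ∀ t ∈ Icc 0 T, e n t ≤ M' * θ ^ n := by
  obtain ⟨S, hS⟩ := isCompact_Icc.exists_bound_of_continuousOn (he N le_rfl)
  set l := 2 * C / θ with hl
  have hl0 : 0 < l := by positivity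
  set W := max (2 * M / θ) (|S| / θ ^ N) with hW
  have hW0 : 0 ≤ W := le_max_of_le_left (by positivity)
  have key : ∀ n, N ≤ n → ∀ t ∈ Icc 0 T, e n t ≤ W * θ ^ n * Real.exp (l * t) := by
    intro n hn
    induction n, hn using Nat.le_induction with
    | base =>
      intro t ht
      have h1 : |S| ≤ W * θ ^ N := by
        rw [← div_le_iff₀ (by positivity)]
        exact le_max_right _ _
      have h2 : (1 : ℝ) ≤ Real.exp (l * t) := Real.one_le_exp (mul_nonneg hl0.le ht.1)
      calc e N t ≤ |S| := ((le_abs_self _).trans (hS t ht)).trans (le_abs_self _)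
        _ ≤ W * θ ^ N := h1
        _ ≤ W * θ ^ N * Real.exp (l * t) := le_mul_of_one_le_right (by positivity) h2
    | succ n hn ih =>
      intro t ht
      have h1 := integral_le_of_le_exp hl0 (by positivity : 0 ≤ W * θ ^ n) (he n hn) ih ht
      have h2 : (1 : ℝ) ≤ Real.exp (l * t) := Real.one_le_exp (mul_nonneg hl0.le ht.1)
      have h3 : M ≤ W * θ / 2 := by
        have : 2 * M / θ ≤ W := le_max_left _ _
        rw [div_le_iff₀ hθ] at this
        linarith
      have h4 : C * (W * θ ^ n / l * Real.exp (l * t))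
          = W * θ / 2 * θ ^ n * Real.exp (l * t) := by
        rw [hl]; field_simp
      calc e (n + 1) t ≤ C * (W * θ ^ n / l * Real.exp (l * t)) + W * θ / 2 * θ ^ n :=
            (h n hn t ht).trans (add_le_add (mul_le_mul_of_nonneg_left h1 hC.le)
              (mul_le_mul_of_nonneg_right h3 (by positivity)))
        _ ≤ W * θ / 2 * θ ^ n * Real.exp (l * t) + W * θ / 2 * θ ^ n * Real.exp (l * t) := by
            rw [h4]
            exact add_le_add le_rfl (le_mul_of_one_le_right (by positivity) h2)
        _ = W * θ ^ (n + 1) * Real.exp (l * t) := by rw [pow_succ]; ring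
  refine ⟨W * Real.exp (l * T), by positivity, fun n hn t ht => (key n hn t ht).trans ?_⟩
  have : Real.exp (l * t) ≤ Real.exp (l * T) :=
    Real.exp_le_exp.2 (mul_le_mul_of_nonneg_left ht.2 hl0.le)
  calc W * θ ^ n * Real.exp (l * t) ≤ W * θ ^ n * Real.exp (l * T) := by gcongr
    _ = _ := by ring

/-! ### Passing to large balls -/

/-- Every bounded compactly supported cutoff is dominated by the cutoffs of large balls. -/
theorem exists_sq_le_ballCutoff_sq {φ : Vec3 ℝ → ℝ} (hc : HasCompactSupport φ)
    (h1 : ∀ x, φ x ^ 2 ≤ 1) :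
    ∃ R₀ : ℝ, 0 < R₀ ∧ ∀ R, R₀ ≤ R → ∀ x, φ x ^ 2 ≤ 1 * ballCutoff R x ^ 2 := by
  obtain ⟨r, hr⟩ := hc.isCompact.isBounded.subset_closedBall 0
  refine ⟨max r 1, lt_max_of_lt_right one_pos, fun R hR x => ?_⟩
  have hR0 : 0 < R := (lt_max_of_lt_right one_pos).trans_le hR
  by_cases hx : x ∈ tsupport φ
  · have : ‖x‖ ≤ R := (mem_closedBall_zero_iff.1 (hr hx)).trans ((le_max_left _ _).trans hR)
    rw [ballCutoff_eq_one hR0 this]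
    simpa using h1 x
  · rw [image_eq_zero_of_notMem_tsupport hx, zero_pow two_ne_zero, one_mul]
    exact sq_nonneg _

theorem jetEnergy_le_of_ballCutoff {w : Fin 3 → Vec3 ℝ → ℝ} (hw : ∀ i, ContDiff ℝ ∞ (w i))
    {F D : ℝ} (h : ∀ R : ℝ, 1 ≤ R → jetEnergy 0 (ballCutoff R) w ≤ F + D / R ^ 2)
    {φ : Vec3 ℝ → ℝ} (hφ : Continuous φ) (hc : HasCompactSupport φ) (h1 : ∀ x, φ x ^ 2 ≤ 1) :
    jetEnergy 0 φ w ≤ F := by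
  obtain ⟨R₀, hR₀, hle⟩ := exists_sq_le_ballCutoff_sq hc h1
  have hlim : Tendsto (fun R : ℝ => F + D / R ^ 2) atTop (𝓝 (F + 0)) :=
    tendsto_const_nhds.add (tendsto_const_nhds.div_atTop (tendsto_pow_atTop two_ne_zero))
  rw [add_zero] at hlim
  refine ge_of_tendsto hlim ?_
  filter_upwards [eventually_ge_atTop R₀, eventually_ge_atTop 1] with R hR hR1
  have hR0 := hR₀.trans_le hR
  have h2 := jetEnergy_mono_cutoff (k := 0) hφ hc (ballCutoff_contDiff R).continuous
    (ballCutoff_hasCompactSupport hR0) hw (hle R hR)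
  rw [one_mul] at h2
  exact h2.trans (h R hR1)

theorem eq_zero_of_jetEnergy_nonpos {w : Fin 3 → Vec3 ℝ → ℝ} (hw : ∀ i, ContDiff ℝ ∞ (w i))
    (h : ∀ φ : Vec3 ℝ → ℝ, Continuous φ → HasCompactSupport φ → (∀ x, φ x ^ 2 ≤ 1) →
      jetEnergy 0 φ w ≤ 0) (i : Fin 3) (x : Vec3 ℝ) : w i x = 0 := by
  by_contra hne
  have hR : (0 : ℝ) < ‖x‖ + 1 := by positivity
  set φ := ballCutoff (‖x‖ + 1)
  have hφ : Continuous φ := (ballCutoff_contDiff _).continuous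
  have hc : HasCompactSupport φ := ballCutoff_hasCompactSupport hR
  have hx : φ x = 1 := ballCutoff_eq_one hR (by linarith)
  have h0 : cutoffIntegral φ (sqJet 0 (w i)) ≤ 0 :=
    (Finset.single_le_sum (f := fun i => cutoffIntegral φ (sqJet 0 (w i)))
      (fun j _ => cutoffIntegral_nonneg fun y => sqJet_nonneg _ _ _)
      (Finset.mem_univ i)).trans (h φ hφ hc (ballCutoff_sq_le_one _))
  have hpos : 0 < ∫ y, φ y ^ 2 * sqJet 0 (w i) y := by
    refine Continuous.integral_pos_of_hasCompactSupport_nonneg_nonzero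
      (hφ.pow 2 |>.mul (continuous_sqJet 0 (hw i))) (hasCompactSupport_cutoff_sq_mul hc)
      (fun y => mul_nonneg (sq_nonneg _) (sqJet_nonneg _ _ _)) (x := x) ?_
    simp only [hx, sqJet]
    simpa using hne
  exact absurd h0 (not_le.2 hpos)

/-! ### Differences of solutions and uniqueness -/

theorem SolvesWithFlux.sub {β T : ℝ} {u w : Fin 3 → ℝ → Vec3 ℝ → ℝ}
    {G H : Fin 3 → Fin 3 → ℝ → Vec3 ℝ → ℝ} (hu : SolvesWithFlux β T u G)
    (hw : SolvesWithFlux β T w H) :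
    SolvesWithFlux β T (fun i t x => u i t x - w i t x) (fun i j t x => G i j t x - H i j t x) := by
  refine ⟨fun i => (hu.smooth i).sub (hw.smooth i),
    fun i j => (hu.smooth_flux i j).sub (hw.smooth_flux i j), fun i t ht x => ?_⟩
  have hd : ∀ {g : ℝ → Vec3 ℝ → ℝ}, SmoothField 0 (Icc 0 T) g → Differentiable ℝ (g t) :=
    fun h => (h.contDiff t ht).differentiable_field
  refine ((hu.hasDeriv i t ht x).sub (hw.hasDeriv i t ht x)).congr_deriv ?_
  have h1 : laplacianSum (fun x => u i t x - w i t x) x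
      = laplacianSum (u i t) x - laplacianSum (w i t) x := by
    simp only [laplacianSum, ← Finset.sum_sub_distrib]
    refine Finset.sum_congr rfl fun l _ => ?_
    rw [partialDeriv_sub (hd (hu.smooth i)) (hd (hw.smooth i)),
      partialDeriv_sub (hd ((hu.smooth i).partialDeriv l)) (hd ((hw.smooth i).partialDeriv l))]
  have h2 : ∀ j, partialDeriv j (fun x => G i j t x - H i j t x) x
      = partialDeriv j (G i j t) x - partialDeriv j (H i j t) x := fun j => by
    rw [partialDeriv_sub (hd (hu.smooth_flux i j)) (hd (hw.smooth_flux i j))]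
  rw [h1, Finset.sum_congr rfl fun j _ => h2 j, Finset.sum_sub_distrib]
  ring

theorem SolvesWithFlux.congr_flux {β T : ℝ} {u : Fin 3 → ℝ → Vec3 ℝ → ℝ}
    {G H : Fin 3 → Fin 3 → ℝ → Vec3 ℝ → ℝ} (hu : SolvesWithFlux β T u G)
    (h : ∀ i j, ∀ t ∈ Icc 0 T, G i j t = H i j t) : SolvesWithFlux β T u H := by
  refine ⟨hu.smooth, fun i j => (hu.smooth_flux i j).congr fun t ht => (h i j t ht).symm,
    fun i t ht x => (hu.hasDeriv i t ht x).congr_deriv ?_⟩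
  simp only [h i _ t ht]

theorem L2BoundedOn.sub {T M M' : ℝ} {u w : Fin 3 → ℝ → Vec3 ℝ → ℝ}
    (hu : L2BoundedOn T M u) (hw : L2BoundedOn T M' w)
    (hus : ∀ i, SmoothField 0 (Icc 0 T) (u i)) (hws : ∀ i, SmoothField 0 (Icc 0 T) (w i)) :
    L2BoundedOn T (2 * (M + M')) (fun i t x => u i t x - w i t x) := by
  intro t ht φ hφ hc h1
  have hcu : ∀ i, Continuous (sqJet 0 (u i t)) := fun i =>
    continuous_sqJet 0 ((hus i).contDiff t ht)
  have hcw : ∀ i, Continuous (sqJet 0 (w i t)) := fun i =>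
    continuous_sqJet 0 ((hws i).contDiff t ht)
  have key : ∀ i, cutoffIntegral φ (sqJet 0 fun x => u i t x - w i t x)
      ≤ 2 * (cutoffIntegral φ (sqJet 0 (u i t)) + cutoffIntegral φ (sqJet 0 (w i t))) := by
    intro i
    rw [← cutoffIntegral_add hφ hc (hcu i) (hcw i), ← cutoffIntegral_const_mul]
    refine cutoffIntegral_mono hφ hc (continuous_sqJet 0 (((hus i).sub (hws i)).contDiff t ht))
      (continuous_const.mul ((hcu i).add (hcw i))) fun x _ => ?_
    simp only [sqJet]
    nlinarith [sq_nonneg (u i t x + w i t x)]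
  calc _ ≤ ∑ i, 2 * (cutoffIntegral φ (sqJet 0 (u i t)) + cutoffIntegral φ (sqJet 0 (w i t))) :=
        Finset.sum_le_sum fun i _ => key i
    _ = 2 * (jetEnergy 0 φ (fun i => u i t) + jetEnergy 0 φ (fun i => w i t)) := by
        rw [← Finset.mul_sum, Finset.sum_add_distrib, jetEnergy, jetEnergy]
    _ ≤ _ := by linarith [hu t ht φ hφ hc h1, hw t ht φ hφ hc h1]

/-- An `L²`-bounded solution of a linear system with bounded coefficients and zero initial data
vanishes: on the ball of radius `R` its energy is `O(R⁻²)` by Grönwall's inequality. -/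
theorem SolvesWithFlux.eq_zero_of_linearFlux {β T M A : ℝ} (hβ : 0 < β)
    {a : Fin 3 → Fin 3 → Fin 3 → ℝ → Vec3 ℝ → ℝ} (ha : ∀ i j k, SmoothField 0 (Icc 0 T) (a i j k))
    (hA : ∀ i j k, ∀ t ∈ Icc 0 T, ∀ x, |a i j k t x| ≤ A) {u : Fin 3 → ℝ → Vec3 ℝ → ℝ}
    (h : SolvesWithFlux β T u (linearFlux a u)) (hM : L2BoundedOn T M u)
    (h0 : ∀ i x, u i 0 x = 0) : ∀ i, ∀ t ∈ Icc 0 T, ∀ x, u i t x = 0 := by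
  intro i t ht x
  obtain ⟨c, hc, hen⟩ := exists_energy_ballCutoff hβ
  have hC := energyConst_pos hβ
  have hA' : ∀ i j k, ∀ t ∈ Icc 0 T, ∀ x, |a i j k t x| ≤ |A| + 1 := fun i j k t ht x =>
    ((hA i j k t ht x).trans (le_abs_self A)).trans (by linarith)
  set K := energyConst β * (27 * (|A| + 1) ^ 2) with hK
  have hK0 : 0 < K := by positivity
  refine eq_zero_of_jetEnergy_nonpos (fun i => (h.smooth i).contDiff t ht)
    (fun φ hφ hcφ h1 => ?_) i x
  refine jetEnergy_le_of_ballCutoff (D := 2 * (c * M * T) * Real.exp (2 * K * t))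
    (fun i => (h.smooth i).contDiff t ht) (fun R hR1 => ?_) hφ hcφ h1
  have hR : 0 < R := one_pos.trans_le hR1
  have hφR := (ballCutoff_contDiff R).continuous
  have hcR := ballCutoff_hasCompactSupport hR
  have hcE := continuousOn_jetEnergy h.smooth 0 hφR hcR
  have h2 := le_of_le_integral (δ := c * M * T / R ^ 2) hK0 hcE (fun s _ => jetEnergy_nonneg _ _ _)
    (fun s hs => ?_) t ht
  · refine h2.trans (le_of_eq ?_)
    ring
  have h3 := hen T M u _ h hM R hR s hs
  have h4 : ∫ r in (0 : ℝ)..s, fluxEnergy 0 (ballCutoff R) (fun i j => linearFlux a u i j r)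
      ≤ ∫ r in (0 : ℝ)..s, 27 * (|A| + 1) ^ 2 * jetEnergy 0 (ballCutoff R) (fun i => u i r) := by
    refine intervalIntegral.integral_mono_on hs.1
      ((continuousOn_fluxEnergy h.smooth_flux 0 hφR hcR).intervalIntegrable_zero hs)
      ((continuousOn_const.mul hcE).intervalIntegrable_zero hs) fun r hr => ?_
    have hr' : r ∈ Icc 0 T := ⟨hr.1, hr.2.trans hs.2⟩
    exact fluxEnergy_linearFlux_le hr' ha h.smooth (fun i j k x => hA' i j k r hr' x) hφR hcR
  rw [intervalIntegral.integral_const_mul] at h4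
  have h5 : jetEnergy 0 (ballCutoff R) (fun i => u i 0) = 0 := by
    have : ∀ i, u i 0 = fun _ => 0 := fun i => funext (h0 i)
    simp [jetEnergy, this, cutoffIntegral, sqJet]
  have h6 : 0 ≤ β * ∫ r in (0 : ℝ)..s, jetDissipation 0 (ballCutoff R) (fun i => u i r) :=
    mul_nonneg hβ.le (intervalIntegral.integral_nonneg hs.1 fun r _ => jetDissipation_nonneg _ _ _)
  have h7 := mul_le_mul_of_nonneg_left h4 hC.le
  rw [h5] at h3
  rw [hK]
  linarith

/-! ### The truncated Picard iteration -/

/-- The coefficients `a` cut off outside the ball of radius `2ⁿ⁺¹`. -/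
def truncatedCoeff (n : ℕ) (a : Fin 3 → Fin 3 → Fin 3 → ℝ → Vec3 ℝ → ℝ) (i j k : Fin 3) (t : ℝ)
    (x : Vec3 ℝ) : ℝ :=
  ballCutoff (2 ^ n) x * a i j k t x

theorem smooth_truncatedCoeff {m : ℕ∞ω} (hm : m ≤ ∞) {J : Set ℝ}
    {a : Fin 3 → Fin 3 → Fin 3 → ℝ → Vec3 ℝ → ℝ} (ha : ∀ i j k, SmoothField m J (a i j k)) (n : ℕ)
    (i j k : Fin 3) : SmoothField m J (truncatedCoeff n a i j k) :=
  (SmoothField.of_contDiff (ballCutoff_contDiff (2 ^ n)) hm).mul (ha i j k)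

theorem abs_truncatedCoeff_le {n : ℕ} {a : Fin 3 → Fin 3 → Fin 3 → ℝ → Vec3 ℝ → ℝ}
    {i j k : Fin 3} {t A : ℝ} {x : Vec3 ℝ} (h : |a i j k t x| ≤ A) :
    |truncatedCoeff n a i j k t x| ≤ A := by
  rw [truncatedCoeff, abs_mul, abs_of_nonneg (ballCutoff_nonneg _ _)]
  exact (mul_le_of_le_one_left (abs_nonneg _) (ballCutoff_le_one _ _)).trans h

/-- The iteration `∂ₜBⁿ⁺¹ = βΔBⁿ⁺¹ + div(χₙ a Bⁿ)`, `Bⁿ⁺¹(0) = χₙ f`, starting from `B⁰ = 0`; the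
cutoff `χₙ` equals one on the ball of radius `2ⁿ`. -/
structure IsPicardSequence (β : ℝ) (a : Fin 3 → Fin 3 → Fin 3 → ℝ → Vec3 ℝ → ℝ)
    (f : Fin 3 → Vec3 ℝ → ℝ) (B : ℕ → Fin 3 → ℝ → Vec3 ℝ → ℝ) : Prop where
  zero : ∀ i t x, B 0 i t x = 0
  smooth : ∀ n i, SmoothField 0 (Ici 0) (B n i)
  initial : ∀ n i x, B (n + 1) i 0 x = ballCutoff (2 ^ n) x * f i x
  solves : ∀ n T, SolvesWithFlux β T (B (n + 1)) (linearFlux (truncatedCoeff n a) (B n))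
  l2Bounded : ∀ n T, ∃ M, L2BoundedOn T M (B n)

/-- One step of the iteration is an inhomogeneous heat equation with compactly supported data. -/
theorem exists_picard_step {β : ℝ} (hβ : 0 < β) {a : Fin 3 → Fin 3 → Fin 3 → ℝ → Vec3 ℝ → ℝ}
    (ha : ∀ i j k, SmoothField 0 (Ici 0) (a i j k)) {f : Fin 3 → Vec3 ℝ → ℝ}
    (hf : ∀ i, ContDiff ℝ ∞ (f i)) (n : ℕ) (w : Fin 3 → ℝ → Vec3 ℝ → ℝ)
    (hw : ∀ i, SmoothField 0 (Ici 0) (w i)) :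
    ∃ u : Fin 3 → ℝ → Vec3 ℝ → ℝ, (∀ i, SmoothField 0 (Ici 0) (u i)) ∧
      (∀ i x, u i 0 x = ballCutoff (2 ^ n) x * f i x) ∧
      (∀ T, SolvesWithFlux β T u (linearFlux (truncatedCoeff n a) w)) ∧
      ∀ T, ∃ M, L2BoundedOn T M u := by
  have hR : (0 : ℝ) < 2 ^ n := by positivity
  have hG := smooth_linearFlux (by simp) (smooth_truncatedCoeff (by simp) ha n) hw
  have hex : ∀ i : Fin 3, _ := fun i => exists_heat_solution hβ
    (f := fun x => ballCutoff (2 ^ n) x * f i x) ((ballCutoff_contDiff _).mul (hf i))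
    ((ballCutoff_hasCompactSupport hR).mul_right)
    (g := fun t x => ∑ j, partialDeriv j (linearFlux (truncatedCoeff n a) w i j t) x)
    (SmoothField.sum _ (fun j => (hG i j).partialDeriv j) (by simp))
    (K := tsupport (ballCutoff (2 ^ n))) (ballCutoff_hasCompactSupport hR).isCompact
    (fun t ht x hx => Finset.sum_eq_zero fun j _ =>
      partialDeriv_eq_zero_of_notMem_tsupport j fun hx' => hx
        (closure_mono (Function.support_subset_iff'.2 fun y hy => ?_) hx'))
  · choose u hu h0 hd M hM0 hM using hex
    refine ⟨u, hu, fun i x => congrFun (h0 i) x, fun T => ⟨fun i => (hu i).mono Icc_subset_Ici_self,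
      fun i j => (hG i j).mono Icc_subset_Ici_self, fun i => hd i T⟩, fun T => ⟨∑ i, M i T, ?_⟩⟩
    intro t ht φ hφ hc h1
    exact Finset.sum_le_sum fun i _ => hM i T t ht φ hφ hc h1
  · have hy' : ballCutoff (2 ^ n) y = 0 := by simpa using hy
    simp [linearFlux, truncatedCoeff, hy']

theorem exists_isPicardSequence {β : ℝ} (hβ : 0 < β)
    {a : Fin 3 → Fin 3 → Fin 3 → ℝ → Vec3 ℝ → ℝ}
    (ha : ∀ i j k, SmoothField 0 (Ici 0) (a i j k)) {f : Fin 3 → Vec3 ℝ → ℝ}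
    (hf : ∀ i, ContDiff ℝ ∞ (f i)) :
    ∃ B : ℕ → Fin 3 → ℝ → Vec3 ℝ → ℝ, IsPicardSequence β a f B := by
  choose S hS hS0 hSs hSb using fun (n : ℕ) (w : {w : Fin 3 → ℝ → Vec3 ℝ → ℝ //
    ∀ i, SmoothField 0 (Ici 0) (w i)}) => exists_picard_step hβ ha hf n w.1 w.2
  let B : ℕ → {w : Fin 3 → ℝ → Vec3 ℝ → ℝ // ∀ i, SmoothField 0 (Ici 0) (w i)} := fun n =>
    Nat.rec ⟨fun _ _ _ => 0, fun _ => SmoothField.of_contDiff contDiff_const (by simp)⟩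
      (fun n w => ⟨S n w, hS n w⟩) n
  refine ⟨fun n => (B n).1, fun _ _ _ => rfl, fun n => (B n).2, fun n => hS0 n (B n),
    fun n => hSs n (B n), fun n T => ?_⟩
  cases n with
  | zero =>
    refine ⟨0, fun t _ φ _ _ _ => ?_⟩
    simp [B, jetEnergy, cutoffIntegral, sqJet]
  | succ n => exact hSb n (B n) T

/-- The growth rate of the energy. -/
def growthRate (β A : ℝ) : ℝ := energyConst β * (27 * A ^ 2)

/-- The energies of the iterates grow at most exponentially, uniformly along the sequence. -/
theorem IsPicardSequence.jetEnergy_le {β A F : ℝ} (hβ : 0 < β) (hA0 : 0 < A)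
    {a : Fin 3 → Fin 3 → Fin 3 → ℝ → Vec3 ℝ → ℝ} (ha : ∀ i j k, SmoothField 0 (Ici 0) (a i j k))
    (hA : ∀ i j k, ∀ t, 0 ≤ t → ∀ x, |a i j k t x| ≤ A) {f : Fin 3 → Vec3 ℝ → ℝ}
    (hF : ∀ φ : Vec3 ℝ → ℝ, Continuous φ → HasCompactSupport φ →
      (∀ x, φ x ^ 2 ≤ 1) → jetEnergy 0 φ f ≤ F)
    {B : ℕ → Fin 3 → ℝ → Vec3 ℝ → ℝ} (hB : IsPicardSequence β a f B) (n : ℕ) :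
    ∀ t, 0 ≤ t → ∀ φ : Vec3 ℝ → ℝ, Continuous φ → HasCompactSupport φ → (∀ x, φ x ^ 2 ≤ 1) →
      jetEnergy 0 φ (fun i => B n i t) ≤ F * Real.exp (growthRate β A * t) := by
  have hC := energyConst_pos hβ
  set l := growthRate β A with hl
  have hl0 : 0 < l := by rw [hl, growthRate]; positivity
  have hF0 : 0 ≤ F := (jetEnergy_nonneg _ _ _).trans (hF (fun _ => 0) continuous_const
    HasCompactSupport.zero (by simp))
  obtain ⟨c, hc, hen⟩ := exists_energy_ballCutoff hβ
  induction n with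
  | zero =>
    intro t _ φ _ _ _
    have : ∀ i, B 0 i t = fun _ => 0 := fun i => funext (hB.zero i t)
    simp only [this]
    simp only [jetEnergy, cutoffIntegral, sqJet]
    simp only [ne_eq, OfNat.ofNat_ne_zero, not_false_eq_true, zero_pow, mul_zero, integral_zero,
      Finset.sum_const_zero]
    positivity
  | succ n ih =>
    intro t ht φ hφ hcφ h1
    have h := hB.solves n t
    obtain ⟨M, hM⟩ := hB.l2Bounded (n + 1) t
    have htt : t ∈ Icc 0 t := ⟨ht, le_rfl⟩
    refine jetEnergy_le_of_ballCutoff (D := c * M * t)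
      (fun i => (h.smooth i).contDiff t htt) (fun R hR1 => ?_) hφ hcφ h1
    have hR : 0 < R := one_pos.trans_le hR1
    have hφR := (ballCutoff_contDiff R).continuous
    have hcR := ballCutoff_hasCompactSupport hR
    have h3 := hen t M _ _ h hM R hR t htt
    have h4 : ∫ r in (0 : ℝ)..t, fluxEnergy 0 (ballCutoff R)
          (fun i j => linearFlux (truncatedCoeff n a) (B n) i j r)
        ≤ ∫ r in (0 : ℝ)..t, 27 * A ^ 2 * F * Real.exp (l * r) := by
      refine intervalIntegral.integral_mono_on ht
        ((continuousOn_fluxEnergy h.smooth_flux 0 hφR hcR).intervalIntegrable_zero htt)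
        (Continuous.intervalIntegrable (by fun_prop) _ _) fun r hr => ?_
      refine (fluxEnergy_linearFlux_le (mem_Ici.2 hr.1) (smooth_truncatedCoeff (by simp) ha n)
        (hB.smooth n) (fun i j k x => abs_truncatedCoeff_le (hA i j k r hr.1 x)) hφR hcR).trans ?_
      rw [mul_assoc (27 * A ^ 2)]
      exact mul_le_mul_of_nonneg_left (ih r hr.1 _ hφR hcR (ballCutoff_sq_le_one R))
        (by positivity)
    rw [intervalIntegral.integral_const_mul, integral_exp_mul hl0.ne'] at h4
    have h5 : jetEnergy 0 (ballCutoff R) (fun i => B (n + 1) i 0) ≤ F := by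
      have : jetEnergy 0 (ballCutoff R) (fun i => B (n + 1) i 0)
          = jetEnergy 0 (fun x => ballCutoff R x * ballCutoff (2 ^ n) x) f := by
        simp only [jetEnergy, cutoffIntegral, sqJet, hB.initial]
        refine Finset.sum_congr rfl fun i _ => integral_congr_ae (Eventually.of_forall fun x => ?_)
        simp only
        ring
      rw [this]
      refine hF _ (hφR.mul (ballCutoff_contDiff _).continuous) hcR.mul_right fun x => ?_
      rw [mul_pow]
      exact mul_le_one₀ (ballCutoff_sq_le_one _ _) (sq_nonneg _) (ballCutoff_sq_le_one _ _)
    have h6 : 0 ≤ β * ∫ r in (0 : ℝ)..t,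
        jetDissipation 0 (ballCutoff R) (fun i => B (n + 1) i r) :=
      mul_nonneg hβ.le (intervalIntegral.integral_nonneg ht fun r _ => jetDissipation_nonneg _ _ _)
    have h7 := mul_le_mul_of_nonneg_left h4 hC.le
    have h8 : energyConst β * (27 * A ^ 2 * F * ((Real.exp (l * t) - 1) / l))
        = F * (Real.exp (l * t) - 1) := by
      have : energyConst β * (27 * A ^ 2) = l := rfl
      rw [← mul_div_assoc, ← mul_div_assoc, div_eq_iff hl0.ne', ← this]
      ring
    rw [h8] at h7
    linarith

/-! ### Consecutive differences of the iterates -/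

/-- The difference `Bⁿ⁺¹ - Bⁿ`. -/
def picardDiff (B : ℕ → Fin 3 → ℝ → Vec3 ℝ → ℝ) (n : ℕ) (i : Fin 3) (t : ℝ) (x : Vec3 ℝ) : ℝ :=
  B (n + 1) i t x - B n i t x

/-- A linear flux with smooth coefficients is controlled by the field on jets of every order. -/
theorem exists_fluxEnergy_linearFlux_le {T : ℝ} {a : Fin 3 → Fin 3 → Fin 3 → ℝ → Vec3 ℝ → ℝ}
    (ha : ∀ i j k, SmoothField 0 (Icc 0 T) (a i j k)) (k : ℕ) {φ : Vec3 ℝ → ℝ}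
    (hφ : Continuous φ) (hc : HasCompactSupport φ) :
    ∃ C, 0 ≤ C ∧ ∀ u : Fin 3 → ℝ → Vec3 ℝ → ℝ, ∀ t ∈ Icc 0 T, (∀ i, ContDiff ℝ ∞ (u i t)) →
      fluxEnergy k φ (fun i j => linearFlux a u i j t) ≤ C * jetEnergy k φ (fun i => u i t) := by
  choose c hc0 hcc using fun i j l => (ha i j l).exists_sqJet_mul_le k hc.isCompact
  have hsum0 : 0 ≤ ∑ i, ∑ j, ∑ l, c i j l := Finset.sum_nonneg fun i _ =>
    Finset.sum_nonneg fun j _ => Finset.sum_nonneg fun l _ => hc0 i j l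
  set S := ∑ i, ∑ j, ∑ l, c i j l with hS
  have hle : ∀ i j l, c i j l ≤ S := fun i j l =>
    (Finset.single_le_sum (f := fun l => c i j l) (fun l _ => hc0 i j l)
      (Finset.mem_univ l)).trans <|
    (Finset.single_le_sum (f := fun j => ∑ l, c i j l)
      (fun j _ => Finset.sum_nonneg fun l _ => hc0 i j l) (Finset.mem_univ j)).trans <|
    Finset.single_le_sum (f := fun i => ∑ j, ∑ l, c i j l) (fun i _ => Finset.sum_nonneg fun j _ =>
      Finset.sum_nonneg fun l _ => hc0 i j l) (Finset.mem_univ i)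
  refine ⟨9 * (4 * S), by positivity, fun u t ht hu => ?_⟩
  have hau : ∀ i j l, ContDiff ℝ ∞ fun x => a i j l t x * u l t x := fun i j l =>
    ((ha i j l).contDiff t ht).mul (hu l)
  have h1 : ∀ i j, cutoffIntegral φ (sqJet k (linearFlux a u i j t))
      ≤ 4 * S * jetEnergy k φ (fun i => u i t) := by
    intro i j
    have hs : Continuous fun x => ∑ l, sqJet k (u l t) x :=
      continuous_finsetSum _ fun l _ => continuous_sqJet k (hu l)
    rw [jetEnergy, ← cutoffIntegral_sum _ hφ hc fun l => continuous_sqJet k (hu l),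
      ← cutoffIntegral_const_mul]
    have hlf : ContDiff ℝ ∞ (linearFlux a u i j t) := ContDiff.sum fun l _ => hau i j l
    refine cutoffIntegral_mono hφ hc (continuous_sqJet k hlf) (continuous_const.mul hs)
      fun x hx => ?_
    refine (sqJet_sum_le k (hau i j) x).trans ?_
    rw [mul_assoc]
    refine mul_le_mul_of_nonneg_left ?_ (by norm_num)
    rw [Finset.mul_sum]
    refine Finset.sum_le_sum fun l _ => (hcc i j l t ht x (subset_tsupport _ hx) _ (hu l)).trans ?_
    exact mul_le_mul_of_nonneg_right (hle i j l) (sqJet_nonneg _ _ _)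
  refine (Finset.sum_le_sum fun i _ => Finset.sum_le_sum fun j _ => h1 i j).trans (le_of_eq ?_)
  simp
  ring

namespace IsPicardSequence

variable {β T M A : ℝ} {a : Fin 3 → Fin 3 → Fin 3 → ℝ → Vec3 ℝ → ℝ} {f : Fin 3 → Vec3 ℝ → ℝ}
  {B : ℕ → Fin 3 → ℝ → Vec3 ℝ → ℝ} {φ : Vec3 ℝ → ℝ}

theorem smooth_diff (hB : IsPicardSequence β a f B) (n : ℕ) (i : Fin 3) :
    SmoothField 0 (Ici 0) (picardDiff B n i) :=
  (hB.smooth (n + 1) i).sub (hB.smooth n i)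

theorem smooth_diff_Icc (hB : IsPicardSequence β a f B) (T : ℝ) (n : ℕ) (i : Fin 3) :
    SmoothField 0 (Icc 0 T) (picardDiff B n i) :=
  (hB.smooth_diff n i).mono Icc_subset_Ici_self

theorem solves_diff (hB : IsPicardSequence β a f B) (p : ℕ) (T : ℝ) :
    SolvesWithFlux β T (picardDiff B (p + 1)) (fun i j t x =>
      linearFlux (truncatedCoeff (p + 1) a) (B (p + 1)) i j t x
        - linearFlux (truncatedCoeff p a) (B p) i j t x) :=
  (hB.solves (p + 1) T).sub (hB.solves p T)

theorem ballCutoff_two_pow_eq_one {p q : ℕ} (hpq : p ≤ q) {x : Vec3 ℝ} (hx : ‖x‖ < 2 ^ p) :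
    ballCutoff (2 ^ q) x = 1 :=
  ballCutoff_eq_one (by positivity)
    (hx.le.trans (pow_le_pow_right₀ one_le_two hpq))

/-- Inside the ball of radius `2ᵖ` the truncations are invisible. -/
theorem fluxEnergy_diff (k p : ℕ) (hsupp : ∀ x, φ x ≠ 0 → ‖x‖ < 2 ^ p) (t : ℝ) :
    fluxEnergy k φ (fun i j x => linearFlux (truncatedCoeff (p + 1) a) (B (p + 1)) i j t x
        - linearFlux (truncatedCoeff p a) (B p) i j t x)
      = fluxEnergy k φ (fun i j => linearFlux a (picardDiff B p) i j t) := by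
  refine Finset.sum_congr rfl fun i _ => Finset.sum_congr rfl fun j _ =>
    cutoffIntegral_congr fun x hx => sqJet_congr k ?_
  filter_upwards [(isOpen_lt continuous_norm continuous_const).mem_nhds (hsupp x hx)] with y hy
  simp only [linearFlux, truncatedCoeff, picardDiff, ← Finset.sum_sub_distrib,
    ballCutoff_two_pow_eq_one le_rfl hy, ballCutoff_two_pow_eq_one (Nat.le_succ p) hy]
  exact Finset.sum_congr rfl fun k _ => by ring

theorem jetEnergy_diff_zero (hB : IsPicardSequence β a f B) (k p : ℕ)
    (hsupp : ∀ x, φ x ≠ 0 → ‖x‖ < 2 ^ p) :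
    jetEnergy k φ (fun i => picardDiff B (p + 1) i 0) = 0 := by
  refine Finset.sum_eq_zero fun i _ => ?_
  have : cutoffIntegral φ (sqJet k (picardDiff B (p + 1) i 0))
      = cutoffIntegral φ (sqJet k fun _ => 0) := by
    refine cutoffIntegral_congr fun x hx => sqJet_congr k ?_
    filter_upwards [(isOpen_lt continuous_norm continuous_const).mem_nhds (hsupp x hx)] with y hy
    simp only [picardDiff, hB.initial, ballCutoff_two_pow_eq_one le_rfl hy,
      ballCutoff_two_pow_eq_one (Nat.le_succ p) hy, sub_self]
  rw [this]
  simp [cutoffIntegral, sqJet_zero_fun]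

theorem energy_diff (hB : IsPicardSequence β a f B) (hβ : 0 < β) (k p : ℕ) (hφ : ContDiff ℝ ∞ φ)
    (hc : HasCompactSupport φ) (hsupp : ∀ x, φ x ≠ 0 → ‖x‖ < 2 ^ p) {t : ℝ} (ht : t ∈ Icc 0 T) :
    jetEnergy k φ (fun i => picardDiff B (p + 1) i t)
        + β * ∫ s in (0 : ℝ)..t, jetDissipation k φ (fun i => picardDiff B (p + 1) i s)
      ≤ energyConst β * ∫ s in (0 : ℝ)..t,
        (∑ l, jetEnergy k (partialDeriv l φ) (fun i => picardDiff B (p + 1) i s)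
          + fluxEnergy k φ (fun i j => linearFlux a (picardDiff B p) i j s)) := by
  have h := (hB.solves_diff p T).energy hβ k hφ hc ht
  rw [hB.jetEnergy_diff_zero k p hsupp, zero_add] at h
  simpa only [fluxEnergy_diff k p hsupp] using h

/-- On a fixed ball, consecutive differences decay geometrically in `L²`: the recursion gains a
factor one half in a norm with exponential weight in time, and the cutoff at radius `2ᵐ` costs
`4⁻ᵐ`; the choice `m ≈ n / 2` balances the two. -/
theorem exists_jetEnergy_zero_le (hB : IsPicardSequence β a f B) (hβ : 0 < β) (hA0 : 0 < A)
    (ha : ∀ i j k, SmoothField 0 (Ici 0) (a i j k))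
    (hA : ∀ i j k, ∀ t, 0 ≤ t → ∀ x, |a i j k t x| ≤ A) (hM : ∀ n, L2BoundedOn T M (B n))
    (hM0 : 0 ≤ M) (hφ : Continuous φ) (hc : HasCompactSupport φ) :
    ∃ M' N, 0 ≤ M' ∧ ∀ n, N ≤ n → ∀ t ∈ Icc 0 T,
      jetEnergy 0 φ (fun i => picardDiff B n i t) ≤ M' * (3 / 4) ^ n := by
  rcases lt_or_ge T 0 with hT | hT
  · exact ⟨0, 0, le_rfl, fun n _ t ht => absurd (ht.1.trans ht.2) (not_le.2 hT)⟩
  obtain ⟨c, hc0, hen⟩ := exists_energy_ballCutoff hβ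
  have hC := energyConst_pos hβ
  set K := growthRate β A with hK
  have hK0 : 0 < K := by rw [hK, growthRate]; positivity
  set M₁ := 2 * (M + M) with hM₁
  have hM₁0 : 0 ≤ M₁ := by positivity
  have hD : ∀ n, L2BoundedOn T M₁ (picardDiff B n) := fun n =>
    (hM (n + 1)).sub (hM n) (fun i => (hB.smooth _ i).mono Icc_subset_Ici_self)
      (fun i => (hB.smooth _ i).mono Icc_subset_Ici_self)
  set D := max M₁ (c * M₁ * T) with hDdef
  have hD0 : 0 ≤ D := le_max_of_le_left hM₁0
  -- the recursion on the ball of radius `2 ^ m`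
  have hrec : ∀ m p, m + 1 ≤ p → ∀ t ∈ Icc 0 T,
      jetEnergy 0 (ballCutoff (2 ^ m)) (fun i => picardDiff B (p + 1) i t)
        ≤ K * (∫ s in (0 : ℝ)..t, jetEnergy 0 (ballCutoff (2 ^ m)) (fun i => picardDiff B p i s))
          + D * (1 / 4) ^ m := by
    intro m p hmp t ht
    have hR : (0 : ℝ) < 2 ^ m := by positivity
    have hφR := (ballCutoff_contDiff (2 ^ m)).continuous
    have hcR := ballCutoff_hasCompactSupport hR
    have hsupp : ∀ x, ballCutoff (2 ^ m) x ≠ 0 → ‖x‖ < 2 ^ p := by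
      intro x hx
      by_contra hge
      refine hx (ballCutoff_eq_zero hR (le_trans ?_ (not_lt.1 hge)))
      rw [← pow_succ']
      exact pow_le_pow_right₀ one_le_two hmp
    have h1 := hen T M₁ _ _ (hB.solves_diff p T) (hD (p + 1)) (2 ^ m) hR t ht
    rw [hB.jetEnergy_diff_zero 0 p hsupp, zero_add] at h1
    simp only [fluxEnergy_diff 0 p hsupp] at h1
    have h2 : 0 ≤ β * ∫ s in (0 : ℝ)..t,
        jetDissipation 0 (ballCutoff (2 ^ m)) (fun i => picardDiff B (p + 1) i s) :=
      mul_nonneg hβ.le (intervalIntegral.integral_nonneg ht.1 fun r _ =>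
        jetDissipation_nonneg _ _ _)
    have h3 : ∫ s in (0 : ℝ)..t, fluxEnergy 0 (ballCutoff (2 ^ m))
          (fun i j => linearFlux a (picardDiff B p) i j s)
        ≤ ∫ s in (0 : ℝ)..t, 27 * A ^ 2 *
          jetEnergy 0 (ballCutoff (2 ^ m)) (fun i => picardDiff B p i s) := by
      refine intervalIntegral.integral_mono_on ht.1
        ((continuousOn_fluxEnergy (fun i j => smooth_linearFlux (by simp)
          (fun i j k => (ha i j k).mono Icc_subset_Ici_self) (hB.smooth_diff_Icc T p) i j) 0 hφR
          hcR).intervalIntegrable_zero ht)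
        ((continuousOn_const.mul (continuousOn_jetEnergy (hB.smooth_diff_Icc T p) 0 hφR
          hcR)).intervalIntegrable_zero ht) fun r hr => ?_
      exact fluxEnergy_linearFlux_le (mem_Ici.2 hr.1) ha (hB.smooth_diff p)
        (fun i j k x => hA i j k r hr.1 x) hφR hcR
    rw [intervalIntegral.integral_const_mul] at h3
    have h4 := mul_le_mul_of_nonneg_left h3 hC.le
    have h5 : c * M₁ * T / (2 ^ m) ^ 2 ≤ D * (1 / 4) ^ m := by
      have : ((2 : ℝ) ^ m) ^ 2 = 4 ^ m := by rw [← pow_mul, mul_comm, pow_mul]; norm_num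
      rw [this, one_div_pow, mul_one_div]
      gcongr
      exact le_max_right _ _
    rw [hK, growthRate, mul_assoc]
    linarith
  -- the weighted estimate along the recursion
  have hchain : ∀ m q, ∀ t ∈ Icc 0 T,
      jetEnergy 0 (ballCutoff (2 ^ m)) (fun i => picardDiff B (m + 1 + q) i t)
        ≤ (2 * D * (1 / 4) ^ m + D * (1 / 2) ^ q) * Real.exp (2 * K * t) := by
    intro m q
    have hR : (0 : ℝ) < 2 ^ m := by positivity
    have hφR := (ballCutoff_contDiff (2 ^ m)).continuous
    have hcR := ballCutoff_hasCompactSupport hR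
    induction q with
    | zero =>
      intro t ht
      have h1 := hD (m + 1) t ht _ hφR hcR (ballCutoff_sq_le_one _)
      have h2 : (1 : ℝ) ≤ Real.exp (2 * K * t) :=
        Real.one_le_exp (mul_nonneg (by positivity) ht.1)
      have h3 : M₁ ≤ D := le_max_left _ _
      rw [pow_zero, mul_one, add_zero]
      refine h1.trans (h3.trans ?_)
      refine le_trans ?_ (le_mul_of_one_le_right (by positivity) h2)
      have : 0 ≤ 2 * D * (1 / 4) ^ m := by positivity
      linarith
    | succ q ih =>
      intro t ht
      have h1 := integral_le_of_le_exp (by positivity : 0 < 2 * K) (by positivity)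
        (continuousOn_jetEnergy (hB.smooth_diff_Icc T (m + 1 + q)) 0 hφR hcR) ih ht
      have h2 := hrec m (m + 1 + q) (by omega) t ht
      have h3 : (1 : ℝ) ≤ Real.exp (2 * K * t) :=
        Real.one_le_exp (mul_nonneg (by positivity) ht.1)
      have h4 : K * ((2 * D * (1 / 4) ^ m + D * (1 / 2) ^ q) / (2 * K) * Real.exp (2 * K * t))
          = (D * (1 / 4) ^ m + D * (1 / 2) ^ (q + 1)) * Real.exp (2 * K * t) := by
        rw [pow_succ]; field_simp
      have h5 := mul_le_mul_of_nonneg_left h1 hK0.le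
      have h6 : D * (1 / 4) ^ m ≤ D * (1 / 4) ^ m * Real.exp (2 * K * t) :=
        le_mul_of_one_le_right (by positivity) h3
      rw [h4] at h5
      have h7 : m + 1 + (q + 1) = m + 1 + q + 1 := by ring
      rw [h7]
      refine h2.trans ((add_le_add h5 h6).trans (le_of_eq ?_))
      ring
  -- the given cutoff is dominated by that of a large ball
  obtain ⟨b, hb⟩ := hc.exists_bound_of_continuous hφ
  obtain ⟨R₀, hR₀⟩ := hc.isCompact.isBounded.subset_closedBall 0
  obtain ⟨m₀, hm₀⟩ := pow_unbounded_of_one_lt R₀ (one_lt_two (α := ℝ))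
  -- for `m = n / 2` both error terms are `O(2 ^ (-n / 2))`, which is below `(3 / 4) ^ n`
  refine ⟨b ^ 2 * (6 * D * Real.exp (2 * K * T)), 2 * m₀ + 2, by positivity, fun n hn t ht => ?_⟩
  obtain ⟨m, q, rfl, hm, hq, hq'⟩ : ∃ m q, n = m + 1 + q ∧ m₀ ≤ m ∧ m ≤ q + 1 ∧ q ≤ m := by
    refine ⟨n / 2, n - (n / 2 + 1), by omega, by omega, by omega, by omega⟩
  have hR : (0 : ℝ) < 2 ^ m := by positivity
  have h1 : jetEnergy 0 φ (fun i => picardDiff B (m + 1 + q) i t)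
      ≤ b ^ 2 * jetEnergy 0 (ballCutoff (2 ^ m)) (fun i => picardDiff B (m + 1 + q) i t) := by
    refine jetEnergy_mono_cutoff hφ hc (ballCutoff_contDiff _).continuous
      (ballCutoff_hasCompactSupport hR) (fun i => (hB.smooth_diff _ i).contDiff t ht.1) fun x => ?_
    by_cases hx : x ∈ tsupport φ
    · have : ‖x‖ ≤ 2 ^ m := ((mem_closedBall_zero_iff.1 (hR₀ hx)).trans hm₀.le).trans
        (pow_le_pow_right₀ one_le_two hm)
      rw [ballCutoff_eq_one hR this, one_pow, mul_one]
      exact sq_le_sq' (neg_le_of_abs_le (hb x)) (le_of_abs_le (hb x))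
    · rw [image_eq_zero_of_notMem_tsupport hx, zero_pow two_ne_zero]
      positivity
  have h2 : (1 / 4 : ℝ) ^ m ≤ (1 / 2) ^ q := by
    calc (1 / 4 : ℝ) ^ m ≤ (1 / 2) ^ m := by gcongr; norm_num
      _ ≤ (1 / 2) ^ q := pow_le_pow_of_le_one (by norm_num) (by norm_num) hq'
  have h3 : (1 / 2 : ℝ) ^ q ≤ 2 * (3 / 4) ^ (m + 1 + q) := by
    have e1 : (3 / 4 : ℝ) ^ (2 * q + 2) ≤ (3 / 4) ^ (m + 1 + q) :=
      pow_le_pow_of_le_one (by norm_num) (by norm_num) (by omega)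
    have e2 : (3 / 4 : ℝ) ^ (2 * q + 2) = 9 / 16 * (9 / 16) ^ q := by
      rw [pow_add, pow_mul]; norm_num [mul_comm]
    have e3 : (1 / 2 : ℝ) ^ q ≤ (9 / 16) ^ q :=
      pow_le_pow_left₀ (by norm_num) (by norm_num) q
    have e4 : (0 : ℝ) ≤ (9 / 16) ^ q := by positivity
    linarith
  have h4 : Real.exp (2 * K * t) ≤ Real.exp (2 * K * T) :=
    Real.exp_le_exp.2 (mul_le_mul_of_nonneg_left ht.2 (by positivity))
  calc _ ≤ b ^ 2 * ((2 * D * (1 / 4) ^ m + D * (1 / 2) ^ q) * Real.exp (2 * K * t)) :=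
        h1.trans (mul_le_mul_of_nonneg_left (hchain m q t ht) (sq_nonneg _))
    _ ≤ b ^ 2 * ((2 * D * (1 / 2) ^ q + D * (1 / 2) ^ q) * Real.exp (2 * K * T)) := by gcongr
    _ = b ^ 2 * (3 * D * Real.exp (2 * K * T)) * (1 / 2) ^ q := by ring
    _ ≤ b ^ 2 * (3 * D * Real.exp (2 * K * T)) * (2 * (3 / 4) ^ (m + 1 + q)) := by gcongr
    _ = _ := by ring

/-- On a fixed compact set, consecutive differences decay geometrically on jets of every order. The
dissipation at order `k` controls the cutoff error at order `k + 1`. -/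
theorem exists_jetEnergy_le (hB : IsPicardSequence β a f B) (hβ : 0 < β) (hA0 : 0 < A)
    (ha : ∀ i j k, SmoothField 0 (Ici 0) (a i j k))
    (hA : ∀ i j k, ∀ t, 0 ≤ t → ∀ x, |a i j k t x| ≤ A) (hM : ∀ n, L2BoundedOn T M (B n))
    (hM0 : 0 ≤ M) (k : ℕ) : ∀ φ : Vec3 ℝ → ℝ, ContDiff ℝ ∞ φ → HasCompactSupport φ →
    ∃ M' N, 0 ≤ M' ∧ ∀ n, N ≤ n → ∀ t ∈ Icc 0 T,
      jetEnergy k φ (fun i => picardDiff B n i t) ≤ M' * (3 / 4) ^ n := by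
  rcases lt_or_ge T 0 with hT | hT
  · exact fun _ _ _ => ⟨0, 0, le_rfl, fun n _ t ht => absurd (ht.1.trans ht.2) (not_le.2 hT)⟩
  have hC := energyConst_pos hβ
  have haT : ∀ i j k, SmoothField 0 (Icc 0 T) (a i j k) := fun i j k =>
    (ha i j k).mono Icc_subset_Ici_self
  have hzero : ∀ φ : Vec3 ℝ → ℝ, ContDiff ℝ ∞ φ → HasCompactSupport φ →
      ∃ M' N, 0 ≤ M' ∧ ∀ n, N ≤ n → ∀ t ∈ Icc 0 T,
        jetEnergy 0 φ (fun i => picardDiff B n i t) ≤ M' * (3 / 4) ^ n := fun φ hφ hc =>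
    hB.exists_jetEnergy_zero_le hβ hA0 ha hA hM hM0 hφ.continuous hc
  have hsupp : ∀ φ : Vec3 ℝ → ℝ, HasCompactSupport φ →
      ∃ N : ℕ, ∀ p, N ≤ p → ∀ x, φ x ≠ 0 → ‖x‖ < 2 ^ p := by
    intro φ hc
    obtain ⟨R₀, hR₀⟩ := hc.isCompact.isBounded.subset_closedBall 0
    obtain ⟨m₀, hm₀⟩ := pow_unbounded_of_one_lt R₀ (one_lt_two (α := ℝ))
    exact ⟨m₀, fun p hp x hx => ((mem_closedBall_zero_iff.1
      (hR₀ (subset_tsupport _ hx))).trans_lt hm₀).trans_le (pow_le_pow_right₀ one_le_two hp)⟩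
  have hflux : ∀ p i j, SmoothField 0 (Icc 0 T) (linearFlux a (picardDiff B p) i j) :=
    fun p => smooth_linearFlux (by simp) haT (hB.smooth_diff_Icc T p)
  induction k with
  | zero => exact hzero
  | succ k ih =>
    -- the time integral of the dissipation of order `k` decays geometrically
    have hdiss : ∀ φ : Vec3 ℝ → ℝ, ContDiff ℝ ∞ φ → HasCompactSupport φ →
        ∃ M' N, 0 ≤ M' ∧ ∀ p, N ≤ p → ∀ t ∈ Icc 0 T,
          ∫ s in (0 : ℝ)..t, jetDissipation k φ (fun i => picardDiff B (p + 1) i s)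
            ≤ M' * (3 / 4) ^ p := by
      intro φ hφ hc
      obtain ⟨N₀, hN₀⟩ := hsupp φ hc
      obtain ⟨M₁, N₁, hM₁, h₁⟩ := ih φ hφ hc
      choose M₂ N₂ hM₂ h₂ using fun l => ih (partialDeriv l φ) (hφ.partialDeriv l)
        (hc.partialDeriv l)
      obtain ⟨C, hC0, hfl⟩ := exists_fluxEnergy_linearFlux_le haT k hφ.continuous hc
      have hS : 0 ≤ ∑ l, M₂ l := Finset.sum_nonneg fun l _ => hM₂ l
      refine ⟨energyConst β * (T * (∑ l, M₂ l + C * M₁)) / β, N₀ + N₁ + ∑ l, N₂ l,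
        by positivity, fun p hp t ht => ?_⟩
      have hN₂ : ∀ l, N₂ l ≤ p + 1 := fun l =>
        (Finset.single_le_sum (fun l _ => Nat.zero_le _) (Finset.mem_univ l)).trans
          (by omega : ∑ l, N₂ l ≤ p + 1)
      have h := hB.energy_diff hβ k p hφ hc (hN₀ p (by omega)) ht
      have hle : ∫ s in (0 : ℝ)..t,
          (∑ l, jetEnergy k (partialDeriv l φ) (fun i => picardDiff B (p + 1) i s)
            + fluxEnergy k φ (fun i j => linearFlux a (picardDiff B p) i j s))
          ≤ ∫ _s in (0 : ℝ)..t, (∑ l, M₂ l + C * M₁) * (3 / 4) ^ p := by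
        refine intervalIntegral.integral_mono_on ht.1 ?_ intervalIntegrable_const fun s hs => ?_
        · exact ((continuousOn_finsetSum _ fun l _ =>
            continuousOn_jetEnergy (hB.smooth_diff_Icc T (p + 1)) k (hφ.partialDeriv l).continuous
              (hc.partialDeriv l)).add (continuousOn_fluxEnergy (hflux p) k hφ.continuous
                hc)).intervalIntegrable_zero ht
        · have hs' : s ∈ Icc 0 T := ⟨hs.1, hs.2.trans ht.2⟩
          rw [add_mul, Finset.sum_mul, mul_assoc C]
          refine add_le_add (Finset.sum_le_sum fun l _ => ?_) ?_
          · refine (h₂ l (p + 1) (hN₂ l) s hs').trans ?_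
            exact mul_le_mul_of_nonneg_left (pow_le_pow_of_le_one (by norm_num) (by norm_num)
              (Nat.le_succ p)) (hM₂ l)
          · exact (hfl _ s hs' fun i => (hB.smooth_diff_Icc T p i).contDiff s hs').trans
              (mul_le_mul_of_nonneg_left (h₁ p (by omega) s hs') hC0)
      rw [intervalIntegral.integral_const, sub_zero, smul_eq_mul] at hle
      have h3 : t * ((∑ l, M₂ l + C * M₁) * (3 / 4) ^ p)
          ≤ T * ((∑ l, M₂ l + C * M₁) * (3 / 4) ^ p) :=
        mul_le_mul_of_nonneg_right ht.2 (by positivity)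
      have h4 := mul_le_mul_of_nonneg_left (hle.trans h3) hC.le
      have h5 := jetEnergy_nonneg k φ (fun i => picardDiff B (p + 1) i t)
      rw [div_mul_eq_mul_div, le_div_iff₀ hβ]
      linarith
    intro φ hφ hc
    obtain ⟨N₀, hN₀⟩ := hsupp φ hc
    choose M₁ N₁ hM₁ h₁ using fun l => hzero (partialDeriv l φ) (hφ.partialDeriv l)
      (hc.partialDeriv l)
    choose M₂ N₂ hM₂ h₂ using fun l => hdiss (partialDeriv l φ) (hφ.partialDeriv l)
      (hc.partialDeriv l)
    obtain ⟨C, hC0, hfl⟩ := exists_fluxEnergy_linearFlux_le haT (k + 1) hφ.continuous hc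
    have hS₁ : 0 ≤ ∑ l, M₁ l := Finset.sum_nonneg fun l _ => hM₁ l
    have hS₂ : 0 ≤ ∑ l, M₂ l := Finset.sum_nonneg fun l _ => hM₂ l
    suffices hrec : ∀ p, N₀ + ∑ l, N₁ l + ∑ l, N₂ l ≤ p → ∀ t ∈ Icc 0 T,
        jetEnergy (k + 1) φ (fun i => picardDiff B (p + 1) i t)
          ≤ energyConst β * (C + 1) * (∫ s in (0 : ℝ)..t,
            jetEnergy (k + 1) φ (fun i => picardDiff B p i s))
            + energyConst β * (T * ∑ l, M₁ l + ∑ l, M₂ l) * (3 / 4) ^ p by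
      obtain ⟨M', hM', h'⟩ := exists_geometric_bound
        (e := fun n t => jetEnergy (k + 1) φ (fun i => picardDiff B n i t)) (by positivity)
        (by positivity) (by norm_num) (fun n _ => continuousOn_jetEnergy (hB.smooth_diff_Icc T n)
          (k + 1) hφ.continuous hc) hrec
      exact ⟨M', _, hM', h'⟩
    intro p hp t ht
    have hN₁ : ∀ l, N₁ l ≤ p + 1 := fun l =>
      (Finset.single_le_sum (fun l _ => Nat.zero_le _) (Finset.mem_univ l)).trans
        (by omega : ∑ l, N₁ l ≤ p + 1)
    have hN₂ : ∀ l, N₂ l ≤ p := fun l =>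
      (Finset.single_le_sum (fun l _ => Nat.zero_le _) (Finset.mem_univ l)).trans
        (by omega : ∑ l, N₂ l ≤ p)
    have h := hB.energy_diff hβ (k + 1) p hφ hc (hN₀ p (by omega)) ht
    have hcE : ∀ l, ContinuousOn (fun s => jetEnergy 0 (partialDeriv l φ)
        (fun i => picardDiff B (p + 1) i s)) (Icc 0 T) := fun l =>
      continuousOn_jetEnergy (hB.smooth_diff_Icc T (p + 1)) 0 (hφ.partialDeriv l).continuous
        (hc.partialDeriv l)
    have hcD : ∀ l, ContinuousOn (fun s => jetDissipation k (partialDeriv l φ)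
        (fun i => picardDiff B (p + 1) i s)) (Icc 0 T) := fun l =>
      continuousOn_jetDissipation (hB.smooth_diff_Icc T (p + 1)) k (hφ.partialDeriv l).continuous
        (hc.partialDeriv l)
    have hcF := continuousOn_fluxEnergy (hflux p) (k + 1) hφ.continuous hc
    have hsplit : ∫ s in (0 : ℝ)..t,
        (∑ l, jetEnergy (k + 1) (partialDeriv l φ) (fun i => picardDiff B (p + 1) i s)
          + fluxEnergy (k + 1) φ (fun i j => linearFlux a (picardDiff B p) i j s))
        = (∑ l, ∫ s in (0 : ℝ)..t, jetEnergy 0 (partialDeriv l φ)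
            (fun i => picardDiff B (p + 1) i s))
          + (∑ l, ∫ s in (0 : ℝ)..t, jetDissipation k (partialDeriv l φ)
            (fun i => picardDiff B (p + 1) i s))
          + ∫ s in (0 : ℝ)..t, fluxEnergy (k + 1) φ
            (fun i j => linearFlux a (picardDiff B p) i j s) := by
      rw [← intervalIntegral.integral_finsetSum fun l _ => (hcE l).intervalIntegrable_zero ht,
        ← intervalIntegral.integral_finsetSum fun l _ => (hcD l).intervalIntegrable_zero ht,
        ← intervalIntegral.integral_add
          ((continuousOn_finsetSum _ fun l _ => hcE l).intervalIntegrable_zero ht)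
          ((continuousOn_finsetSum _ fun l _ => hcD l).intervalIntegrable_zero ht),
        ← intervalIntegral.integral_add
          (f := fun s => (∑ l, jetEnergy 0 (partialDeriv l φ) fun i => picardDiff B (p + 1) i s)
            + ∑ l, jetDissipation k (partialDeriv l φ) fun i => picardDiff B (p + 1) i s)
          (((continuousOn_finsetSum _ fun l _ => hcE l).add
            (continuousOn_finsetSum _ fun l _ => hcD l)).intervalIntegrable_zero ht)
          (hcF.intervalIntegrable_zero ht)]
      refine intervalIntegral.integral_congr fun s hs => ?_
      rw [uIcc_of_le ht.1] at hs
      have hs' : s ∈ Icc 0 T := ⟨hs.1, hs.2.trans ht.2⟩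
      rw [← Finset.sum_add_distrib]
      congr 1
      exact Finset.sum_congr rfl fun l _ => jetEnergy_succ (hφ.partialDeriv l).continuous
        (hc.partialDeriv l) fun i => (hB.smooth_diff_Icc T (p + 1) i).contDiff s hs'
    rw [hsplit] at h
    have e1 : ∑ l, ∫ s in (0 : ℝ)..t, jetEnergy 0 (partialDeriv l φ)
        (fun i => picardDiff B (p + 1) i s) ≤ T * (∑ l, M₁ l) * (3 / 4) ^ p := by
      rw [Finset.mul_sum, Finset.sum_mul]
      refine Finset.sum_le_sum fun l _ => ?_
      have : ∫ s in (0 : ℝ)..t, jetEnergy 0 (partialDeriv l φ) (fun i => picardDiff B (p + 1) i s)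
          ≤ ∫ _s in (0 : ℝ)..t, M₁ l * (3 / 4) ^ p := by
        refine intervalIntegral.integral_mono_on ht.1 ((hcE l).intervalIntegrable_zero ht)
          intervalIntegrable_const fun s hs => ?_
        refine (h₁ l (p + 1) (hN₁ l) s ⟨hs.1, hs.2.trans ht.2⟩).trans ?_
        exact mul_le_mul_of_nonneg_left (pow_le_pow_of_le_one (by norm_num) (by norm_num)
          (Nat.le_succ p)) (hM₁ l)
      rw [intervalIntegral.integral_const, sub_zero, smul_eq_mul] at this
      refine this.trans ?_
      rw [mul_assoc]
      exact mul_le_mul_of_nonneg_right ht.2 (mul_nonneg (hM₁ l) (by positivity))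
    have e2 : ∑ l, ∫ s in (0 : ℝ)..t, jetDissipation k (partialDeriv l φ)
        (fun i => picardDiff B (p + 1) i s) ≤ (∑ l, M₂ l) * (3 / 4) ^ p := by
      rw [Finset.sum_mul]
      exact Finset.sum_le_sum fun l _ => h₂ l p (hN₂ l) t ht
    have e3 : ∫ s in (0 : ℝ)..t, fluxEnergy (k + 1) φ
        (fun i j => linearFlux a (picardDiff B p) i j s)
        ≤ (C + 1) * ∫ s in (0 : ℝ)..t, jetEnergy (k + 1) φ (fun i => picardDiff B p i s) := by
      have hcJ := continuousOn_jetEnergy (hB.smooth_diff_Icc T p) (k + 1) hφ.continuous hc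
      rw [← intervalIntegral.integral_const_mul]
      refine intervalIntegral.integral_mono_on ht.1 (hcF.intervalIntegrable_zero ht)
        ((continuousOn_const.mul hcJ).intervalIntegrable_zero ht) fun s hs => ?_
      have hs' : s ∈ Icc 0 T := ⟨hs.1, hs.2.trans ht.2⟩
      refine (hfl _ s hs' fun i => (hB.smooth_diff_Icc T p i).contDiff s hs').trans ?_
      exact mul_le_mul_of_nonneg_right (by linarith) (jetEnergy_nonneg _ _ _)
    have e4 : 0 ≤ β * ∫ s in (0 : ℝ)..t,
        jetDissipation (k + 1) φ (fun i => picardDiff B (p + 1) i s) :=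
      mul_nonneg hβ.le (intervalIntegral.integral_nonneg ht.1 fun r _ =>
        jetDissipation_nonneg _ _ _)
    have e5 := mul_le_mul_of_nonneg_left (add_le_add (add_le_add e1 e2) e3) hC.le
    linarith

end IsPicardSequence

/-! ### Limits of sequences of fields -/

theorem tendstoUniformlyOn_of_le_geometric {X : Type} {s : ℕ → X → ℝ} {C q : ℝ} (hq0 : 0 ≤ q)
    (hq1 : q < 1) {N : ℕ} {S : Set X}
    (h : ∀ n, N ≤ n → ∀ x ∈ S, |s (n + 1) x - s n x| ≤ C * q ^ n) {U : X → ℝ}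
    (hU : ∀ x ∈ S, Tendsto (fun n => s n x) atTop (𝓝 (U x))) :
    TendstoUniformlyOn s U atTop S := by
  have hlim : Tendsto (fun n : ℕ => C * q ^ N * q ^ n / (1 - q)) atTop (𝓝 0) := by
    have := ((tendsto_pow_atTop_nhds_zero_of_lt_one hq0 hq1).const_mul
      (C * q ^ N)).div_const (1 - q)
    simpa using this
  have hshift : TendstoUniformlyOn (fun n => s (n + N)) U atTop S := by
    refine Metric.tendstoUniformlyOn_iff.2 fun ε hε => ?_
    filter_upwards [hlim.eventually (gt_mem_nhds hε)] with n hn x hx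
    rw [dist_comm]
    refine (dist_le_of_le_geometric_of_tendsto (f := fun n => s (n + N) x) q (C * q ^ N) hq1
      (fun k => ?_) ((tendsto_add_atTop_iff_nat N).2 (hU x hx)) n).trans_lt hn
    rw [dist_comm, Real.dist_eq]
    have := h (k + N) (Nat.le_add_left _ _) x hx
    rw [pow_add] at this
    have e : k + N + 1 = k + 1 + N := by omega
    rw [e] at this
    linarith
  intro V hV
  obtain ⟨m, hm⟩ := eventually_atTop.1 (hshift V hV)
  filter_upwards [eventually_ge_atTop (m + N)] with n hn x hx
  have := hm (n - N) (by omega) x hx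
  simpa only [Nat.sub_add_cancel (show N ≤ n by omega)] using this

theorem exists_tendsto_of_le_geometric {s : ℕ → ℝ} {C q : ℝ} (hq1 : q < 1) {N : ℕ}
    (h : ∀ n, N ≤ n → |s (n + 1) - s n| ≤ C * q ^ n) : ∃ a, Tendsto s atTop (𝓝 a) := by
  have hc : CauchySeq fun n => s (n + N) := by
    refine cauchySeq_of_le_geometric q (C * q ^ N) hq1 fun k => ?_
    rw [dist_comm, Real.dist_eq]
    have := h (k + N) (Nat.le_add_left _ _)
    rw [pow_add] at this
    have e : k + N + 1 = k + 1 + N := by omega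
    rw [e] at this
    linarith
  obtain ⟨a, ha⟩ := cauchySeq_tendsto_of_complete hc
  exact ⟨a, (tendsto_add_atTop_iff_nat N).1 ha⟩

/-- If all spatial derivatives of a sequence of fields form geometrically convergent series,
locally uniformly in space and time, then the limit is smooth in space and the derivatives
converge to those of the limit. -/
theorem exists_smoothField_limit {w : ℕ → ℝ → Vec3 ℝ → ℝ}
    (hw : ∀ n, SmoothField 0 (Ici 0) (w n)) {q : ℝ} (hq0 : 0 ≤ q) (hq1 : q < 1)
    (h : ∀ γ T r, ∃ C N, ∀ n, N ≤ n → ∀ t ∈ Icc 0 T, ∀ x, ‖x‖ ≤ r →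
      |iterPartial γ (w (n + 1) t) x - iterPartial γ (w n t) x| ≤ C * q ^ n) :
    ∃ u, SmoothField 0 (Ici 0) u ∧ ∀ γ, TendstoLocallyUniformlyOn
      (fun n (p : ℝ × Vec3 ℝ) => iterPartial γ (w n p.1) p.2)
      (fun p => iterPartial γ (u p.1) p.2) atTop (Ici 0 ×ˢ univ) := by
  have hex : ∀ γ (p : ℝ × Vec3 ℝ), ∃ a, 0 ≤ p.1 →
      Tendsto (fun n => iterPartial γ (w n p.1) p.2) atTop (𝓝 a) := by
    intro γ p
    by_cases hp : 0 ≤ p.1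
    · obtain ⟨C, N, hC⟩ := h γ p.1 ‖p.2‖
      obtain ⟨a, ha⟩ := exists_tendsto_of_le_geometric hq1
        (s := fun n => iterPartial γ (w n p.1) p.2)
        (fun n hn => hC n hn p.1 ⟨hp, le_rfl⟩ p.2 le_rfl)
      exact ⟨a, fun _ => ha⟩
    · exact ⟨0, fun h => absurd h hp⟩
  choose U hU using hex
  have hunif : ∀ γ, TendstoLocallyUniformlyOn
      (fun n (p : ℝ × Vec3 ℝ) => iterPartial γ (w n p.1) p.2) (U γ) atTop (Ici 0 ×ˢ univ) := by
    refine fun γ => tendstoLocallyUniformlyOn_of_forall_exists_nhds fun p hp => ?_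
    have hp1 : (0 : ℝ) ≤ p.1 := hp.1
    refine ⟨Icc 0 (p.1 + 1) ×ˢ Metric.closedBall 0 (‖p.2‖ + 1), ?_, ?_⟩
    · rw [← Prod.mk.eta (p := p), nhdsWithin_prod_eq, nhdsWithin_univ]
      refine prod_mem_prod ?_ (Metric.isOpen_ball.mem_nhds ?_ |> (mem_of_superset ·
        Metric.ball_subset_closedBall))
      · exact inter_mem_nhdsWithin _ (Iic_mem_nhds (by linarith))
      · simp
    · obtain ⟨C, N, hC⟩ := h γ (p.1 + 1) (‖p.2‖ + 1)
      exact tendstoUniformlyOn_of_le_geometric hq0 hq1 (C := C) (N := N)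
        (fun n hn y hy => hC n hn y.1 hy.1 y.2 (mem_closedBall_zero_iff.1 hy.2))
        fun y hy => hU γ y hy.1.1
  have hder : ∀ γ, ∀ t, 0 ≤ t → ∀ x, HasFDerivAt (fun y => U γ (t, y))
      (∑ i, U (γ ++ [i]) (t, x) • EuclideanSpace.proj (𝕜 := ℝ) i) x := by
    intro γ t ht x
    have hslice : ∀ γ, TendstoLocallyUniformlyOn (fun n y => iterPartial γ (w n t) y)
        (fun y => U γ (t, y)) atTop univ := fun γ =>
      (hunif γ).comp (fun y => (t, y)) (fun y _ => ⟨ht, mem_univ _⟩) (by fun_prop)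
    have hsum : TendstoLocallyUniformlyOn
        (fun n y => ∑ i, iterPartial (γ ++ [i]) (w n t) y • EuclideanSpace.proj (𝕜 := ℝ) i)
        (fun y => ∑ i, U (γ ++ [i]) (t, y) •
          (EuclideanSpace.proj (𝕜 := ℝ) i : Vec3 ℝ →L[ℝ] ℝ)) atTop univ := by
      have : ∀ i : Fin 3, TendstoLocallyUniformlyOn
        (fun n y => iterPartial (γ ++ [i]) (w n t) y • EuclideanSpace.proj (𝕜 := ℝ) i)
        (fun y => U (γ ++ [i]) (t, y) •
          (EuclideanSpace.proj (𝕜 := ℝ) i : Vec3 ℝ →L[ℝ] ℝ)) atTop univ := fun i =>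
        UniformContinuous.comp_tendstoLocallyUniformlyOn
          (g := fun r : ℝ => r • (EuclideanSpace.proj (𝕜 := ℝ) i : Vec3 ℝ →L[ℝ] ℝ))
          ((ContinuousLinearMap.toSpanSingleton ℝ _).uniformContinuous) (hslice _)
      simp only [Fin.sum_univ_three]
      exact ((this 0).add (this 1)).add (this 2)
    refine hasFDerivAt_of_tendstoLocallyUniformlyOn isOpen_univ hsum (fun n y _ => ?_)
      (fun y _ => (hslice γ).tendsto_at (mem_univ y)) (mem_univ x)
    have hd := ((hw n).contDiff t ht).iterPartial γ
    have := (hd.differentiable_field y).hasFDerivAt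
    rw [fderiv_eq_sum_partialDeriv] at this
    simpa only [partialDeriv_iterPartial] using this
  have hpd : ∀ γ, ∀ t, 0 ≤ t → ∀ i, partialDeriv i (fun y => U γ (t, y))
      = fun y => U (γ ++ [i]) (t, y) := by
    intro γ t ht i
    ext x
    rw [partialDeriv, (hder γ t ht x).fderiv]
    simp
  have hiter : ∀ γ, ∀ t, 0 ≤ t → iterPartial γ (fun y => U [] (t, y)) = fun y => U γ (t, y) := by
    intro γ t ht
    induction γ using List.reverseRecOn with
    | nil => rfl
    | append_singleton γ i ih => rw [← partialDeriv_iterPartial, ih, hpd γ t ht i]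
  have hlim : ∀ γ, TendstoLocallyUniformlyOn
      (fun n (p : ℝ × Vec3 ℝ) => iterPartial γ (w n p.1) p.2)
      (fun p => iterPartial γ (fun y => U [] (p.1, y)) p.2) atTop (Ici 0 ×ˢ univ) := fun γ =>
    (hunif γ).congr_right fun p hp => by rw [hiter γ p.1 hp.1]
  refine ⟨fun t y => U [] (t, y), ⟨fun t ht => contDiff_of_differentiable_iterPartial fun γ => ?_,
    fun γ => contDiffOn_zero.2 ?_⟩, hlim⟩
  · rw [hiter γ t ht]
    exact fun x => (hder γ t ht x).differentiableAt
  · exact (hlim γ).continuousOn (Frequently.of_forall fun n => ((hw n).contDiffOn γ).continuousOn)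

/-! ### Convergence of the iteration -/

/-- Sobolev's inequality turns decay of the localized jet energies into uniform decay of all
derivatives. -/
theorem exists_iterPartial_le_jetEnergy (γ : List (Fin 3)) {r : ℝ} (hr : 0 < r) :
    ∃ C, 0 ≤ C ∧ ∀ w : Fin 3 → Vec3 ℝ → ℝ, (∀ i, ContDiff ℝ ∞ (w i)) → ∀ i x, ‖x‖ ≤ r →
      iterPartial γ (w i) x ^ 2
        ≤ C * jetEnergy (3 + γ.length) (ballCutoff (2 * r)) w := by
  have hr2 : 0 < 2 * r := by positivity
  have hψ := ballCutoff_contDiff (2 * r)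
  have hcψ := ballCutoff_hasCompactSupport hr2
  obtain ⟨C, hC0, hC⟩ := exists_sq_le_cutoffIntegral_sqJet (ballCutoff_contDiff r)
    (ballCutoff_hasCompactSupport hr) hψ hcψ fun x hx =>
      ballCutoff_eq_one hr2 (mem_closedBall_zero_iff.1 (ballCutoff_tsupport hr hx))
  refine ⟨C, hC0, fun w hw i x hx => ?_⟩
  refine (hC _ ((hw i).iterPartial γ) x (ballCutoff_eq_one hr hx)).trans ?_
  refine mul_le_mul_of_nonneg_left ?_ hC0
  refine (cutoffIntegral_mono hψ.continuous hcψ (continuous_sqJet 3 ((hw i).iterPartial γ))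
    (continuous_sqJet (3 + γ.length) (hw i)) fun y _ => sqJet_iterPartial_le 3 γ _ y).trans ?_
  exact Finset.single_le_sum (f := fun i => cutoffIntegral (ballCutoff (2 * r))
    (sqJet (3 + γ.length) (w i))) (fun j _ => cutoffIntegral_nonneg fun y => sqJet_nonneg _ _ _)
    (Finset.mem_univ i)
theorem TendstoLocallyUniformlyOn.shift {X : Type} [TopologicalSpace X] {F : ℕ → X → ℝ} {f : X → ℝ}
    {s : Set X} (h : TendstoLocallyUniformlyOn F f atTop s) :
    TendstoLocallyUniformlyOn (fun n => F (n + 1)) f atTop s := by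
  intro V hV x hx
  obtain ⟨t, ht, h⟩ := h V hV x hx
  exact ⟨t, ht, (tendsto_add_atTop_nat 1).eventually h⟩

theorem partialDeriv_linearFlux {a : Fin 3 → Fin 3 → Fin 3 → ℝ → Vec3 ℝ → ℝ}
    {u : Fin 3 → ℝ → Vec3 ℝ → ℝ} {t : ℝ} (ha : ∀ i j k, ContDiff ℝ ∞ (a i j k t))
    (hu : ∀ k, ContDiff ℝ ∞ (u k t)) (i j : Fin 3) (x : Vec3 ℝ) :
    partialDeriv j (linearFlux a u i j t) x = ∑ k, (partialDeriv j (a i j k t) x * u k t x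
      + a i j k t x * partialDeriv j (u k t) x) := by
  have h1 : linearFlux a u i j t = fun x => ∑ k, a i j k t x * u k t x := rfl
  rw [h1, partialDeriv_sum _ fun k => ((ha i j k).mul (hu k)).differentiable_field]
  refine Finset.sum_congr rfl fun k _ => ?_
  rw [partialDeriv_mul (ha i j k).differentiable_field (hu k).differentiable_field]

theorem tendsto_cutoffIntegral {g : ℕ → Vec3 ℝ → ℝ} {g' : Vec3 ℝ → ℝ}
    (hg : ∀ n, Continuous (g n)) (hg' : Continuous g')
    (h : TendstoLocallyUniformlyOn g g' atTop univ) {φ : Vec3 ℝ → ℝ} (hφ : Continuous φ)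
    (hc : HasCompactSupport φ) :
    Tendsto (fun n => cutoffIntegral φ (g n)) atTop (𝓝 (cutoffIntegral φ g')) := by
  have hK := (tendstoLocallyUniformlyOn_iff_tendstoUniformlyOn_of_compact hc.isCompact).1
    (h.mono (subset_univ _))
  refine tendsto_integral_filter_of_dominated_convergence (fun x => φ x ^ 2 * (|g' x| + 1))
    (Eventually.of_forall fun n => ((hφ.pow 2).mul (hg n)).aestronglyMeasurable) ?_
    (integrable_cutoff hφ hc (hg'.abs.add continuous_const))
    (Eventually.of_forall fun x => (h.tendsto_at (mem_univ x)).const_mul _)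
  filter_upwards [Metric.tendstoUniformlyOn_iff.1 hK 1 one_pos] with n hn
  refine Eventually.of_forall fun x => ?_
  by_cases hx : φ x = 0
  · simp [hx]
  · have h1 := hn x (subset_tsupport _ hx)
    rw [Real.dist_eq, abs_sub_comm] at h1
    have h2 := abs_sub_abs_le_abs_sub (g n x) (g' x)
    rw [norm_mul, Real.norm_eq_abs, Real.norm_eq_abs, abs_of_nonneg (sq_nonneg (φ x))]
    exact mul_le_mul_of_nonneg_left (by linarith) (sq_nonneg _)

/-- Existence for linear systems in divergence form with bounded coefficients, with the energy
bound. -/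
theorem exists_linear_solution {β A F : ℝ} (hβ : 0 < β) (hA0 : 0 < A)
    {a : Fin 3 → Fin 3 → Fin 3 → ℝ → Vec3 ℝ → ℝ} (ha : ∀ i j k, SmoothField 0 (Ici 0) (a i j k))
    (hA : ∀ i j k, ∀ t, 0 ≤ t → ∀ x, |a i j k t x| ≤ A) {f : Fin 3 → Vec3 ℝ → ℝ}
    (hf : ∀ i, ContDiff ℝ ∞ (f i)) (hF : ∀ φ : Vec3 ℝ → ℝ, Continuous φ → HasCompactSupport φ →
      (∀ x, φ x ^ 2 ≤ 1) → jetEnergy 0 φ f ≤ F) :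
    ∃ u : Fin 3 → ℝ → Vec3 ℝ → ℝ, (∀ i, SmoothField 0 (Ici 0) (u i)) ∧
      (∀ T, SolvesWithFlux β T u (linearFlux a u)) ∧ (∀ i, u i 0 = f i) ∧
      ∀ t, 0 ≤ t → ∀ φ : Vec3 ℝ → ℝ, Continuous φ → HasCompactSupport φ → (∀ x, φ x ^ 2 ≤ 1) →
        jetEnergy 0 φ (fun i => u i t) ≤ F * Real.exp (growthRate β A * t) := by
  obtain ⟨B, hB⟩ := exists_isPicardSequence hβ ha hf
  have hF0 : 0 ≤ F := (jetEnergy_nonneg _ _ _).trans (hF (fun _ => 0) continuous_const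
    HasCompactSupport.zero (by simp))
  have hl0 : 0 ≤ growthRate β A := mul_nonneg (energyConst_pos hβ).le (by positivity)
  have hbd := fun n => hB.jetEnergy_le hβ hA0 ha hA hF n
  have hM : ∀ T n, L2BoundedOn T (F * Real.exp (growthRate β A * T)) (B n) := by
    intro T n t ht φ hφ hc h1
    refine (hbd n t ht.1 φ hφ hc h1).trans (mul_le_mul_of_nonneg_left ?_ hF0)
    exact Real.exp_le_exp.2 (mul_le_mul_of_nonneg_left ht.2 hl0)
  -- energies decay like `(3 / 4) ^ n`, hence values like the powers of the square root
  have hq1 : √(3 / 4 : ℝ) < 1 := by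
    rw [Real.sqrt_lt' one_pos]; norm_num
  choose u hu hlim using fun i => exists_smoothField_limit (fun n => hB.smooth n i)
    (Real.sqrt_nonneg (3 / 4)) hq1 fun γ T r => by
      have hr : (0 : ℝ) < max r 1 := lt_max_of_lt_right one_pos
      obtain ⟨C, hC0, hC⟩ := exists_iterPartial_le_jetEnergy γ hr
      obtain ⟨M', N, hM'0, hM'⟩ := hB.exists_jetEnergy_le hβ hA0 ha hA (hM T) (by positivity)
        (3 + γ.length) (ballCutoff (2 * max r 1)) (ballCutoff_contDiff _)
        (ballCutoff_hasCompactSupport (by positivity))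
      refine ⟨√(C * M'), N, fun n hn t ht x hx => ?_⟩
      have h1 := hC (fun i => picardDiff B n i t)
        (fun i => (hB.smooth_diff n i).contDiff t ht.1) i x (hx.trans (le_max_left _ _))
      have h2 : iterPartial γ (picardDiff B n i t) x
          = iterPartial γ (B (n + 1) i t) x - iterPartial γ (B n i t) x :=
        congrFun (iterPartial_sub γ ((hB.smooth (n + 1) i).contDiff t ht.1)
          ((hB.smooth n i).contDiff t ht.1)) x
      have h3 := h1.trans (mul_le_mul_of_nonneg_left (hM' n hn t ht) hC0)
      rw [h2, ← mul_assoc] at h3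
      refine abs_le_of_sq_le_sq (h3.trans (le_of_eq ?_)) (by positivity)
      rw [mul_pow, ← pow_mul, mul_comm n, pow_mul, Real.sq_sqrt (by positivity),
        Real.sq_sqrt (by norm_num)]
  have hslice : ∀ i γ x t, TendstoLocallyUniformlyOn (fun n s => iterPartial γ (B n i s) x)
      (fun s => iterPartial γ (u i s) x) atTop (Icc 0 t) := fun i γ x t =>
    (hlim i γ).comp (fun s => (s, x)) (fun s hs => ⟨hs.1, mem_univ _⟩) (by fun_prop)
  have htend : ∀ i γ t x, 0 ≤ t → Tendsto (fun n => iterPartial γ (B n i t) x) atTop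
      (𝓝 (iterPartial γ (u i t) x)) := fun i γ t x ht =>
    (hslice i γ x t).tendsto_at ⟨ht, le_rfl⟩
  have hpow : ∀ x : Vec3 ℝ, ∀ᶠ n : ℕ in atTop, ‖x‖ < 2 ^ n := fun x =>
    (tendsto_pow_atTop_atTop_of_one_lt one_lt_two).eventually_gt_atTop _
  have h0 : ∀ i, u i 0 = f i := by
    refine fun i => funext fun x => tendsto_nhds_unique
      ((tendsto_add_atTop_iff_nat 1).2 (htend i [] 0 x le_rfl)) ?_
    refine tendsto_const_nhds.congr' ?_
    filter_upwards [hpow x] with n hn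
    simp only [iterPartial, hB.initial]
    rw [IsPicardSequence.ballCutoff_two_pow_eq_one le_rfl hn, one_mul]
  -- the equation passes to the limit in integrated form
  have hint : ∀ i x t, 0 ≤ t → u i t x = f i x + ∫ s in (0 : ℝ)..t,
      (β * laplacianSum (u i s) x + ∑ j, partialDeriv j (linearFlux a u i j s) x) := by
    intro i x t ht
    have hcon : ∀ {g : ℝ → Vec3 ℝ → ℝ}, SmoothField 0 (Ici 0) g →
        ContinuousOn (fun s => g s x) (Icc 0 t) := fun hg =>
      (hg.continuousOn_time x).mono Icc_subset_Ici_self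
    have hconst : ∀ {g : ℝ → ℝ}, TendstoLocallyUniformlyOn (fun _ : ℕ => g) g atTop (Icc 0 t) :=
      fun V hV y hy => ⟨univ, univ_mem, Eventually.of_forall fun n z _ => refl_mem_uniformity hV⟩
    have hflux : ∀ j k, TendstoLocallyUniformlyOn
        (fun n s => partialDeriv j (a i j k s) x * B n k s x
          + a i j k s x * partialDeriv j (B n k s) x)
        (fun s => partialDeriv j (a i j k s) x * u k s x
          + a i j k s x * partialDeriv j (u k s) x) atTop (Icc 0 t) := fun j k =>
      (hconst.fun_mul₀ (hslice k [] x t) (hcon ((ha i j k).partialDeriv j)) (hcon (hu k))).fun_add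
        (hconst.fun_mul₀ (hslice k [j] x t) (hcon (ha i j k)) (hcon ((hu k).partialDeriv j)))
    have hlap : TendstoLocallyUniformlyOn (fun n s => laplacianSum (B (n + 1) i s) x)
        (fun s => laplacianSum (u i s) x) atTop (Icc 0 t) := by
      simp only [laplacianSum, Fin.sum_univ_three]
      exact (((hslice i [0, 0] x t).fun_add (hslice i [1, 1] x t)).fun_add
        (hslice i [2, 2] x t)).shift
    have hsum : ∀ j, TendstoLocallyUniformlyOn
        (fun n s => ∑ k, (partialDeriv j (a i j k s) x * B n k s x
          + a i j k s x * partialDeriv j (B n k s) x))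
        (fun s => ∑ k, (partialDeriv j (a i j k s) x * u k s x
          + a i j k s x * partialDeriv j (u k s) x)) atTop (Icc 0 t) := fun j => by
      simp only [Fin.sum_univ_three]
      exact ((hflux j 0).fun_add (hflux j 1)).fun_add (hflux j 2)
    have hall : TendstoLocallyUniformlyOn (fun n s => β * laplacianSum (B (n + 1) i s) x
        + ∑ j, ∑ k, (partialDeriv j (a i j k s) x * B n k s x
          + a i j k s x * partialDeriv j (B n k s) x))
        (fun s => β * laplacianSum (u i s) x
        + ∑ j, ∑ k, (partialDeriv j (a i j k s) x * u k s x
          + a i j k s x * partialDeriv j (u k s) x)) atTop (Icc 0 t) := by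
      have h1 : TendstoLocallyUniformlyOn (fun n s => ∑ j, ∑ k,
          (partialDeriv j (a i j k s) x * B n k s x + a i j k s x * partialDeriv j (B n k s) x))
          (fun s => ∑ j, ∑ k, (partialDeriv j (a i j k s) x * u k s x
            + a i j k s x * partialDeriv j (u k s) x)) atTop (Icc 0 t) := by
        simp only [Fin.sum_univ_three (f := fun j => ∑ k, _)]
        exact ((hsum 0).fun_add (hsum 1)).fun_add (hsum 2)
      exact (hconst.fun_mul₀ hlap continuousOn_const
        (hcon ((hu i).laplacianSum (by simp)))).fun_add h1
    rw [tendstoLocallyUniformlyOn_iff_tendstoUniformlyOn_of_compact isCompact_Icc] at hall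
    have hcn : ∀ n, ContinuousOn (fun s => β * laplacianSum (B (n + 1) i s) x
        + ∑ j, ∑ k, (partialDeriv j (a i j k s) x * B n k s x
          + a i j k s x * partialDeriv j (B n k s) x)) (Icc 0 t) := fun n =>
      (continuousOn_const.mul (hcon ((hB.smooth (n + 1) i).laplacianSum (by simp)))).add
        (continuousOn_finsetSum _ fun j _ => continuousOn_finsetSum _ fun k _ =>
          ((hcon ((ha i j k).partialDeriv j)).mul (hcon (hB.smooth n k))).add
            ((hcon (ha i j k)).mul (hcon ((hB.smooth n k).partialDeriv j))))
    rw [← uIcc_of_le ht] at hall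
    have hI := hall.tendsto_intervalIntegral_of_continuousOn (μ := volume)
      (Eventually.of_forall fun n => by rw [uIcc_of_le ht]; exact hcn n)
    have hrhs : ∫ s in (0 : ℝ)..t,
        (β * laplacianSum (u i s) x + ∑ j, partialDeriv j (linearFlux a u i j s) x)
        = ∫ s in (0 : ℝ)..t, (β * laplacianSum (u i s) x
          + ∑ j, ∑ k, (partialDeriv j (a i j k s) x * u k s x
          + a i j k s x * partialDeriv j (u k s) x)) := by
      refine intervalIntegral.integral_congr fun s hs => ?_
      rw [uIcc_of_le ht] at hs
      rw [Finset.sum_congr rfl fun j _ => partialDeriv_linearFlux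
        (fun i j k => (ha i j k).contDiff s hs.1) (fun k => (hu k).contDiff s hs.1) i j x]
    rw [hrhs]
    refine tendsto_nhds_unique ((tendsto_add_atTop_iff_nat 1).2 (htend i [] t x ht))
      ((tendsto_const_nhds.add hI).congr' ?_)
    filter_upwards [hpow x] with n hn
    have hs := hB.solves n t
    have htt : t ∈ Icc 0 t := ⟨ht, le_rfl⟩
    have h1 := eq_add_integral_of_hasDerivWithinAt (fun s hs' => hs.hasDeriv i s hs' x)
      ((continuousOn_const.mul (((hs.smooth i).laplacianSum (by simp)).continuousOn_time x)).add
        (continuousOn_finsetSum _ fun j _ =>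
          ((hs.smooth_flux i j).partialDeriv j).continuousOn_time x)) htt
    have h2 : B (n + 1) i 0 x = f i x := by
      rw [hB.initial, IsPicardSequence.ballCutoff_two_pow_eq_one le_rfl hn, one_mul]
    simp only [iterPartial]
    rw [h1, h2]
    congr 1
    refine intervalIntegral.integral_congr fun s hs => ?_
    rw [uIcc_of_le ht] at hs
    congr 1
    refine Finset.sum_congr rfl fun j _ => ?_
    rw [← partialDeriv_linearFlux (fun i j k => (ha i j k).contDiff s hs.1)
      (fun k => (hB.smooth n k).contDiff s hs.1) i j x]
    refine (partialDeriv_congr j ?_).eq_of_nhds.symm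
    filter_upwards [(isOpen_lt continuous_norm continuous_const).mem_nhds hn] with y hy
    simp only [linearFlux, truncatedCoeff,
      IsPicardSequence.ballCutoff_two_pow_eq_one le_rfl hy, one_mul]
  refine ⟨u, hu, fun T => ⟨fun i => (hu i).mono Icc_subset_Ici_self, fun i j =>
    (smooth_linearFlux (by simp) ha hu i j).mono Icc_subset_Ici_self, fun i t ht x => ?_⟩, h0, ?_⟩
  · refine hasDerivWithinAt_of_eq_add_integral (c := f i x) (f' := fun s =>
      β * laplacianSum (u i s) x + ∑ j, partialDeriv j (linearFlux a u i j s) x)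
      ?_ (fun t ht => hint i x t ht.1) ht
    exact (((continuousOn_const.mul (((hu i).laplacianSum (by simp)).continuousOn_time x)).add
      (continuousOn_finsetSum _ fun j _ => ((smooth_linearFlux (by simp) ha hu i
        j).partialDeriv j).continuousOn_time x))).mono Icc_subset_Ici_self
  · intro t ht φ hφ hc h1
    have hconv : Tendsto (fun n => jetEnergy 0 φ (fun i => B n i t)) atTop
        (𝓝 (jetEnergy 0 φ (fun i => u i t))) := by
      refine tendsto_finsetSum _ fun i _ => tendsto_cutoffIntegral
        (fun n => continuous_sqJet 0 ((hB.smooth n i).contDiff t ht))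
        (continuous_sqJet 0 ((hu i).contDiff t ht)) ?_ hφ hc
      have h2 : TendstoLocallyUniformlyOn (fun n y => B n i t y) (fun y => u i t y) atTop univ :=
        (hlim i []).comp (fun y => (t, y)) (fun y _ => ⟨ht, mem_univ _⟩) (by fun_prop)
      have hc2 := ((hu i).continuous_slice ht).continuousOn (s := univ)
      simpa only [sqJet, sq] using! h2.fun_mul₀ h2 hc2 hc2
    exact le_of_tendsto' hconv fun n => hbd n t ht φ hφ hc h1

/-! ### Joint smoothness in space and time -/

/-- A function with a time derivative and continuous spatial derivatives is differentiable in
space and time. -/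
theorem hasFDerivWithinAt_of_partial {J : Set ℝ} {f : ℝ → Vec3 ℝ → ℝ}
    {D : ℝ → Vec3 ℝ → Vec3 ℝ →L[ℝ] ℝ} {t h : ℝ} {x : Vec3 ℝ}
    (hf : ∀ s ∈ J, ∀ y, HasFDerivAt (f s) (D s y) y)
    (hD : ContinuousWithinAt (fun p : ℝ × Vec3 ℝ => D p.1 p.2) (J ×ˢ univ) (t, x))
    (hft : HasDerivWithinAt (fun s => f s x) h J t) :
    HasFDerivWithinAt (fun p : ℝ × Vec3 ℝ => f p.1 p.2)
      ((D t x).comp (ContinuousLinearMap.snd ℝ ℝ (Vec3 ℝ))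
        + h • ContinuousLinearMap.fst ℝ ℝ (Vec3 ℝ)) (J ×ˢ univ) (t, x) := by
  have h2 : HasFDerivWithinAt (fun p : ℝ × Vec3 ℝ => f p.1 x)
      (h • ContinuousLinearMap.fst ℝ ℝ (Vec3 ℝ)) (J ×ˢ univ) (t, x) :=
    HasDerivWithinAt.comp_hasFDerivWithinAt (h₂ := fun s => f s x) (f := Prod.fst)
      (t := J) (t, x) hft hasFDerivAt_fst.hasFDerivWithinAt fun p hp => hp.1
  have h1 : HasFDerivWithinAt (fun p : ℝ × Vec3 ℝ => f p.1 p.2 - f p.1 x)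
      ((D t x).comp (ContinuousLinearMap.snd ℝ ℝ (Vec3 ℝ))) (J ×ˢ univ) (t, x) := by
    rw [hasFDerivWithinAt_iff_isLittleO, Asymptotics.isLittleO_iff]
    intro ε hε
    obtain ⟨δ, hδ, hδε⟩ := Metric.continuousWithinAt_iff.1 hD ε hε
    filter_upwards [self_mem_nhdsWithin, mem_nhdsWithin_of_mem_nhds
      (Metric.ball_mem_nhds (t, x) hδ)] with p hpS hp
    have hp2 : p.2 ∈ Metric.ball x δ := lt_of_le_of_lt (le_max_right (dist p.1 t) (dist p.2 x)) hp
    have key := (convex_ball x δ).norm_image_sub_le_of_norm_hasFDerivWithin_le'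
      (f := f p.1) (φ := D t x) (C := ε)
      (fun y _ => (hf p.1 hpS.1 y).hasFDerivWithinAt) (fun y hy => ?_)
      (Metric.mem_ball_self hδ) hp2
    · simp only [sub_self, sub_zero]
      exact key.trans (mul_le_mul_of_nonneg_left (norm_snd_le (p - (t, x))) hε.le)
    · have hd : dist (p.1, y) (t, x) < δ :=
        max_lt (lt_of_le_of_lt (le_max_left (dist p.1 t) (dist p.2 x)) hp) hy
      have := hδε (show ((p.1, y) : ℝ × Vec3 ℝ) ∈ J ×ˢ univ from ⟨hpS.1, mem_univ _⟩) hd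
      rw [dist_eq_norm] at this
      exact this.le
  exact (h1.add h2).congr_of_eventuallyEq (Eventually.of_forall fun p => by simp) (by simp)

namespace SmoothField

variable {T : ℝ} {u h : ℝ → Vec3 ℝ → ℝ}

/-- A field whose time derivative is as regular as the field itself gains a derivative. -/
theorem succ (hT : 0 < T) {m : ℕ} (hu : SmoothField m (Icc 0 T) u) (hh : SmoothField m (Icc 0 T) h)
    (hd : ∀ t ∈ Icc 0 T, ∀ x, HasDerivWithinAt (fun s => u s x) (h t x) (Icc 0 T) t) :
    SmoothField (m + 1) (Icc 0 T) u := by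
  refine ⟨hu.contDiff, fun γ => ?_⟩
  have hU : UniqueDiffOn ℝ (Icc 0 T ×ˢ (univ : Set (Vec3 ℝ))) :=
    (uniqueDiffOn_Icc hT).prod uniqueDiffOn_univ
  have hD : ContDiffOn ℝ m (fun p : ℝ × Vec3 ℝ => ∑ i, _root_.iterPartial (γ ++ [i]) (u p.1) p.2 •
      (EuclideanSpace.proj (𝕜 := ℝ) i : Vec3 ℝ →L[ℝ] ℝ)) (Icc 0 T ×ˢ univ) :=
    ContDiffOn.sum fun i _ => (hu.contDiffOn (γ ++ [i])).smul contDiffOn_const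
  rw [contDiffOn_succ_iff_hasFDerivWithinAt_of_uniqueDiffOn hU]
  refine ⟨by simp, fun p => (∑ i, _root_.iterPartial (γ ++ [i]) (u p.1) p.2 •
      (EuclideanSpace.proj (𝕜 := ℝ) i : Vec3 ℝ →L[ℝ] ℝ)).comp
        (ContinuousLinearMap.snd ℝ ℝ (Vec3 ℝ))
      + _root_.iterPartial γ (h p.1) p.2 • ContinuousLinearMap.fst ℝ ℝ (Vec3 ℝ),
    (hD.clm_comp contDiffOn_const).add ((hh.contDiffOn γ).smul contDiffOn_const), ?_⟩
  rintro ⟨t, x⟩ ⟨ht, -⟩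
  refine hasFDerivWithinAt_of_partial (f := fun t => _root_.iterPartial γ (u t))
    (D := fun t x => ∑ i, _root_.iterPartial (γ ++ [i]) (u t) x •
      (EuclideanSpace.proj (𝕜 := ℝ) i : Vec3 ℝ →L[ℝ] ℝ)) (fun s hs y => ?_)
    (hD.continuousOn (t, x) ⟨ht, mem_univ _⟩) (hasDerivWithinAt_iterPartial γ hu hh hd t ht x)
  have := (((hu.contDiff s hs).iterPartial γ).differentiable_field y).hasFDerivAt
  rw [fderiv_eq_sum_partialDeriv] at this
  simpa only [partialDeriv_iterPartial] using this

end SmoothField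

theorem natCast_le_infty (m : ℕ) : (m : ℕ∞ω) ≤ ∞ := by exact_mod_cast le_top

/-- Solutions of linear systems with smooth coefficients that are smooth in space are smooth in
space and time: the equation trades time derivatives for spatial derivatives. -/
theorem SolvesWithFlux.contDiffOn {β T : ℝ} (hT : 0 < T)
    {a : Fin 3 → Fin 3 → Fin 3 → ℝ → Vec3 ℝ → ℝ} (ha : ∀ i j k, SmoothField ∞ (Icc 0 T) (a i j k))
    {u : Fin 3 → ℝ → Vec3 ℝ → ℝ} (h : SolvesWithFlux β T u (linearFlux a u)) (i : Fin 3) :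
    ContDiffOn ℝ ∞ (fun p : ℝ × Vec3 ℝ => u i p.1 p.2) (Icc 0 T ×ˢ univ) := by
  have key : ∀ m : ℕ, ∀ i, SmoothField m (Icc 0 T) (u i) := by
    intro m
    induction m with
    | zero => exact h.smooth
    | succ m ih =>
      intro i
      have hm := natCast_le_infty m
      push_cast
      refine (ih i).succ hT (h := fun t x => β * laplacianSum (u i t) x
        + ∑ j, partialDeriv j (linearFlux a u i j t) x) ?_ (h.hasDeriv i)
      exact (((ih i).laplacianSum hm).const_mul hm β).add (SmoothField.sum _ (fun j =>
        (smooth_linearFlux hm (fun i j k => (ha i j k).of_le hm) ih i j).partialDeriv j) hm)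
  exact contDiffOn_infty.2 fun m => (key m i).contDiffOn []

theorem contDiffOn_Ici_of_Icc {F : Type} [NormedAddCommGroup F] [NormedSpace ℝ F]
    {g : ℝ × Vec3 ℝ → F} (h : ∀ T, 0 < T → ContDiffOn ℝ ∞ g (Icc 0 T ×ˢ univ)) :
    ContDiffOn ℝ ∞ g (Ici 0 ×ˢ univ) := by
  rintro ⟨t, x⟩ ⟨ht, -⟩
  have ht0 : (0 : ℝ) ≤ t := ht
  refine (h (t + 1) (by linarith) (t, x) ⟨⟨ht0, by linarith⟩, mem_univ _⟩).mono_of_mem_nhdsWithin ?_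
  rw [nhdsWithin_prod_eq, nhdsWithin_univ]
  exact prod_mem_prod (inter_mem_nhdsWithin _ (Iic_mem_nhds (by linarith))) univ_mem

/-! ### The induction equation in divergence form -/

/-- The Levi-Civita symbol. -/
def leviCivita (i j k : Fin 3) : ℝ :=
  (((j : ℕ) : ℝ) - ((i : ℕ) : ℝ)) * (((k : ℕ) : ℝ) - ((i : ℕ) : ℝ))
    * (((k : ℕ) : ℝ) - ((j : ℕ) : ℝ)) / 2

/-- The coefficients `vᵢδⱼₖ - vⱼδᵢₖ + αεᵢⱼₖ` of the flux of the induction equation. -/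
def dynamoCoeff (v : ℝ → Vec3 ℝ → Vec3 ℝ) (α : ℝ → Vec3 ℝ → ℝ) (i j k : Fin 3) (t : ℝ)
    (x : Vec3 ℝ) : ℝ :=
  (if j = k then 1 else 0) * v t x i - (if i = k then 1 else 0) * v t x j
    + leviCivita i j k * α t x

theorem dynamoCoeff_swap (v : ℝ → Vec3 ℝ → Vec3 ℝ) (α : ℝ → Vec3 ℝ → ℝ) (i j k : Fin 3) (t : ℝ)
    (x : Vec3 ℝ) : dynamoCoeff v α j i k t x = -dynamoCoeff v α i j k t x := by
  simp only [dynamoCoeff, leviCivita]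
  ring

theorem contDiff_component {B : Vec3 ℝ → Vec3 ℝ} (hB : ContDiff ℝ ∞ B) (i : Fin 3) :
    ContDiff ℝ ∞ fun y => B y i :=
  (contDiff_euclidean.1 hB) i

theorem laplacian_apply {B : Vec3 ℝ → Vec3 ℝ} (hB : ContDiff ℝ ∞ B) (x : Vec3 ℝ) (i : Fin 3) :
    Laplacian.laplacian B x i = laplacianSum (fun y => B y i) x := by
  rw [← laplacian_eq_laplacianSum (contDiff_component hB i)]
  have h2 : ContDiffAt ℝ 2 B x :=
    hB.contDiffAt.of_le (WithTop.coe_le_coe.2 (le_top : (2 : ℕ∞) ≤ ⊤))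
  exact (h2.laplacian_CLM_comp_left (l := (EuclideanSpace.proj i : Vec3 ℝ →L[ℝ] ℝ))).symm

theorem partialDeriv_mul_sub_mul {f g h k : Vec3 ℝ → ℝ} (hf : ContDiff ℝ ∞ f)
    (hg : ContDiff ℝ ∞ g) (hh : ContDiff ℝ ∞ h) (hk : ContDiff ℝ ∞ k) (l : Fin 3) (x : Vec3 ℝ) :
    partialDeriv l (fun y => f y * g y - h y * k y) x
      = partialDeriv l f x * g x + f x * partialDeriv l g x
        - (partialDeriv l h x * k x + h x * partialDeriv l k x) := by
  rw [partialDeriv_sub (hf.mul hg).differentiable_field (hh.mul hk).differentiable_field,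
    partialDeriv_mul hf.differentiable_field hg.differentiable_field,
    partialDeriv_mul hh.differentiable_field hk.differentiable_field]

theorem partialDeriv_dynamoCoeff {v : ℝ → Vec3 ℝ → Vec3 ℝ} {α : ℝ → Vec3 ℝ → ℝ} {t : ℝ}
    (hv : ContDiff ℝ ∞ (v t)) (hα : ContDiff ℝ ∞ (α t)) (i j k l : Fin 3) (x : Vec3 ℝ) :
    partialDeriv l (dynamoCoeff v α i j k t) x
      = (if j = k then 1 else 0) * partialDeriv l (fun y => v t y i) x
        - (if i = k then 1 else 0) * partialDeriv l (fun y => v t y j) x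
        + leviCivita i j k * partialDeriv l (α t) x := by
  have hd := fun i => (contDiff_component hv i).differentiable_field
  have hc : ∀ (c : ℝ) i, Differentiable ℝ fun y => c * v t y i := fun c i => (hd i).const_mul c
  have hs : ∀ c d : ℝ, Differentiable ℝ fun y => c * v t y i - d * v t y j := fun c d =>
    (hc c i).sub (hc d j)
  have : dynamoCoeff v α i j k t = fun y => (if j = k then 1 else 0) * v t y i
    - (if i = k then 1 else 0) * v t y j + leviCivita i j k * α t y := rfl
  rw [this, partialDeriv_add (hs _ _) (hα.differentiable_field.const_mul _),
    partialDeriv_sub (hc _ _) (hc _ _), partialDeriv_const_mul (hd i),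
    partialDeriv_const_mul (hd j),
    partialDeriv_const_mul hα.differentiable_field]

theorem contDiff_dynamoCoeff {v : ℝ → Vec3 ℝ → Vec3 ℝ} {α : ℝ → Vec3 ℝ → ℝ} {t : ℝ}
    (hv : ContDiff ℝ ∞ (v t)) (hα : ContDiff ℝ ∞ (α t)) (i j k : Fin 3) :
    ContDiff ℝ ∞ (dynamoCoeff v α i j k t) :=
  ((contDiff_const.mul (contDiff_component hv i)).sub
    (contDiff_const.mul (contDiff_component hv j))).add (contDiff_const.mul hα)

/-- The right-hand side of the induction equation is in divergence form. -/
theorem inductionRHS_apply {v : ℝ → Vec3 ℝ → Vec3 ℝ} {α : ℝ → Vec3 ℝ → ℝ} {t : ℝ}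
    (hv : ContDiff ℝ ∞ (v t)) (hα : ContDiff ℝ ∞ (α t)) (β : ℝ)
    {u : Fin 3 → ℝ → Vec3 ℝ → ℝ} {B : Vec3 ℝ → Vec3 ℝ} (hB : ContDiff ℝ ∞ B)
    (hu : ∀ i, u i t = fun y => B y i) (x : Vec3 ℝ) (i : Fin 3) :
    inductionRHS (v t) (α t) β B x i = β * laplacianSum (u i t) x
      + ∑ j, partialDeriv j (linearFlux (dynamoCoeff v α) u i j t) x := by
  have hBi := contDiff_component hB
  have hvi := contDiff_component hv
  have hui : ∀ i, ContDiff ℝ ∞ (u i t) := fun i => by rw [hu i]; exact hBi i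
  have h1 : ∀ j, partialDeriv j (linearFlux (dynamoCoeff v α) u i j t) x
      = ∑ k, (((if j = k then 1 else 0) * partialDeriv j (fun y => v t y i) x
        - (if i = k then 1 else 0) * partialDeriv j (fun y => v t y j) x
        + leviCivita i j k * partialDeriv j (α t) x) * B x k
        + dynamoCoeff v α i j k t x * partialDeriv j (fun y => B y k) x) := by
    intro j
    rw [partialDeriv_linearFlux (contDiff_dynamoCoeff hv hα) hui]
    simp only [partialDeriv_dynamoCoeff hv hα, hu]
  have hsub := fun l i j i' j' => partialDeriv_mul_sub_mul (hvi i) (hBi j) (hvi i') (hBi j') l x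
  have hmul : ∀ l j, partialDeriv l (fun y => α t y * B y j) x
      = partialDeriv l (α t) x * B x j + α t x * partialDeriv l (fun y => B y j) x := fun l j => by
    rw [partialDeriv_mul hα.differentiable_field (hBi j).differentiable_field]
  simp only [inductionRHS, PiLp.add_apply, PiLp.smul_apply, laplacian_apply hB, h1, hu]
  rw [add_comm, smul_eq_mul]
  congr 1
  fin_cases i <;>
  simp [curl, cross, cross_apply, hsub, hmul, Fin.sum_univ_three, dynamoCoeff, leviCivita] <;>
  ring

/-! ### Divergence-free fields -/

theorem curl_curl_apply {B : Vec3 ℝ → Vec3 ℝ} (hB : ContDiff ℝ ∞ B) (x : Vec3 ℝ) (i : Fin 3) :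
    curl (curl B) x i = partialDeriv i (divergence B) x - laplacianSum (fun y => B y i) x := by
  have hBi := contDiff_component hB
  have hp : ∀ i j, Differentiable ℝ (partialDeriv i fun y => B y j) := fun i j =>
    ((hBi j).partialDeriv i).differentiable_field
  have hdiv : divergence B = fun y => ∑ i, partialDeriv i (fun y => B y i) y := rfl
  have hsub := fun l i j i' j' => congrFun (partialDeriv_sub (hp i j) (hp i' j') l) x
  have hcomm := fun i j k => congrFun (partialDeriv_comm (hBi k) i j) x
  rw [hdiv, partialDeriv_sum _ fun k => hp k k]
  simp only [laplacianSum, Fin.sum_univ_three]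
  fin_cases i <;>
  simp [curl, hsub]
  · rw [hcomm 0 1 1, hcomm 0 2 2]; ring
  · rw [hcomm 1 0 0, hcomm 1 2 2]; ring
  · rw [hcomm 2 0 0, hcomm 2 1 1]; ring

theorem contDiff_curl {B : Vec3 ℝ → Vec3 ℝ} (hB : ContDiff ℝ ∞ B) : ContDiff ℝ ∞ (curl B) := by
  have hp := fun i j => (contDiff_component hB j).partialDeriv i
  refine contDiff_euclidean.2 fun i => ?_
  fin_cases i
  · exact (hp 1 2).sub (hp 2 1)
  · exact (hp 2 0).sub (hp 0 2)
  · exact (hp 0 1).sub (hp 1 0)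

/-- On divergence-free fields, `-∇×∇×B = ∇²B`. -/
theorem dynamoRHS_eq_inductionRHS {V : Vec3 ℝ → Vec3 ℝ} {A : Vec3 ℝ → ℝ} (hA : ContDiff ℝ ∞ A)
    (β : ℝ) {B : Vec3 ℝ → Vec3 ℝ} (hB : ContDiff ℝ ∞ B) (hdiv : ∀ x, divergence B x = 0)
    (x : Vec3 ℝ) : dynamoRHS V A β B x = inductionRHS V A β B x := by
  have hBi := contDiff_component hB
  have hC := contDiff_component (contDiff_curl hB)
  have h0 : divergence B = fun _ => 0 := funext hdiv
  have hcc := curl_curl_apply hB x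
  rw [h0] at hcc
  simp only [partialDeriv_const, zero_sub] at hcc
  have hl : ∀ l i, partialDeriv l (fun y => electromotiveForce A β B y i) x
      = partialDeriv l (fun y => A y * B y i) x - β * partialDeriv l (fun y => curl B y i) x := by
    intro l i
    have : (fun y => electromotiveForce A β B y i) = fun y => A y * B y i - β * curl B y i := rfl
    rw [this, partialDeriv_sub (hA.mul (hBi i)).differentiable_field
      ((hC i).differentiable_field.const_mul β), partialDeriv_const_mul (hC i).differentiable_field]
  have hcurl : ∀ i, curl (electromotiveForce A β B) x i
      = curl (fun y => A y • B y) x i - β * curl (curl B) x i := by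
    intro i
    have e : ∀ F : Vec3 ℝ → Vec3 ℝ, curl F x =
        !₂[partialDeriv 1 (fun y => F y 2) x - partialDeriv 2 (fun y => F y 1) x,
          partialDeriv 2 (fun y => F y 0) x - partialDeriv 0 (fun y => F y 2) x,
          partialDeriv 0 (fun y => F y 1) x - partialDeriv 1 (fun y => F y 0) x] := fun _ => rfl
    rw [e (electromotiveForce A β B), e (fun y => A y • B y), e (curl B)]
    simp only [hl]
    fin_cases i <;> simp <;> ring
  ext i
  simp only [dynamoRHS, inductionRHS, PiLp.add_apply, PiLp.smul_apply, hcurl, hcc,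
    laplacian_apply hB, smul_eq_mul]
  ring

/-! ### Energy and the `L²` norm -/

theorem jetEnergy_zero_eq_integral {w : Vec3 ℝ → Vec3 ℝ} (hw : ContDiff ℝ ∞ w) {φ : Vec3 ℝ → ℝ}
    (hφ : Continuous φ) (hc : HasCompactSupport φ) :
    jetEnergy 0 φ (fun i y => w y i) = ∫ x, φ x ^ 2 * ‖w x‖ ^ 2 := by
  have hwi := contDiff_component hw
  rw [jetEnergy, ← cutoffIntegral_sum _ hφ hc fun i => continuous_sqJet 0 (hwi i), cutoffIntegral]
  refine integral_congr_ae (Eventually.of_forall fun x => ?_)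
  simp only [sqJet, EuclideanSpace.real_norm_sq_eq]

theorem ofReal_jetEnergy_zero {w : Vec3 ℝ → Vec3 ℝ} (hw : ContDiff ℝ ∞ w) {φ : Vec3 ℝ → ℝ}
    (hφ : Continuous φ) (hc : HasCompactSupport φ) :
    ENNReal.ofReal (jetEnergy 0 φ (fun i y => w y i))
      = ∫⁻ x, ENNReal.ofReal (φ x ^ 2) * ‖w x‖ₑ ^ 2 := by
  rw [jetEnergy_zero_eq_integral hw hφ hc, ofReal_integral_eq_lintegral_ofReal
    (f := fun x => φ x ^ 2 * ‖w x‖ ^ 2) (integrable_cutoff hφ hc (hw.continuous.norm.pow 2))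
    (Eventually.of_forall fun x => by positivity)]
  refine lintegral_congr fun x => ?_
  rw [ENNReal.ofReal_mul (sq_nonneg _), ENNReal.ofReal_pow (norm_nonneg _), ofReal_norm]

theorem eLpNorm_two_sq (w : Vec3 ℝ → Vec3 ℝ) :
    eLpNorm w 2 volume ^ 2 = ∫⁻ x, ‖w x‖ₑ ^ 2 := by
  have := eLpNorm_nnreal_pow_eq_lintegral (p := 2) (f := w) (μ := volume) two_ne_zero
  simpa using this

theorem jetEnergy_zero_le_of_eLpNorm_le {w : Vec3 ℝ → Vec3 ℝ} (hw : ContDiff ℝ ∞ w) {M : ℝ}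
    (hM0 : 0 ≤ M) (hM : eLpNorm w 2 volume ≤ ENNReal.ofReal M) {φ : Vec3 ℝ → ℝ}
    (hφ : Continuous φ) (hc : HasCompactSupport φ) (h1 : ∀ x, φ x ^ 2 ≤ 1) :
    jetEnergy 0 φ (fun i y => w y i) ≤ M ^ 2 := by
  rw [← ENNReal.ofReal_le_ofReal_iff (sq_nonneg M), ofReal_jetEnergy_zero hw hφ hc,
    ENNReal.ofReal_pow hM0]
  refine le_trans ?_ (pow_le_pow_left' hM 2)
  rw [eLpNorm_two_sq]
  refine lintegral_mono fun x => ?_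
  refine mul_le_of_le_one_left zero_le ?_
  rw [← ENNReal.ofReal_one]
  exact ENNReal.ofReal_le_ofReal (h1 x)

/-- The `L²` norm is recovered from the localized energies by Fatou's lemma. -/
theorem eLpNorm_le_of_jetEnergy_zero_le {w : Vec3 ℝ → Vec3 ℝ} (hw : ContDiff ℝ ∞ w) {M : ℝ}
    (hM0 : 0 ≤ M) (h : ∀ φ : Vec3 ℝ → ℝ, Continuous φ → HasCompactSupport φ → (∀ x, φ x ^ 2 ≤ 1) →
      jetEnergy 0 φ (fun i y => w y i) ≤ M ^ 2) : eLpNorm w 2 volume ≤ ENNReal.ofReal M := by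
  have hpos : ∀ n : ℕ, (0 : ℝ) < (n : ℝ) + 1 := fun n => by positivity
  have hsq : eLpNorm w 2 volume ^ 2 ≤ ENNReal.ofReal M ^ 2 := by
    rw [eLpNorm_two_sq]
    have hlim : ∀ x, ‖w x‖ₑ ^ 2
        ≤ liminf (fun n : ℕ => ENNReal.ofReal (ballCutoff (n + 1) x ^ 2) * ‖w x‖ₑ ^ 2) atTop := by
      intro x
      refine (Tendsto.liminf_eq (tendsto_const_nhds.congr' ?_)).ge
      filter_upwards [eventually_ge_atTop ⌈‖x‖⌉₊] with n hn
      have : ‖x‖ ≤ n + 1 := ((Nat.le_ceil _).trans (Nat.cast_le.2 hn)).trans (by linarith)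
      rw [ballCutoff_eq_one (hpos n) this]
      simp
    refine (lintegral_mono hlim).trans ((lintegral_liminf_le fun n => ?_).trans ?_)
    · exact (ENNReal.measurable_ofReal.comp
        ((ballCutoff_contDiff _).continuous.pow 2).measurable).mul
          (hw.continuous.measurable.enorm.pow_const 2)
    · refine liminf_le_of_le (by isBoundedDefault) fun b hb => ?_
      obtain ⟨n, hn⟩ := hb.exists
      refine hn.trans ?_
      rw [← ofReal_jetEnergy_zero hw (ballCutoff_contDiff _).continuous
        (ballCutoff_hasCompactSupport (hpos n)), ← ENNReal.ofReal_pow hM0]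
      exact ENNReal.ofReal_le_ofReal (h _ (ballCutoff_contDiff _).continuous
        (ballCutoff_hasCompactSupport (hpos n)) (ballCutoff_sq_le_one _))
  exact (ENNReal.pow_le_pow_left_iff two_ne_zero).1 hsq

/-! ### Smooth solutions and systems with flux -/

/-- The components of a time-dependent vector field. -/
def components (B : ℝ → Vec3 ℝ → Vec3 ℝ) (i : Fin 3) (t : ℝ) (x : Vec3 ℝ) : ℝ := B t x i

theorem smoothField_components {J : Set ℝ} (hJ : UniqueDiffOn ℝ J) {B : ℝ → Vec3 ℝ → Vec3 ℝ}
    (hB : ContDiffOn ℝ ∞ (fun p : ℝ × Vec3 ℝ => B p.1 p.2) (J ×ˢ univ)) (i : Fin 3) :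
    SmoothField ∞ J (components B i) :=
  SmoothField.of_contDiffOn hJ (contDiffOn_euclidean.1 hB i)

theorem contDiff_slice {J : Set ℝ} {F : Type} [NormedAddCommGroup F] [NormedSpace ℝ F]
    {B : ℝ → Vec3 ℝ → F} (hB : ContDiffOn ℝ ∞ (fun p : ℝ × Vec3 ℝ => B p.1 p.2) (J ×ˢ univ))
    {t : ℝ} (ht : t ∈ J) : ContDiff ℝ ∞ (B t) := by
  rw [← contDiffOn_univ]
  exact hB.comp (f := fun x : Vec3 ℝ => (t, x)) (by fun_prop) fun x _ => ⟨ht, mem_univ _⟩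

theorem smooth_dynamoCoeff {v : ℝ → Vec3 ℝ → Vec3 ℝ} {α : ℝ → Vec3 ℝ → ℝ}
    (hv : ContDiffOn ℝ ∞ (fun p : ℝ × Vec3 ℝ => v p.1 p.2) (Ici 0 ×ˢ univ))
    (hα : ContDiffOn ℝ ∞ (fun p : ℝ × Vec3 ℝ => α p.1 p.2) (Ici 0 ×ˢ univ)) (i j k : Fin 3) :
    SmoothField ∞ (Ici 0) (dynamoCoeff v α i j k) := by
  have hvi := smoothField_components (uniqueDiffOn_Ici 0) hv
  have hαs := SmoothField.of_contDiffOn (uniqueDiffOn_Ici 0) hα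
  exact (((hvi i).const_mul le_rfl _).sub ((hvi j).const_mul le_rfl _)).add
    (hαs.const_mul le_rfl _)

theorem exists_dynamoCoeff_bound {v : ℝ → Vec3 ℝ → Vec3 ℝ} {α : ℝ → Vec3 ℝ → ℝ}
    (hvb : ∃ M : ℝ, ∀ t : ℝ, 0 ≤ t → ∀ x : Vec3 ℝ, ‖v t x‖ ≤ M)
    (hαb : ∃ M : ℝ, ∀ t : ℝ, 0 ≤ t → ∀ x : Vec3 ℝ, |α t x| ≤ M) :
    ∃ A, 0 < A ∧ ∀ i j k, ∀ t, 0 ≤ t → ∀ x, |dynamoCoeff v α i j k t x| ≤ A := by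
  obtain ⟨M₁, h₁⟩ := hvb
  obtain ⟨M₂, h₂⟩ := hαb
  have hM₁ : 0 ≤ M₁ := (norm_nonneg _).trans (h₁ 0 le_rfl 0)
  have hM₂ : 0 ≤ M₂ := (abs_nonneg _).trans (h₂ 0 le_rfl 0)
  refine ⟨M₁ + M₁ + M₂ + 1, by positivity, fun i j k t ht x => ?_⟩
  have hle : ∀ c a M : ℝ, |c| ≤ 1 → |a| ≤ M → |c * a| ≤ M := fun c a M hc ha => by
    rw [abs_mul]
    exact (mul_le_of_le_one_left (abs_nonneg _) hc).trans ha
  have hv : ∀ i, |v t x i| ≤ M₁ := fun i => (PiLp.norm_apply_le (v t x) i).trans (h₁ t ht x)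
  have hite : ∀ p : Prop, [Decidable p] → |(if p then 1 else 0 : ℝ)| ≤ 1 := fun p _ => by
    split_ifs <;> simp
  have hlc : |leviCivita i j k| ≤ 1 := by
    fin_cases i <;> fin_cases j <;> fin_cases k <;> norm_num [leviCivita]
  have e1 := hle _ _ _ (hite (j = k)) (hv i)
  have e2 := hle _ _ _ (hite (i = k)) (hv j)
  have e3 := hle _ _ _ hlc (h₂ t ht x)
  rw [dynamoCoeff]
  rw [abs_le] at e1 e2 e3 ⊢
  constructor <;> linarith [e1.1, e1.2, e2.1, e2.2, e3.1, e3.2]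

theorem hasDerivWithinAt_vec3_iff {J : Set ℝ} {t : ℝ} {g : ℝ → Vec3 ℝ} {g' : Vec3 ℝ} :
    HasDerivWithinAt g g' J t ↔ ∀ i, HasDerivWithinAt (fun s => g s i) (g' i) J t := by
  simp only [hasDerivWithinAt_iff_hasFDerivWithinAt, hasFDerivWithinAt_euclidean]
  refine forall_congr' fun i => ?_
  have : (PiLp.proj 2 (fun _ : Fin 3 => ℝ) i).comp (ContinuousLinearMap.toSpanSingleton ℝ g')
      = ContinuousLinearMap.toSpanSingleton ℝ (g' i) := by
    ext; simp
  rw [this]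

/-- Smooth solutions of the induction equation solve the system in divergence form. -/
theorem IsSmoothSolution.solvesWithFlux {v : ℝ → Vec3 ℝ → Vec3 ℝ} {α : ℝ → Vec3 ℝ → ℝ} {β T : ℝ}
    (hT : 0 < T) (hv : ContDiffOn ℝ ∞ (fun p : ℝ × Vec3 ℝ => v p.1 p.2) (Ici 0 ×ˢ univ))
    (hα : ContDiffOn ℝ ∞ (fun p : ℝ × Vec3 ℝ => α p.1 p.2) (Ici 0 ×ˢ univ)) {J : Set ℝ}
    (hJ : Icc 0 T ⊆ J) {B : ℝ → Vec3 ℝ → Vec3 ℝ}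
    (hB : IsSmoothSolution (fun t B => inductionRHS (v t) (α t) β B) J B) :
    SolvesWithFlux β T (components B) (linearFlux (dynamoCoeff v α) (components B)) := by
  have hs := fun i => (smoothField_components (uniqueDiffOn_Icc hT)
    (hB.1.mono (prod_mono hJ Subset.rfl)) i).of_le (by simp : (0 : ℕ∞ω) ≤ ∞)
  refine ⟨hs, smooth_linearFlux (by simp) (fun i j k => ((smooth_dynamoCoeff hv hα i j k).mono
    Icc_subset_Ici_self).of_le (by simp)) hs, fun i t ht x => ?_⟩
  have hd := (hB.2 t (hJ ht) x).mono hJ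
  rw [hasDerivWithinAt_vec3_iff] at hd
  refine (hd i).congr_deriv ?_
  exact inductionRHS_apply (contDiff_slice hv ht.1) (contDiff_slice hα ht.1) β
    (contDiff_slice hB.1 (hJ ht)) (fun i => rfl) x i

theorem HasFiniteEnergy.l2BoundedOn {J : Set ℝ} {B : ℝ → Vec3 ℝ → Vec3 ℝ}
    (hB : HasFiniteEnergy J B) (hs : ContDiffOn ℝ ∞ (fun p : ℝ × Vec3 ℝ => B p.1 p.2) (J ×ˢ univ))
    {T : ℝ} (hT : T ∈ J) (hJ : Icc 0 T ⊆ J) : ∃ M, L2BoundedOn T M (components B) := by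
  obtain ⟨M, hM⟩ := hB T hT
  refine ⟨(M : ℝ) ^ 2, fun t ht φ hφ hc h1 => ?_⟩
  refine jetEnergy_zero_le_of_eLpNorm_le (contDiff_slice hs (hJ ht)) M.2 ?_ hφ hc h1
  simpa using hM t (hJ ht) ht.2

theorem IsTimeInterval.exists_Icc {J : Set ℝ} (hJ : IsTimeInterval J) {t : ℝ} (ht : t ∈ J) :
    ∃ T, 0 < T ∧ t ∈ Icc 0 T ∧ T ∈ J ∧ Icc 0 T ⊆ J := by
  obtain ⟨h0, hsub, hoc, hnt⟩ := hJ
  obtain ⟨s, hs, hs0⟩ := hnt.exists_ne 0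
  have hspos : 0 < s := lt_of_le_of_ne (hsub hs) (Ne.symm hs0)
  have hmax : max s t ∈ J := by rcases max_choice s t with h | h <;> rw [h] <;> assumption
  exact ⟨max s t, lt_max_of_lt_left hspos, ⟨hsub ht, le_max_right _ _⟩, hmax, hoc.out h0 hmax⟩

/-- Uniqueness for the induction equation in the class of fields of finite energy. -/
theorem IsSmoothSolution.eq_of_finiteEnergy {v : ℝ → Vec3 ℝ → Vec3 ℝ} {α : ℝ → Vec3 ℝ → ℝ} {β : ℝ}
    (hβ : 0 < β) (hv : ContDiffOn ℝ ∞ (fun p : ℝ × Vec3 ℝ => v p.1 p.2) (Ici 0 ×ˢ univ))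
    (hα : ContDiffOn ℝ ∞ (fun p : ℝ × Vec3 ℝ => α p.1 p.2) (Ici 0 ×ˢ univ))
    {A : ℝ} (hA : ∀ i j k, ∀ t, 0 ≤ t → ∀ x, |dynamoCoeff v α i j k t x| ≤ A)
    {J : Set ℝ} (hJ : IsTimeInterval J) {B₁ B₂ : ℝ → Vec3 ℝ → Vec3 ℝ}
    (h₁ : IsSmoothSolution (fun t B => inductionRHS (v t) (α t) β B) J B₁)
    (he₁ : HasFiniteEnergy J B₁)
    (h₂ : IsSmoothSolution (fun t B => inductionRHS (v t) (α t) β B) J B₂)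
    (he₂ : HasFiniteEnergy J B₂) (h0 : B₁ 0 = B₂ 0) : ∀ t ∈ J, B₁ t = B₂ t := by
  intro t ht
  obtain ⟨T, hT, htT, hTJ, hsub⟩ := hJ.exists_Icc ht
  have s₁ := h₁.solvesWithFlux hT hv hα hsub
  have s₂ := h₂.solvesWithFlux hT hv hα hsub
  obtain ⟨M₁, hM₁⟩ := he₁.l2BoundedOn h₁.1 hTJ hsub
  obtain ⟨M₂, hM₂⟩ := he₂.l2BoundedOn h₂.1 hTJ hsub
  have hs := (s₁.sub s₂).congr_flux (H := linearFlux (dynamoCoeff v α)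
    (fun i t x => components B₁ i t x - components B₂ i t x)) fun i j t _ => funext fun x => by
      simp only [linearFlux, ← Finset.sum_sub_distrib, mul_sub]
  have hz := hs.eq_zero_of_linearFlux hβ (fun i j k => ((smooth_dynamoCoeff hv hα i j k).mono
    Icc_subset_Ici_self).of_le (by simp)) (fun i j k t ht x => hA i j k t ht.1 x)
    (hM₁.sub hM₂ s₁.smooth s₂.smooth) (fun i x => by simp [components, h0])
  ext x i
  exact sub_eq_zero.1 (hz i t htT x)

/-- Global existence for the induction equation, with exponential growth of the energy. -/
theorem exists_induction_solution {v : ℝ → Vec3 ℝ → Vec3 ℝ} {α : ℝ → Vec3 ℝ → ℝ} {β : ℝ}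
    (hβ : 0 < β) (hv : ContDiffOn ℝ ∞ (fun p : ℝ × Vec3 ℝ => v p.1 p.2) (Ici 0 ×ˢ univ))
    (hα : ContDiffOn ℝ ∞ (fun p : ℝ × Vec3 ℝ => α p.1 p.2) (Ici 0 ×ˢ univ))
    {A : ℝ} (hA0 : 0 < A) (hA : ∀ i j k, ∀ t, 0 ≤ t → ∀ x, |dynamoCoeff v α i j k t x| ≤ A)
    {f : Vec3 ℝ → Vec3 ℝ} (hf : ContDiff ℝ ∞ f) (hf2 : MemLp f 2 volume) :
    ∃ B : ℝ → Vec3 ℝ → Vec3 ℝ,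
      IsSmoothSolution (fun t B => inductionRHS (v t) (α t) β B) (Ici 0) B ∧
      HasFiniteEnergy (Ici 0) B ∧ B 0 = f ∧ ∀ t ∈ Ici (0 : ℝ), eLpNorm (B t) 2 volume
        ≤ ENNReal.ofReal (1 * Real.exp (growthRate β A / 2 * t)) * eLpNorm f 2 volume := by
  set N := (eLpNorm f 2 volume).toReal with hN
  have hN0 : 0 ≤ N := ENNReal.toReal_nonneg
  have hNf : ENNReal.ofReal N = eLpNorm f 2 volume := ENNReal.ofReal_toReal hf2.eLpNorm_ne_top
  have hl0 : 0 ≤ growthRate β A := mul_nonneg (energyConst_pos hβ).le (by positivity)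
  have ha := smooth_dynamoCoeff hv hα
  obtain ⟨u, hu, hsol, h0, hen⟩ := exists_linear_solution (F := N ^ 2) hβ hA0
    (fun i j k => (ha i j k).of_le (by simp)) hA (contDiff_component hf)
    fun φ hφ hc h1 => jetEnergy_zero_le_of_eLpNorm_le hf hN0 hNf.ge hφ hc h1
  set B : ℝ → Vec3 ℝ → Vec3 ℝ := fun t x => WithLp.toLp 2 fun i => u i t x with hBdef
  have hBsm : ContDiffOn ℝ ∞ (fun p : ℝ × Vec3 ℝ => B p.1 p.2) (Ici 0 ×ˢ univ) :=
    contDiffOn_Ici_of_Icc fun T hT => contDiffOn_euclidean.2 fun i =>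
      (hsol T).contDiffOn hT (fun i j k => (ha i j k).mono Icc_subset_Ici_self) i
  have hnorm : ∀ t ∈ Ici (0 : ℝ), eLpNorm (B t) 2 volume
        ≤ ENNReal.ofReal (1 * Real.exp (growthRate β A / 2 * t)) * eLpNorm f 2 volume := by
    intro t ht
    rw [one_mul, ← hNf, ← ENNReal.ofReal_mul (Real.exp_pos _).le]
    refine eLpNorm_le_of_jetEnergy_zero_le (contDiff_slice hBsm ht) (by positivity)
      fun φ hφ hc h1 => (hen t ht φ hφ hc h1).trans (le_of_eq ?_)
    rw [mul_pow, ← Real.exp_nat_mul, mul_comm]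
    congr 2
    push_cast
    ring
  refine ⟨B, ⟨hBsm, fun t ht x => ?_⟩, fun T hT => ?_, ?_, hnorm⟩
  · have ht0 : (0 : ℝ) ≤ t := ht
    rw [hasDerivWithinAt_vec3_iff]
    intro i
    rw [inductionRHS_apply (contDiff_slice hv ht) (contDiff_slice hα ht) β (u := u)
      (contDiff_slice hBsm ht) (fun i => rfl) x i]
    exact ((hsol (t + 1)).hasDeriv i t ⟨ht0, by linarith⟩ x).mono_of_mem_nhdsWithin
      (inter_mem_nhdsWithin _ (Iic_mem_nhds (by linarith)))
  · refine ⟨(Real.exp (growthRate β A / 2 * T) * N).toNNReal, fun t ht htT => ?_⟩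
    refine (hnorm t ht).trans ?_
    rw [← hNf, one_mul, ← ENNReal.ofReal_mul (Real.exp_pos _).le]
    refine ENNReal.ofReal_le_ofReal (mul_le_mul_of_nonneg_right ?_ hN0)
    exact Real.exp_le_exp.2 (mul_le_mul_of_nonneg_left htT (by positivity))
  · ext x i
    exact congrFun (h0 i) x

/-! ### The divergence of solutions -/

/-- The divergence of a field given by its components. -/
def divergenceOf (u : Fin 3 → ℝ → Vec3 ℝ → ℝ) (t : ℝ) (x : Vec3 ℝ) : ℝ :=
  ∑ i, partialDeriv i (u i t) x

theorem smooth_divergenceOf {m : ℕ∞ω} (hm : m ≤ ∞) {J : Set ℝ} {u : Fin 3 → ℝ → Vec3 ℝ → ℝ}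
    (hu : ∀ i, SmoothField m J (u i)) : SmoothField m J (divergenceOf u) :=
  SmoothField.sum _ (fun i => (hu i).partialDeriv i) hm

theorem sum_partialDeriv_partialDeriv_eq_zero {G : Fin 3 → Fin 3 → Vec3 ℝ → ℝ}
    (hG : ∀ i j, ContDiff ℝ ∞ (G i j)) (hanti : ∀ i j, G j i = fun x => (-1) * G i j x)
    (x : Vec3 ℝ) : ∑ i, ∑ j, partialDeriv i (partialDeriv j (G i j)) x = 0 := by
  have h : ∑ i, ∑ j, partialDeriv i (partialDeriv j (G i j)) x
      = -∑ i, ∑ j, partialDeriv i (partialDeriv j (G i j)) x := by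
    conv_lhs => rw [Finset.sum_comm]
    rw [← Finset.sum_neg_distrib]
    refine Finset.sum_congr rfl fun i _ => ?_
    rw [← Finset.sum_neg_distrib]
    refine Finset.sum_congr rfl fun j _ => ?_
    rw [hanti i j, partialDeriv_const_mul (hG i j).differentiable_field,
      partialDeriv_const_mul ((hG i j).partialDeriv i).differentiable_field,
      partialDeriv_comm (hG i j) j i]
    ring
  linarith

/-- The divergence of a solution of a system with antisymmetric flux solves the heat equation. -/
theorem SolvesWithFlux.hasDerivWithinAt_divergence {β T : ℝ} {u : Fin 3 → ℝ → Vec3 ℝ → ℝ}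
    {G : Fin 3 → Fin 3 → ℝ → Vec3 ℝ → ℝ} (h : SolvesWithFlux β T u G)
    (hanti : ∀ i j t x, G j i t x = -G i j t x) {t : ℝ} (ht : t ∈ Icc 0 T) (x : Vec3 ℝ) :
    HasDerivWithinAt (fun s => divergenceOf u s x) (β * laplacianSum (divergenceOf u t) x)
      (Icc 0 T) t := by
  have hus := h.smooth
  have hGs := h.smooth_flux
  have hΔ := fun i => (hus i).laplacianSum (by simp)
  have hdG : ∀ i, SmoothField 0 (Icc 0 T) fun t x => ∑ j, partialDeriv j (G i j t) x := fun i =>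
    SmoothField.sum _ (fun j => (hGs i j).partialDeriv j) (by simp)
  have hd := fun i => (hus i).hasDerivWithinAt_partialDeriv
    (((hΔ i).const_mul (by simp) β).add (hdG i)) (h.hasDeriv i) i t ht x
  refine (HasDerivWithinAt.fun_sum fun i _ => hd i).congr_deriv ?_
  have hut := fun i => (hus i).contDiff t ht
  have hGt := fun i j => (hGs i j).contDiff t ht
  have e1 : ∀ i, partialDeriv i (fun x => β * laplacianSum (u i t) x
      + ∑ j, partialDeriv j (G i j t) x) x
      = β * (∑ l, partialDeriv i (partialDeriv l (partialDeriv l (u i t))) x)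
        + ∑ j, partialDeriv i (partialDeriv j (G i j t)) x := by
    intro i
    have hl : laplacianSum (u i t) = fun x => ∑ l, partialDeriv l (partialDeriv l (u i t)) x := rfl
    rw [partialDeriv_add (((hΔ i).contDiff t ht).differentiable_field.const_mul β)
      ((hdG i).contDiff t ht).differentiable_field,
      partialDeriv_const_mul ((hΔ i).contDiff t ht).differentiable_field,
      partialDeriv_sum _ fun j => ((hGt i j).partialDeriv j).differentiable_field, hl,
      partialDeriv_sum _ fun l => (((hut i).partialDeriv l).partialDeriv l).differentiable_field]
  have hc : divergenceOf u t = fun x => ∑ i, partialDeriv i (u i t) x := rfl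
  have e2 : laplacianSum (divergenceOf u t) x
      = ∑ i, ∑ l, partialDeriv i (partialDeriv l (partialDeriv l (u i t))) x := by
    rw [laplacianSum, Finset.sum_comm]
    refine Finset.sum_congr rfl fun l _ => ?_
    rw [hc, partialDeriv_sum _ fun i => ((hut i).partialDeriv i).differentiable_field,
      partialDeriv_sum _ fun i => (((hut i).partialDeriv i).partialDeriv l).differentiable_field]
    refine Finset.sum_congr rfl fun i _ => ?_
    rw [partialDeriv_comm (hut i) l i, partialDeriv_comm ((hut i).partialDeriv l) l i]
  simp only [e1]
  rw [Finset.sum_add_distrib, ← Finset.mul_sum, e2, sum_partialDeriv_partialDeriv_eq_zero hGt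
    (fun i j => funext fun x => by rw [hanti i j t x, neg_one_mul]), add_zero]

/-- A solution bounded in `L²` with antisymmetric linear flux that starts divergence-free remains
so. The energy inequality bounds the space-time integral of `|∇u|²`, hence of the square of the
divergence, and for solutions of the heat equation with this bound the localized energy on the
ball of radius `R` is `O(R⁻²)`. -/
theorem SolvesWithFlux.divergence_eq_zero {β T M A : ℝ} (hβ : 0 < β)
    {a : Fin 3 → Fin 3 → Fin 3 → ℝ → Vec3 ℝ → ℝ} (ha : ∀ i j k, SmoothField 0 (Icc 0 T) (a i j k))
    (hA : ∀ i j k, ∀ t ∈ Icc 0 T, ∀ x, |a i j k t x| ≤ A)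
    (hanti : ∀ i j k t x, a j i k t x = -a i j k t x) {u : Fin 3 → ℝ → Vec3 ℝ → ℝ}
    (h : SolvesWithFlux β T u (linearFlux a u)) (hM : L2BoundedOn T M u)
    (h0 : ∀ x, divergenceOf u 0 x = 0) : ∀ t ∈ Icc 0 T, ∀ x, divergenceOf u t x = 0 := by
  intro t ht x
  have hT : 0 ≤ T := ht.1.trans ht.2
  have hsm := smooth_divergenceOf (by simp) h.smooth
  have hlin : ∀ i j t x, linearFlux a u j i t x = -linearFlux a u i j t x := fun i j t x => by
    simp only [linearFlux, hanti i j, neg_mul, Finset.sum_neg_distrib]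
  set w : Fin 3 → ℝ → Vec3 ℝ → ℝ := fun _ => divergenceOf u with hw
  have hws : SolvesWithFlux β T w (fun _ _ _ _ => 0) := by
    refine ⟨fun _ => hsm, fun _ _ => SmoothField.of_contDiff contDiff_const (by simp),
      fun i t ht x => (h.hasDerivWithinAt_divergence hlin ht x).congr_deriv ?_⟩
    simp [partialDeriv_const, hw]
  obtain ⟨c, hc, hen⟩ := exists_energy_ballCutoff hβ
  obtain ⟨c', hc', hgrad⟩ := exists_ballCutoff_gradient_le
  have hC := energyConst_pos hβ
  have hM0 : 0 ≤ M := (jetEnergy_nonneg _ _ _).trans (hM t ht (fun _ => 0) continuous_const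
    HasCompactSupport.zero (by simp))
  set K := M + energyConst β * (T * (27 * A ^ 2 * M)) + c * M * T with hK
  have hK0 : 0 ≤ K := by positivity
  -- the space-time integral of the dissipation is bounded on balls of radius at least one
  have hdiss : ∀ R, 1 ≤ R → ∀ t ∈ Icc 0 T,
      β * ∫ s in (0 : ℝ)..t, jetDissipation 0 (ballCutoff R) (fun i => u i s) ≤ K := by
    intro R hR1 t ht
    have hR : 0 < R := one_pos.trans_le hR1
    have hφR := (ballCutoff_contDiff R).continuous
    have hcR := ballCutoff_hasCompactSupport hR
    have h1 := hen T M u _ h hM R hR t ht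
    have h2 : ∫ s in (0 : ℝ)..t, fluxEnergy 0 (ballCutoff R) (fun i j => linearFlux a u i j s)
        ≤ ∫ _s in (0 : ℝ)..t, 27 * A ^ 2 * M := by
      refine intervalIntegral.integral_mono_on ht.1
        ((continuousOn_fluxEnergy h.smooth_flux 0 hφR hcR).intervalIntegrable_zero ht)
        intervalIntegrable_const fun s hs => ?_
      have hs' : s ∈ Icc 0 T := ⟨hs.1, hs.2.trans ht.2⟩
      exact (fluxEnergy_linearFlux_le hs' ha h.smooth (fun i j k x => hA i j k s hs' x) hφR
        hcR).trans (mul_le_mul_of_nonneg_left (hM s hs' _ hφR hcR (ballCutoff_sq_le_one R))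
          (by positivity))
    rw [intervalIntegral.integral_const, sub_zero, smul_eq_mul] at h2
    have h3 : t * (27 * A ^ 2 * M) ≤ T * (27 * A ^ 2 * M) :=
      mul_le_mul_of_nonneg_right ht.2 (by positivity)
    have h4 := mul_le_mul_of_nonneg_left (h2.trans h3) hC.le
    have h5 := hM 0 ⟨le_rfl, hT⟩ _ hφR hcR (ballCutoff_sq_le_one R)
    have h6 : c * M * T / R ^ 2 ≤ c * M * T :=
      div_le_self (by positivity) (one_le_pow₀ hR1)
    have h7 := jetEnergy_nonneg 0 (ballCutoff R) (fun i => u i t)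
    linarith
  have hwdiss : ∀ R, 0 < R → ∀ s ∈ Icc 0 T, jetEnergy 0 (ballCutoff R) (fun i => w i s)
      ≤ 9 * jetDissipation 0 (ballCutoff R) (fun i => u i s) := by
    intro R hR s hs
    have hφR := (ballCutoff_contDiff R).continuous
    have hcR := ballCutoff_hasCompactSupport hR
    have hp : ∀ i l, Continuous (sqJet 0 (partialDeriv l (u i s))) := fun i l =>
      continuous_sqJet 0 (((h.smooth i).contDiff s hs).partialDeriv l)
    have h1 : cutoffIntegral (ballCutoff R) (sqJet 0 (divergenceOf u s))
        ≤ 3 * jetDissipation 0 (ballCutoff R) (fun i => u i s) := by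
      have e : jetDissipation 0 (ballCutoff R) (fun i => u i s) = cutoffIntegral (ballCutoff R)
          (fun x => ∑ i, ∑ l, sqJet 0 (partialDeriv l (u i s)) x) := by
        rw [cutoffIntegral_sum (f := fun i x => ∑ l, sqJet 0 (partialDeriv l (u i s)) x) _ hφR hcR
          fun i => continuous_finsetSum _ fun l _ => hp i l]
        exact Finset.sum_congr rfl fun i _ =>
          (cutoffIntegral_sum (f := fun l => sqJet 0 (partialDeriv l (u i s))) _ hφR hcR
            (hp i)).symm
      rw [e, ← cutoffIntegral_const_mul]
      refine cutoffIntegral_mono hφR hcR (continuous_sqJet 0 (hsm.contDiff s hs))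
        (continuous_const.mul (continuous_finsetSum _ fun i _ => continuous_finsetSum _
          fun l _ => hp i l)) fun y _ => ?_
      simp only [sqJet, divergenceOf]
      refine sq_sum_le_card_mul_sum_sq.trans ?_
      simp only [Finset.card_univ, Fintype.card_fin]
      refine mul_le_mul_of_nonneg_left (Finset.sum_le_sum fun i _ => ?_) (by norm_num)
      exact Finset.single_le_sum (f := fun l => partialDeriv l (u i s) y ^ 2)
        (fun l _ => sq_nonneg _) (Finset.mem_univ i)
    have h2 : jetEnergy 0 (ballCutoff R) (fun i => w i s)
        = 3 * cutoffIntegral (ballCutoff R) (sqJet 0 (divergenceOf u s)) := by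
      simp [jetEnergy, hw]
    rw [h2]
    linarith
  refine eq_zero_of_jetEnergy_nonpos (w := fun i => w i t) (fun i => hsm.contDiff t ht)
    (fun φ hφ hcφ h1 => ?_) 0 x
  refine jetEnergy_le_of_ballCutoff (D := energyConst β * (27 * c') * (K / β))
    (fun i => hsm.contDiff t ht) (fun R hR1 => ?_) hφ hcφ h1
  have hR : 0 < R := one_pos.trans_le hR1
  have h2R : 0 < 2 * R := by positivity
  have hφR := ballCutoff_contDiff R
  have hcR := ballCutoff_hasCompactSupport hR
  have hφ2 := (ballCutoff_contDiff (2 * R)).continuous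
  have hc2 := ballCutoff_hasCompactSupport h2R
  have h2 := hws.energy hβ 0 hφR hcR ht
  have e1 : jetEnergy 0 (ballCutoff R) (fun i => w i 0) = 0 := by
    have : divergenceOf u 0 = fun _ => 0 := funext h0
    simp [hw, jetEnergy, this, cutoffIntegral, sqJet]
  have e2 : fluxEnergy 0 (ballCutoff R) (fun _ _ _ => 0) = 0 := by
    simp [fluxEnergy, cutoffIntegral, sqJet]
  have e3 : 0 ≤ β * ∫ s in (0 : ℝ)..t, jetDissipation 0 (ballCutoff R) (fun i => w i s) :=
    mul_nonneg hβ.le (intervalIntegral.integral_nonneg ht.1 fun r _ => jetDissipation_nonneg _ _ _)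
  simp only [e1, e2, add_zero, zero_add] at h2 ⊢
  have h3 : ∫ s in (0 : ℝ)..t, ∑ l, jetEnergy 0 (partialDeriv l (ballCutoff R)) (fun i => w i s)
      ≤ ∫ s in (0 : ℝ)..t, 27 * c' / R ^ 2
        * jetDissipation 0 (ballCutoff (2 * R)) (fun i => u i s) := by
    refine intervalIntegral.integral_mono_on ht.1
      ((continuousOn_finsetSum _ fun l _ => continuousOn_jetEnergy (fun _ => hsm) 0
        (hφR.partialDeriv l).continuous (hcR.partialDeriv l)).intervalIntegrable_zero ht)
      ((continuousOn_const.mul (continuousOn_jetDissipation h.smooth 0 hφ2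
        hc2)).intervalIntegrable_zero ht) fun s hs => ?_
    have hs' : s ∈ Icc 0 T := ⟨hs.1, hs.2.trans ht.2⟩
    have h4 : ∀ l, jetEnergy 0 (partialDeriv l (ballCutoff R)) (fun i => w i s)
        ≤ c' / R ^ 2 * (9 * jetDissipation 0 (ballCutoff (2 * R)) (fun i => u i s)) := fun l =>
      (jetEnergy_mono_cutoff (hφR.partialDeriv l).continuous (hcR.partialDeriv l) hφ2 hc2
        (fun i => hsm.contDiff s hs') (hgrad R hR l)).trans
        (mul_le_mul_of_nonneg_left (hwdiss (2 * R) h2R s hs') (by positivity))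
    refine (Finset.sum_le_sum fun l _ => h4 l).trans (le_of_eq ?_)
    simp
    ring
  rw [intervalIntegral.integral_const_mul] at h3
  have h5 := hdiss (2 * R) (by linarith) t ht
  have h6 : ∫ s in (0 : ℝ)..t, jetDissipation 0 (ballCutoff (2 * R)) (fun i => u i s) ≤ K / β := by
    rw [le_div_iff₀ hβ]; linarith
  have h7 := mul_le_mul_of_nonneg_left (h3.trans (mul_le_mul_of_nonneg_left h6
    (by positivity : 0 ≤ 27 * c' / R ^ 2))) hC.le
  have h8 : energyConst β * (27 * c' / R ^ 2 * (K / β))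
      = energyConst β * (27 * c') * (K / β) / R ^ 2 := by ring
  linarith

/-! ### The constraint -/

theorem IsTimeInterval.exists_Icc_mem_nhdsWithin {J : Set ℝ} (hJ : IsTimeInterval J) {t : ℝ}
    (ht : t ∈ J) : ∃ T, 0 < T ∧ t ∈ Icc 0 T ∧ Icc 0 T ⊆ J ∧ Icc 0 T ∈ 𝓝[J] t := by
  obtain ⟨h0, hsub, hoc, hnt⟩ := id hJ
  have ht0 : (0 : ℝ) ≤ t := hsub ht
  by_cases h : ∃ s ∈ J, t < s
  · obtain ⟨s, hs, hts⟩ := h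
    refine ⟨s, ht0.trans_lt hts, ⟨ht0, hts.le⟩, hoc.out h0 hs, ?_⟩
    filter_upwards [self_mem_nhdsWithin,
      mem_nhdsWithin_of_mem_nhds (Iio_mem_nhds hts)] with r hr hrs
    exact ⟨hsub hr, le_of_lt hrs⟩
  · push Not at h
    obtain ⟨s, hs, hs0⟩ := hnt.exists_ne 0
    have hspos : 0 < s := lt_of_le_of_ne (hsub hs) (Ne.symm hs0)
    refine ⟨t, hspos.trans_le (h s hs), ⟨ht0, le_rfl⟩, hoc.out h0 ht, ?_⟩
    filter_upwards [self_mem_nhdsWithin] with r hr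
    exact ⟨hsub hr, h r hr⟩

theorem contDiff_divergence {B : Vec3 ℝ → Vec3 ℝ} (hB : ContDiff ℝ ∞ B) :
    ContDiff ℝ ∞ (divergence B) :=
  ContDiff.sum fun i _ => (contDiff_component hB i).partialDeriv i

theorem linearFlux_dynamoCoeff_swap (v : ℝ → Vec3 ℝ → Vec3 ℝ) (α : ℝ → Vec3 ℝ → ℝ)
    (u : Fin 3 → ℝ → Vec3 ℝ → ℝ) (i j : Fin 3) (t : ℝ) (x : Vec3 ℝ) :
    linearFlux (dynamoCoeff v α) u j i t x = -linearFlux (dynamoCoeff v α) u i j t x := by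
  simp only [linearFlux, dynamoCoeff_swap v α i j, neg_mul, Finset.sum_neg_distrib]

theorem IsSmoothSolution.hasDerivWithinAt_divergence {v : ℝ → Vec3 ℝ → Vec3 ℝ}
    {α : ℝ → Vec3 ℝ → ℝ} {β : ℝ}
    (hv : ContDiffOn ℝ ∞ (fun p : ℝ × Vec3 ℝ => v p.1 p.2) (Ici 0 ×ˢ univ))
    (hα : ContDiffOn ℝ ∞ (fun p : ℝ × Vec3 ℝ => α p.1 p.2) (Ici 0 ×ˢ univ))
    {J : Set ℝ} (hJ : IsTimeInterval J) {B : ℝ → Vec3 ℝ → Vec3 ℝ}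
    (hB : IsSmoothSolution (fun t B => inductionRHS (v t) (α t) β B) J B) {t : ℝ} (ht : t ∈ J)
    (x : Vec3 ℝ) : HasDerivWithinAt (fun s => divergence (B s) x)
      (β * Laplacian.laplacian (divergence (B t)) x) J t := by
  obtain ⟨T, hT, htT, hsub, hmem⟩ := hJ.exists_Icc_mem_nhdsWithin ht
  rw [laplacian_eq_laplacianSum (contDiff_divergence (contDiff_slice hB.1 ht))]
  exact ((hB.solvesWithFlux hT hv hα hsub).hasDerivWithinAt_divergence
    (linearFlux_dynamoCoeff_swap v α _) htT x).mono_of_mem_nhdsWithin hmem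

theorem IsSmoothSolution.divergence_eq_zero {v : ℝ → Vec3 ℝ → Vec3 ℝ}
    {α : ℝ → Vec3 ℝ → ℝ} {β : ℝ} (hβ : 0 < β)
    (hv : ContDiffOn ℝ ∞ (fun p : ℝ × Vec3 ℝ => v p.1 p.2) (Ici 0 ×ˢ univ))
    (hα : ContDiffOn ℝ ∞ (fun p : ℝ × Vec3 ℝ => α p.1 p.2) (Ici 0 ×ˢ univ))
    {A : ℝ} (hA : ∀ i j k, ∀ t, 0 ≤ t → ∀ x, |dynamoCoeff v α i j k t x| ≤ A)
    {J : Set ℝ} (hJ : IsTimeInterval J) {B : ℝ → Vec3 ℝ → Vec3 ℝ}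
    (hB : IsSmoothSolution (fun t B => inductionRHS (v t) (α t) β B) J B)
    (he : HasFiniteEnergy J B) (h0 : ∀ x, divergence (B 0) x = 0) {t : ℝ} (ht : t ∈ J)
    (x : Vec3 ℝ) : divergence (B t) x = 0 := by
  obtain ⟨T, hT, htT, hTJ, hsub⟩ := hJ.exists_Icc ht
  obtain ⟨M, hM⟩ := he.l2BoundedOn hB.1 hTJ hsub
  exact (hB.solvesWithFlux hT hv hα hsub).divergence_eq_zero hβ
    (fun i j k => ((smooth_dynamoCoeff hv hα i j k).mono Icc_subset_Ici_self).of_le (by simp))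
    (fun i j k t ht x => hA i j k t ht.1 x) (dynamoCoeff_swap v α) hM h0 t htT x

/-! ### Well-posedness -/

theorem isTimeInterval_Ici : IsTimeInterval (Ici 0) :=
  ⟨self_mem_Ici, Subset.rfl, ordConnected_Ici,
    ⟨0, self_mem_Ici, 1, mem_Ici.2 zero_le_one, zero_ne_one⟩⟩

theorem isL2WellPosed_inductionRHS {v : ℝ → Vec3 ℝ → Vec3 ℝ} {α : ℝ → Vec3 ℝ → ℝ} {β : ℝ}
    (hβ : 0 < β) (hv : ContDiffOn ℝ ∞ (fun p : ℝ × Vec3 ℝ => v p.1 p.2) (Ici 0 ×ˢ univ))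
    (hα : ContDiffOn ℝ ∞ (fun p : ℝ × Vec3 ℝ => α p.1 p.2) (Ici 0 ×ˢ univ))
    {A : ℝ} (hA0 : 0 < A) (hA : ∀ i j k, ∀ t, 0 ≤ t → ∀ x, |dynamoCoeff v α i j k t x| ≤ A) :
    IsL2WellPosed (fun t B => inductionRHS (v t) (α t) β B) univ := by
  -- the energy grows at most at the rate `growthRate β A`, the norm at half that rate
  refine ⟨1, growthRate β A / 2, fun f hf hf2 _ => ⟨?_, ?_⟩⟩
  · obtain ⟨B, hB, he, h0, hn⟩ := exists_induction_solution hβ hv hα hA0 hA hf hf2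
    exact ⟨B, hB, he, fun _ _ => mem_univ _, h0, hn⟩
  · intro J hJ B₁ B₂ h₁ he₁ _ h01 h₂ he₂ _ h02
    exact h₁.eq_of_finiteEnergy hβ hv hα hA hJ he₁ h₂ he₂ (h01.trans h02.symm)

theorem isL2WellPosed_dynamoRHS {v : ℝ → Vec3 ℝ → Vec3 ℝ} {α : ℝ → Vec3 ℝ → ℝ} {β : ℝ}
    (hβ : 0 < β) (hv : ContDiffOn ℝ ∞ (fun p : ℝ × Vec3 ℝ => v p.1 p.2) (Ici 0 ×ˢ univ))
    (hα : ContDiffOn ℝ ∞ (fun p : ℝ × Vec3 ℝ => α p.1 p.2) (Ici 0 ×ˢ univ))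
    {A : ℝ} (hA0 : 0 < A) (hA : ∀ i j k, ∀ t, 0 ≤ t → ∀ x, |dynamoCoeff v α i j k t x| ≤ A) :
    IsL2WellPosed (fun t B => dynamoRHS (v t) (α t) β B)
      {B | ∀ x : Vec3 ℝ, divergence B x = 0} := by
  refine ⟨1, growthRate β A / 2, fun f hf hf2 hdiv => ⟨?_, ?_⟩⟩
  · obtain ⟨B, hB, he, h0, hn⟩ := exists_induction_solution hβ hv hα hA0 hA hf hf2
    have hBdiv : ∀ t ∈ Ici (0 : ℝ), ∀ x, divergence (B t) x = 0 := fun t ht x =>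
      hB.divergence_eq_zero hβ hv hα hA isTimeInterval_Ici he (by rw [h0]; exact hdiv) ht x
    refine ⟨B, ⟨hB.1, fun t ht x => ?_⟩, he, hBdiv, h0, hn⟩
    simp only
    rw [dynamoRHS_eq_inductionRHS (contDiff_slice hα ht) β (contDiff_slice hB.1 ht) (hBdiv t ht)]
    exact hB.2 t ht x
  · intro J hJ B₁ B₂ h₁ he₁ hd₁ h01 h₂ he₂ hd₂ h02
    have hconv : ∀ B : ℝ → Vec3 ℝ → Vec3 ℝ,
        IsSmoothSolution (fun t B => dynamoRHS (v t) (α t) β B) J B →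
        (∀ t ∈ J, ∀ x, divergence (B t) x = 0) →
        IsSmoothSolution (fun t B => inductionRHS (v t) (α t) β B) J B := by
      intro B hB hd
      refine ⟨hB.1, fun t ht x => ?_⟩
      simp only
      rw [← dynamoRHS_eq_inductionRHS (contDiff_slice hα (hJ.2.1 ht)) β
        (contDiff_slice hB.1 ht) (hd t ht)]
      exact hB.2 t ht x
    exact (hconv B₁ h₁ hd₁).eq_of_finiteEnergy hβ hv hα hA hJ he₁ (hconv B₂ h₂ hd₂) he₂
      (h01.trans h02.symm)

/-! ### Plane waves -/

/-- The phase factor `exp(i(wt + k·x))` of a plane wave. -/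
def phase (k : Vec3 ℝ) (w : ℂ) (t : ℝ) (x : Vec3 ℝ) : ℂ :=
  Complex.exp (Complex.I * (w * (t : ℂ) + ((inner ℝ k x : ℝ) : ℂ)))

variable (k : Vec3 ℝ) (w : ℂ) (t : ℝ) (x : Vec3 ℝ)

theorem phase_ne_zero : phase k w t x ≠ 0 := Complex.exp_ne_zero _

theorem hasFDerivAt_phase : HasFDerivAt (phase k w t)
    ((Complex.I * phase k w t x) • (Complex.ofRealCLM.comp (innerSL ℝ k))) x := by
  have h1 : HasFDerivAt (fun y : Vec3 ℝ => ((inner ℝ k y : ℝ) : ℂ))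
      (Complex.ofRealCLM.comp (innerSL ℝ k)) x :=
    (Complex.ofRealCLM.comp (innerSL ℝ k)).hasFDerivAt
  have h2 := ((h1.const_add (w * (t : ℂ))).const_mul Complex.I).cexp
  refine h2.congr_fderiv ?_
  rw [smul_smul, mul_comm (Complex.exp _)]
  rfl

theorem contDiff_phase : ContDiff ℝ ∞ (phase k w t) := by
  have h1 : ContDiff ℝ ∞ (fun y : Vec3 ℝ => ((inner ℝ k y : ℝ) : ℂ)) :=
    (Complex.ofRealCLM.comp (innerSL ℝ k)).contDiff
  exact (contDiff_const.mul (contDiff_const.add h1)).cexp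

theorem partialDeriv_phase_mul (c : ℂ) (i : Fin 3) :
    partialDeriv i (fun y => phase k w t y * c) x = Complex.I * phase k w t x * (k i : ℂ) * c := by
  rw [partialDeriv, ((hasFDerivAt_phase k w t x).mul_const c).fderiv]
  simp [mul_comm c, mul_assoc, EuclideanSpace.inner_single_right]

theorem curl_phase_smul (c : Vec3 ℂ) :
    curl (fun y => phase k w t y • c) x = (Complex.I * phase k w t x) • cross k c := by
  ext i
  fin_cases i <;>
  simp [curl, cross, cross_apply, partialDeriv_phase_mul] <;> ring

theorem laplacian_phase :
    Laplacian.laplacian (phase k w t) x = -((‖k‖ ^ 2 : ℝ) : ℂ) * phase k w t x := by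
  have h1 : fderiv ℝ (phase k w t) = fun x =>
      (Complex.I * phase k w t x) • (Complex.ofRealCLM.comp (innerSL ℝ k)) :=
    funext fun x => (hasFDerivAt_phase k w t x).fderiv
  have h2 := (((hasFDerivAt_phase k w t x).const_mul Complex.I).smul_const
    (Complex.ofRealCLM.comp (innerSL ℝ k))).fderiv
  rw [← h1] at h2
  rw [InnerProductSpace.laplacian_eq_iteratedFDeriv_orthonormalBasis _
    (EuclideanSpace.basisFun (Fin 3) ℝ)]
  simp only [iteratedFDeriv_two_apply, h2]
  simp [EuclideanSpace.real_norm_sq_eq, Fin.sum_univ_three,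
    EuclideanSpace.inner_single_right]
  linear_combination (k 0 ^ 2 + k 1 ^ 2 + k 2 ^ 2 : ℂ) * phase k w t x * Complex.I_sq

theorem laplacian_phase_smul (b : Vec3 ℂ) :
    Laplacian.laplacian (fun y => phase k w t y • b) x
      = (-((‖k‖ ^ 2 : ℝ) : ℂ) * phase k w t x) • b := by
  have h2 : ContDiffAt ℝ 2 (phase k w t) x :=
    (contDiff_phase k w t).contDiffAt.of_le (WithTop.coe_le_coe.2 (le_top : (2 : ℕ∞) ≤ ⊤))
  have := h2.laplacian_CLM_comp_left
    (l := ((ContinuousLinearMap.toSpanSingleton ℂ b).restrictScalars ℝ))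
  rw [← laplacian_phase]
  exact this

theorem hasDerivAt_phase_smul (b : Vec3 ℂ) :
    HasDerivAt (fun s => phase k w s x • b) ((Complex.I * w * phase k w t x) • b) t := by
  have h1 : HasDerivAt (fun s : ℝ => Complex.I * (w * (s : ℂ) + ((inner ℝ k x : ℝ) : ℂ)))
      (Complex.I * (w * 1)) t :=
    (((Complex.ofRealCLM.hasDerivAt (x := t)).const_mul w).add_const _).const_mul Complex.I
  refine (h1.cexp.smul_const b).congr_deriv ?_
  rw [phase]
  congr 1
  ring

variable {k w t x}

/-- The algebraic form of the frozen equation. -/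
theorem solvesFrozen_iff {V : Vec3 ℝ} {a β : ℝ} {b : Vec3 ℂ} :
    SolvesFrozen V a β k w b ↔ ∀ i, shiftedFrequency V β k w * b i
      = a * cross k b i + (∑ j, (k j : ℂ) * b j) * (V i : ℂ) := by
  have hrhs : ∀ t x, inductionRHS (fun _ => V) (fun _ => a) β (planeWave k w b t) x
      = phase k w t x • (Complex.I • cross k (cross V b) + Complex.I • cross k (a • b)
        - ((β * ‖k‖ ^ 2 : ℝ) : ℂ) • b) := by
    intro t x
    have h0 : planeWave k w b t = fun y => phase k w t y • b := rfl
    have h1 : (fun y => cross V (planeWave k w b t y)) = fun y => phase k w t y • cross V b := by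
      funext y
      rw [h0]
      ext i
      fin_cases i <;> simp [cross, cross_apply]
    have h2 : (fun y => a • planeWave k w b t y) = fun y => phase k w t y • (a • b) := by
      funext y
      rw [h0, smul_comm]
    rw [inductionRHS, h1, h2, h0, curl_phase_smul, curl_phase_smul, laplacian_phase_smul]
    ext i
    simp
    ring
  have hsol : SolvesFrozen V a β k w b ↔ (Complex.I * w) • b
      = Complex.I • cross k (cross V b) + Complex.I • cross k (a • b)
        - ((β * ‖k‖ ^ 2 : ℝ) : ℂ) • b := by
    constructor
    · intro h
      have h1 := (h 0 0).unique (hasDerivAt_phase_smul k w 0 0 b)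
      rw [hrhs, mul_comm (Complex.I * w), ← smul_smul] at h1
      exact (smul_right_injective _ (phase_ne_zero k w 0 0) h1).symm
    · intro h t x
      rw [hrhs, ← h, smul_smul, mul_comm (phase k w t x)]
      exact hasDerivAt_phase_smul k w t x b
  rw [hsol, PiLp.ext_iff]
  refine forall_congr' fun i => ?_
  have hI := Complex.I_ne_zero
  rw [← sub_eq_zero, ← sub_eq_zero (a := shiftedFrequency V β k w * b i)]
  have key : ((Complex.I * w) • b) i - (Complex.I • cross k (cross V b)
      + Complex.I • cross k (a • b) - ((β * ‖k‖ ^ 2 : ℝ) : ℂ) • b) i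
      = Complex.I * (shiftedFrequency V β k w * b i
        - (a * cross k b i + (∑ j, (k j : ℂ) * b j) * (V i : ℂ))) := by
    have hin : ((inner ℝ V k : ℝ) : ℂ) = V 0 * k 0 + V 1 * k 1 + V 2 * k 2 := by
      simp [PiLp.inner_apply, Fin.sum_univ_three, mul_comm]
    rw [shiftedFrequency, hin]
    fin_cases i <;>
    simp [cross, cross_apply, Fin.sum_univ_three] <;>
    ring_nf <;> simp
  rw [key, mul_eq_zero]
  simp [hI]

/-! ### Dispersion relation -/

variable {V k : Vec3 ℝ} {a β : ℝ} {w : ℂ} {b : Vec3 ℂ}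

theorem modeMatrix_mulVec (Ω : ℂ) (i : Fin 3) :
    (modeMatrix a k Ω *ᵥ WithLp.ofLp b) i = Ω * b i - a * cross k b i := by
  fin_cases i <;>
  simp [modeMatrix, cross, cross_apply, Matrix.mulVec, dotProduct, Fin.sum_univ_three] <;> ring

theorem solvesFrozen_iff_modeMatrix (hb : IsTransverse k b) : SolvesFrozen V a β k w b ↔
    modeMatrix a k (shiftedFrequency V β k w) *ᵥ WithLp.ofLp b = 0 := by
  rw [solvesFrozen_iff, funext_iff]
  refine forall_congr' fun i => ?_
  rw [modeMatrix_mulVec, hb, Pi.zero_apply, sub_eq_zero, zero_mul, add_zero]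

theorem ofReal_norm_sq : ((‖k‖ : ℝ) : ℂ) ^ 2 = (k 0 : ℂ) ^ 2 + (k 1 : ℂ) ^ 2 + (k 2 : ℂ) ^ 2 := by
  rw [← Complex.ofReal_pow, EuclideanSpace.real_norm_sq_eq, Fin.sum_univ_three]
  push_cast
  ring

theorem det_modeMatrix (Ω : ℂ) :
    (modeMatrix a k Ω).det = Ω * (Ω ^ 2 + ((a ^ 2 * ‖k‖ ^ 2 : ℝ) : ℂ)) := by
  push_cast
  rw [ofReal_norm_sq, modeMatrix, Matrix.det_fin_three]
  simp
  ring

theorem shiftedFrequency_sq_add_eq_zero_iff :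
    shiftedFrequency V β k w ^ 2 + ((a ^ 2 * ‖k‖ ^ 2 : ℝ) : ℂ) = 0 ↔
      w = modePlus V a β k ∨ w = modeMinus V a β k := by
  have ha : (((|a| : ℝ) : ℂ)) ^ 2 = (a : ℂ) ^ 2 := by
    rw [← Complex.ofReal_pow, sq_abs, Complex.ofReal_pow]
  have h : shiftedFrequency V β k w ^ 2 + ((a ^ 2 * ‖k‖ ^ 2 : ℝ) : ℂ)
      = (w - modePlus V a β k) * (w - modeMinus V a β k) := by
    rw [shiftedFrequency, modePlus, modeMinus]
    push_cast
    linear_combination (-(‖k‖ : ℂ) ^ 2) * ha + ((‖k‖ : ℂ) ^ 2 * (|a| : ℝ) ^ 2) * Complex.I_sq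
  rw [h, mul_eq_zero, sub_eq_zero, sub_eq_zero]

theorem shiftedFrequency_eq_zero_iff : shiftedFrequency V β k w = 0 ↔ w = modeZero V β k := by
  rw [← sub_eq_zero (b := modeZero V β k), shiftedFrequency, modeZero]
  ring_nf

theorem det_modeMatrix_eq_zero_iff : (modeMatrix a k (shiftedFrequency V β k w)).det = 0 ↔
    w = modeZero V β k ∨ w = modePlus V a β k ∨ w = modeMinus V a β k := by
  rw [det_modeMatrix, mul_eq_zero, shiftedFrequency_eq_zero_iff,
    shiftedFrequency_sq_add_eq_zero_iff]

/-- On transverse amplitudes the operator `b ↦ k × b` squares to `-|k|²`. -/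
theorem cross_cross_of_isTransverse (hb : IsTransverse k b) (i : Fin 3) :
    cross k (cross k b) i = -(‖k‖ : ℂ) ^ 2 * b i := by
  rw [ofReal_norm_sq]
  rw [IsTransverse, Fin.sum_univ_three] at hb
  fin_cases i
  · simp [cross, cross_apply]
    linear_combination (k 0 : ℂ) * hb
  · simp [cross, cross_apply]
    linear_combination (k 1 : ℂ) * hb
  · simp [cross, cross_apply]
    linear_combination (k 2 : ℂ) * hb

theorem cross_const_smul (c : ℂ) (i : Fin 3) : cross k (c • b) i = c * cross k b i := by
  fin_cases i <;> simp [cross, cross_apply]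

theorem isTransverse_cross : IsTransverse k (cross k b) := by
  rw [IsTransverse, Fin.sum_univ_three]
  simp [cross, cross_apply]
  ring

theorem exists_orthogonal (k : Vec3 ℝ) :
    ∃ e : Vec3 ℝ, e ≠ 0 ∧ k 0 * e 0 + k 1 * e 1 + k 2 * e 2 = 0 := by
  by_cases h : k 0 = 0 ∧ k 1 = 0
  · refine ⟨!₂[1, 0, 0], fun h0 => ?_, by simp [h.1]⟩
    simpa using congrArg (fun e : Vec3 ℝ => e 0) h0
  · refine ⟨!₂[-k 1, k 0, 0], fun h0 => h ⟨?_, ?_⟩, by simp; ring⟩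
    · simpa using congrArg (fun e : Vec3 ℝ => e 1) h0
    · simpa using congrArg (fun e : Vec3 ℝ => e 0) h0

/-- Circularly polarized amplitudes: on the transverse plane `b ↦ k × b` has both eigenvalues
`±i|k|`. -/
theorem exists_cross_eigenvector (hk : k ≠ 0) {μ : ℂ} (hre : μ.re = 0)
    (hμ : μ ^ 2 = -(‖k‖ : ℂ) ^ 2) :
    ∃ b : Vec3 ℂ, b ≠ 0 ∧ IsTransverse k b ∧ ∀ i, cross k b i = μ * b i := by
  obtain ⟨e, he, hke⟩ := exists_orthogonal k
  set c : Vec3 ℂ := WithLp.toLp 2 fun i => (e i : ℂ) with hc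
  have hcT : IsTransverse k c := by
    rw [IsTransverse, Fin.sum_univ_three]
    have h := congrArg Complex.ofReal hke
    push_cast at h
    exact h
  refine ⟨μ • c + cross k c, fun h0 => he ?_, ?_, fun i => ?_⟩
  · -- `μ` is imaginary and `c` real, so the imaginary part of the amplitude is `Im μ • e`
    have hne : μ.im ≠ 0 := by
      intro him
      have : μ = 0 := Complex.ext hre him
      rw [this] at hμ
      have h2 : (‖k‖ : ℂ) ^ 2 = 0 := by linear_combination hμ
      simp at h2
      exact hk h2
    ext i
    have h1 := congrArg (fun b : Vec3 ℂ => (b i).im) h0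
    have h3 : (cross k c i).im = 0 := by
      fin_cases i <;> simp [cross, cross_apply, hc]
    have h4 : (c i).im = 0 := by simp [hc]
    have h5 : (c i).re = e i := by simp [hc]
    rw [PiLp.add_apply, PiLp.smul_apply, smul_eq_mul, Complex.add_im, Complex.mul_im, h3, h4, h5,
      mul_zero, zero_add, add_zero] at h1
    exact (mul_eq_zero.1 h1).resolve_left hne
  · have h1 := isTransverse_cross (k := k) (b := c)
    rw [IsTransverse, Fin.sum_univ_three] at h1 hcT ⊢
    simp only [PiLp.add_apply, PiLp.smul_apply, smul_eq_mul]
    linear_combination μ * hcT + h1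
  · have h1 := cross_cross_of_isTransverse hcT i
    have h2 := cross_const_smul (k := k) (b := c) μ i
    have h3 : cross k (μ • c + cross k c) i = cross k (μ • c) i + cross k (cross k c) i := by
      simp only [cross, WithLp.ofLp_add, map_add]
      rfl
    rw [h3, h1, h2]
    simp only [PiLp.add_apply, PiLp.smul_apply, smul_eq_mul]
    linear_combination -(c i) * hμ

theorem exists_isTransverse_solvesFrozen_iff (hk : k ≠ 0) :
    (∃ b : Vec3 ℂ, b ≠ 0 ∧ IsTransverse k b ∧ SolvesFrozen V a β k w b) ↔
      w = modePlus V a β k ∨ w = modeMinus V a β k := by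
  constructor
  · rintro ⟨b, hb0, hb, hs⟩
    rw [← shiftedFrequency_sq_add_eq_zero_iff]
    rw [solvesFrozen_iff] at hs
    have hs' : shiftedFrequency V β k w • b = (a : ℂ) • cross k b := by
      ext i
      have := hs i
      rw [hb, zero_mul, add_zero] at this
      exact this
    obtain ⟨i, hi⟩ : ∃ i, b i ≠ 0 := by
      by_contra! h
      exact hb0 (PiLp.ext h)
    have h1 := congrArg (fun c => cross k c i) hs'
    simp only [cross_const_smul, cross_cross_of_isTransverse hb] at h1
    have h2 := congrArg (fun c : Vec3 ℂ => c i) hs'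
    simp only [PiLp.smul_apply, smul_eq_mul] at h2
    refine (mul_eq_zero.1 ?_).resolve_right hi
    push_cast
    linear_combination shiftedFrequency V β k w * h2 + (a : ℂ) * h1
  · intro hw
    rw [← shiftedFrequency_sq_add_eq_zero_iff (a := a)] at hw
    rcases eq_or_ne a 0 with rfl | ha
    · have h0 : shiftedFrequency V β k w = 0 := by simpa using hw
      obtain ⟨b, hb0, hb, -⟩ := exists_cross_eigenvector hk (μ := Complex.I * ‖k‖) (by simp)
        (by rw [mul_pow, Complex.I_sq]; ring)
      refine ⟨b, hb0, hb, solvesFrozen_iff.2 fun i => ?_⟩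
      rw [h0, hb]
      simp
    · have ha' : (a : ℂ) ≠ 0 := Complex.ofReal_ne_zero.2 ha
      have hμ : (shiftedFrequency V β k w / a) ^ 2 = -(‖k‖ : ℂ) ^ 2 := by
        push_cast at hw
        field_simp
        linear_combination hw
      have hre : (shiftedFrequency V β k w / a).re = 0 := by
        set μ := shiftedFrequency V β k w / a
        have h1 : (μ - Complex.I * ‖k‖) * (μ + Complex.I * ‖k‖) = 0 := by
          linear_combination hμ - (‖k‖ : ℂ) ^ 2 * Complex.I_sq
        rcases mul_eq_zero.1 h1 with h | h
        · simpa using congrArg Complex.re h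
        · simpa using congrArg Complex.re h
      obtain ⟨b, hb0, hb, hbμ⟩ := exists_cross_eigenvector hk hre hμ
      refine ⟨b, hb0, hb, solvesFrozen_iff.2 fun i => ?_⟩
      rw [hb, hbμ]
      field_simp
      ring

/-- A plane wave with `k·b ≠ 0` has the frequency `iβ|k|²`, by the scalar product of the equation
with `k`; a transverse one satisfies the dispersion relation. -/
theorem im_eq_of_solvesFrozen (hb0 : b ≠ 0) (hs : SolvesFrozen V a β k w b) :
    w.im = (modeZero V β k).im ∨ w.im = (modePlus V a β k).im ∨
      w.im = (modeMinus V a β k).im := by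
  by_cases hb : IsTransverse k b
  · have h0 := (solvesFrozen_iff_modeMatrix hb).1 hs
    have hdet : (modeMatrix a k (shiftedFrequency V β k w)).det = 0 :=
      Matrix.exists_mulVec_eq_zero_iff.1 ⟨_, fun h => hb0 (PiLp.ext fun i => congrFun h i), h0⟩
    rcases det_modeMatrix_eq_zero_iff.1 hdet with h | h | h
    · exact .inl (congrArg _ h)
    · exact .inr (.inl (congrArg _ h))
    · exact .inr (.inr (congrArg _ h))
  · left
    have h := solvesFrozen_iff.1 hs
    have hT := isTransverse_cross (k := k) (b := b)
    rw [IsTransverse, Fin.sum_univ_three] at hT hb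
    have hin : ((inner ℝ V k : ℝ) : ℂ) = V 0 * k 0 + V 1 * k 1 + V 2 * k 2 := by
      simp [PiLp.inner_apply, Fin.sum_univ_three, mul_comm]
    have hw : w - Complex.I * ((β * ‖k‖ ^ 2 : ℝ) : ℂ) = 0 := by
      refine (mul_eq_zero.1 ?_).resolve_right hb
      have h0 := h 0
      have h1 := h 1
      have h2 := h 2
      rw [Fin.sum_univ_three, shiftedFrequency, hin] at h0 h1 h2
      linear_combination (k 0 : ℂ) * h0 + (k 1 : ℂ) * h1 + (k 2 : ℂ) * h2 + (a : ℂ) * hT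
    rw [sub_eq_zero.1 hw, modeZero]
    simp

/-! ### Modes of high frequency -/

theorem abs_im_sub_le (hw : w = modeZero V β k ∨ w = modePlus V a β k ∨ w = modeMinus V a β k) :
    |w.im - β * ‖k‖ ^ 2| ≤ |a| * ‖k‖ := by
  have hk := norm_nonneg k
  have ha := abs_nonneg a
  have hak := mul_nonneg ha hk
  rcases hw with rfl | rfl | rfl
  · have : (modeZero V β k).im = β * ‖k‖ ^ 2 := by
      rw [modeZero, Complex.add_im, Complex.neg_im, Complex.ofReal_im, neg_zero, zero_add,
        Complex.I_mul_im, Complex.ofReal_re]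
    rw [this]
    simpa using hak
  · have : (modePlus V a β k).im = ‖k‖ * (β * ‖k‖ + |a|) := by
      rw [modePlus]; simp
    rw [this, abs_le]
    constructor <;> nlinarith
  · have : (modeMinus V a β k).im = ‖k‖ * (β * ‖k‖ - |a|) := by
      rw [modeMinus]; simp
    rw [this, abs_le]
    constructor <;> nlinarith

/-- Beyond the wavenumber `K` the diffusion rate `β|k|²` dominates `|a||k|`, with relative error
at most `ε`, for all `|a| ≤ M`. -/
theorem exists_high_frequency (hβ : 0 < β) (M : ℝ) {ε : ℝ} (hε : 0 < ε) :
    ∃ K : ℝ, ∀ (V k : Vec3 ℝ) (a : ℝ) (w : ℂ), |a| ≤ M → K ≤ ‖k‖ →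
      (w = modeZero V β k ∨ w = modePlus V a β k ∨ w = modeMinus V a β k) →
        0 < w.im ∧ |w.im - β * ‖k‖ ^ 2| ≤ ε * (β * ‖k‖ ^ 2) := by
  refine ⟨max 1 (max ((M + 1) / β) (M / (ε * β))), fun V k a w ha hK hw => ?_⟩
  have h1 : 1 ≤ ‖k‖ := (le_max_left _ _).trans hK
  have h2 : M + 1 ≤ ‖k‖ * β :=
    (div_le_iff₀ hβ).1 (((le_max_left _ _).trans (le_max_right _ _)).trans hK)
  have h3 : M ≤ ‖k‖ * (ε * β) :=
    (div_le_iff₀ (by positivity)).1 (((le_max_right _ _).trans (le_max_right _ _)).trans hK)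
  have h := abs_im_sub_le hw
  have hk : 0 < ‖k‖ := by linarith
  refine ⟨?_, h.trans ?_⟩
  · have h4 := (abs_le.1 h).1
    have h5 : |a| * ‖k‖ < (‖k‖ * β) * ‖k‖ := mul_lt_mul_of_pos_right (by linarith) hk
    nlinarith
  · calc |a| * ‖k‖ ≤ (‖k‖ * (ε * β)) * ‖k‖ := mul_le_mul_of_nonneg_right (ha.trans h3) hk.le
      _ = ε * (β * ‖k‖ ^ 2) := by ring

end

theorem mainTheorem2 (v : ℝ → Vec3 ℝ → Vec3 ℝ) (α : ℝ → Vec3 ℝ → ℝ) (β : ℝ)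
    (hβ : 0 < β)
    (hv : ContDiffOn ℝ ∞ (fun p : ℝ × Vec3 ℝ => v p.1 p.2) (Ici 0 ×ˢ univ))
    (hα : ContDiffOn ℝ ∞ (fun p : ℝ × Vec3 ℝ => α p.1 p.2) (Ici 0 ×ˢ univ))
    (hvb : ∃ M : ℝ, ∀ t : ℝ, 0 ≤ t → ∀ x : Vec3 ℝ, ‖v t x‖ ≤ M)
    (hαb : ∃ M : ℝ, ∀ t : ℝ, 0 ≤ t → ∀ x : Vec3 ℝ, |α t x| ≤ M) :
    -- the equation is well posed in `L²`, without imposing the constraint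
    IsL2WellPosed (fun t B => inductionRHS (v t) (α t) β B) univ ∧
    -- the constrained system, with the electromotive force `αB - β∇×B`, is well posed in `L²`
    IsL2WellPosed (fun t B => dynamoRHS (v t) (α t) β B) {B | ∀ x : Vec3 ℝ, divergence B x = 0} ∧
    -- for divergence-free fields the two right-hand sides agree
    (∀ t : ℝ, 0 ≤ t → ∀ B : Vec3 ℝ → Vec3 ℝ, ContDiff ℝ ∞ B → (∀ x, divergence B x = 0) →
      ∀ x : Vec3 ℝ, dynamoRHS (v t) (α t) β B x = inductionRHS (v t) (α t) β B x) ∧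
    -- the divergence of every solution obeys the heat equation, and the constraint is preserved
    (∀ J : Set ℝ, IsTimeInterval J → ∀ B : ℝ → Vec3 ℝ → Vec3 ℝ,
      IsSmoothSolution (fun t B => inductionRHS (v t) (α t) β B) J B →
        (∀ t ∈ J, ∀ x : Vec3 ℝ, HasDerivWithinAt (fun s => divergence (B s) x)
          (β * Laplacian.laplacian (divergence (B t)) x) J t) ∧
        (HasFiniteEnergy J B → (∀ x : Vec3 ℝ, divergence (B 0) x = 0) →
          ∀ t ∈ J, ∀ x : Vec3 ℝ, divergence (B t) x = 0)) ∧
    -- the modes of the equation with the coefficients frozen at an arbitrary point `(t₀, x₀)`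
    (∀ t₀ : ℝ, 0 ≤ t₀ → ∀ x₀ k : Vec3 ℝ,
      (∀ (w : ℂ) (b : Vec3 ℂ), IsTransverse k b →
        (SolvesFrozen (v t₀ x₀) (α t₀ x₀) β k w b ↔
          modeMatrix (α t₀ x₀) k (shiftedFrequency (v t₀ x₀) β k w) *ᵥ WithLp.ofLp b = 0)) ∧
      (∀ Ω : ℂ, (modeMatrix (α t₀ x₀) k Ω).det
        = Ω * (Ω ^ 2 + (((α t₀ x₀) ^ 2 * ‖k‖ ^ 2 : ℝ) : ℂ))) ∧
      (∀ w : ℂ, (modeMatrix (α t₀ x₀) k (shiftedFrequency (v t₀ x₀) β k w)).det = 0 ↔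
        w = modeZero (v t₀ x₀) β k ∨ w = modePlus (v t₀ x₀) (α t₀ x₀) β k ∨
          w = modeMinus (v t₀ x₀) (α t₀ x₀) β k) ∧
      (k ≠ 0 → ∀ w : ℂ,
        (∃ b : Vec3 ℂ, b ≠ 0 ∧ IsTransverse k b ∧ SolvesFrozen (v t₀ x₀) (α t₀ x₀) β k w b) ↔
          w = modePlus (v t₀ x₀) (α t₀ x₀) β k ∨ w = modeMinus (v t₀ x₀) (α t₀ x₀) β k) ∧
      (∀ (w : ℂ) (b : Vec3 ℂ), b ≠ 0 → SolvesFrozen (v t₀ x₀) (α t₀ x₀) β k w b →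
        w.im = (modeZero (v t₀ x₀) β k).im ∨
          w.im = (modePlus (v t₀ x₀) (α t₀ x₀) β k).im ∨
          w.im = (modeMinus (v t₀ x₀) (α t₀ x₀) β k).im)) ∧
    -- at high frequency all imaginary parts are positive and asymptotic to `β|k|²`
    (∀ ε : ℝ, 0 < ε → ∃ K : ℝ, ∀ t₀ : ℝ, 0 ≤ t₀ → ∀ x₀ k : Vec3 ℝ, K ≤ ‖k‖ → ∀ w : ℂ,
      (w = modeZero (v t₀ x₀) β k ∨ w = modePlus (v t₀ x₀) (α t₀ x₀) β k ∨
          w = modeMinus (v t₀ x₀) (α t₀ x₀) β k) →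
        0 < w.im ∧ |w.im - β * ‖k‖ ^ 2| ≤ ε * (β * ‖k‖ ^ 2)) := by
  obtain ⟨A, hA0, hA⟩ := exists_dynamoCoeff_bound hvb hαb
  obtain ⟨M, hM⟩ := hαb
  refine ⟨isL2WellPosed_inductionRHS hβ hv hα hA0 hA, isL2WellPosed_dynamoRHS hβ hv hα hA0 hA,
    fun t ht B hB hdiv x => dynamoRHS_eq_inductionRHS (contDiff_slice hα ht) β hB hdiv x,
    fun J hJ B hB => ⟨fun t ht x => hB.hasDerivWithinAt_divergence hv hα hJ ht x,
      fun he h0 t ht x => hB.divergence_eq_zero hβ hv hα hA hJ he h0 ht x⟩,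
    fun t₀ _ x₀ k => ⟨fun w b hb => solvesFrozen_iff_modeMatrix hb, det_modeMatrix,
      fun w => det_modeMatrix_eq_zero_iff, fun hk w => exists_isTransverse_solvesFrozen_iff hk,
      fun w b hb0 hs => im_eq_of_solvesFrozen hb0 hs⟩, fun ε hε => ?_⟩
  obtain ⟨K, hK⟩ := exists_high_frequency hβ M hε
  exact ⟨K, fun t₀ ht₀ x₀ k hk w hw => hK (v t₀ x₀) k (α t₀ x₀) w (hM t₀ ht₀ x₀) hk hw⟩
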